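/- **Conventions.** For $n\ge 0$, a permutation $\sigma$ of $[n]=\{1,\dots,n\}$ is written as the word $[\sigma(1),\dots,\sigma(n)]$, and likewise permutations of any finite set $A\subseteq[n]$ are words containing each element of $A$ exactly once; $\overline\sigma$ is the reversed word. A *substring* is a contiguous subword with at least two letters. A *move* $m$ from $\sigma$ to $\gamma$ is a non-empty set of pairwise disjoint substrings of $\sigma$ such that reversing all of them turns $\sigma$ into $\gamma$; its inversion set $\mathrm{Inv}_m$ is the set of pairs $i<j$ lying in a common substring of $m$ (the pairs whose order is reversed). For a set $\Pi$ of permutations, an *allowable sequence* in $\Pi$ from $\sigma$ to $\sigma'$ is a sequence $\sigma=\sigma_0,\dots,\sigma_l=\sigma'$ in $\Pi$ with moves $m_k$ from $\sigma_{k-1}$ to $\sigma_k$ whose inversion sets are pairwise disjoint. A set $\Pi$ of permutations of $A$ forms an *allowable graph of permutations* with set of moves $\mathcal M$ (each $m\in\mathcal M$ being a move between two elements of $\Pi$) if: (P1) $\sigma\in\Pi$ implies $\overline\sigma\in\Pi$; (P2) for all $\sigma,\sigma'\in\Pi$ there is an allowable sequence in $\Pi$ from $\sigma$ to $\sigma'$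 whose moves belong to $\mathcal M$; (P3) for $m,s\in\mathcal M$, either $\mathrm{Inv}_m=\mathrm{Inv}_s$ or $\mathrm{Inv}_m\cap\mathrm{Inv}_s=\emptyset$. The graph itself has vertex set $\Pi$, and its edges are the pairs of permutations that differ by a move in $\mathcal M$. **Theorem.** Let $\Pi\subseteq\mathfrak S_n$ be non-empty and form an allowable graph of permutations with set of moves $\mathcal M$. The following are equivalent. (i) $\Pi$ arises from a sweep oriented matroid: there is an oriented matroid on the ground set $\{(i,j):1\le i<j\le n\}$, all of whose covectors are covectors of the braid oriented matroid (that is, of the form $(\operatorname{sign}(u_j-u_i))_{i<j}$ with $u\in\mathbb R^n$), whose topes (maximal covectors) are exactly the sign-vectors $X^\sigma$, $\sigma\in\Pi$, where $X^\sigma_{(i,j)}=+$ if $i$ precedes $j$ in the word $\sigma$, and $X^\sigma_{(i,j)}=-$ otherwise. (ii) Every potential sweep of $\Pi$ is a sweep of $\Pi$. Here, for ordered partitions $I=(I_1,\dots,I_l)$ and $J=(J_1,\dots,J_r)$ of $[n]$ (with non-empty parts), $I\circ J$ is obtained by replacing each $I_k$ by the sequence of the non-empty sets among $I_k\cap J_1,\dots,I_k\cap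 J_r$; permutations are identified with ordered partitions into singletons; $J$ refines $I$ if each part of $I$ is a union of consecutive parts of $J$. A *sweep* of $\Pi$ is an ordered partition $I$ with $I\circ\sigma\in\Pi$ for all $\sigma\in\Pi$. A *potential sweep* of $\Pi$ is an ordered partition $I$ that is refined by some permutation in $\Pi$ and such that $I\circ\overline\sigma\in\Pi$ for every $\sigma\in\Pi$ that refines $I$. (iii) All contractions of $\Pi$ are allowable graphs of permutations. Here, for a move $m$ of an allowable graph $\Pi'$ on a ground set $A'$, the *elementary contraction* $\Pi'/m$ is the set of words obtained from those $\gamma\in\Pi'$ that are separated by $m$ (or its reverse) from another element of $\Pi'$ by replacing each substring of the move by its minimal letter; its ground set consists of the letters of $A'$ that are in no substring of $m$ together with the minimal letter of each substring of $m$. The *contractions* of $\Pi$ are the sets obtained from $\Pi$ by finitely many (possibly zero) successive elementary contractions. (iv) The graph is in the class $\mathcal F(\mathcal Q^-)$ of Knauer and Marc: it is a partial cube (isomorphic to an isometric subgraph of a hypercube graph) that has no partial cube minor isomorphic to a graph in $\mathcal Q^-=\{Q_n^{-*},\,Q_n^{--}(m): n\ge 4,\ 1\le m\le n\}$. Here a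 partial cube minor is a graph obtained by a sequence of restrictions to halfspaces $\{x: d(x,a)<d(x,b)\}$, for edges $ab$, and of contractions of all the edges of a class of the Djoković–Winkler relation; for a vertex $v$ of the hypercube graph $Q_n$ with antipode $-v$, $Q_n^{-*}$ is $Q_n$ without $-v$ and one neighbour of $v$, and $Q_n^{--}(m)$ is $Q_n$ without $v$, $-v$ and $m$ neighbours of $v$. -/

import Mathlib

/-! Permutations of a finite linearly ordered ground set are written as words: lists without
repetition in which exactly the elements of the ground set occur. The ground set `[n]` is `Fin n`. -/

namespace Sweep

section Words

variable {α : Type*} [LinearOrder α]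

/-- The words that are permutations of the ground set `A`. -/
def IsWordOn (A : Set α) (w : List α) : Prop :=
  w.Nodup ∧ ∀ a, a ∈ w ↔ a ∈ A

/-- `BlockMove L m w w'`: cutting the word `w` into the consecutive non-empty blocks `L`, the blocks
with at least two letters form the non-empty set `m` of disjoint substrings, and reversing all of
them gives the word `w'` (blocks with one letter do not change when they are reversed). -/
def BlockMove (L : List (List α)) (m : Set (List α)) (w w' : List α) : Prop :=
  (∀ b ∈ L, b ≠ []) ∧ L.flatten = w ∧ (L.map List.reverse).flatten = w' ∧
    m = {b | b ∈ L ∧ 2 ≤ b.length} ∧ m.Nonempty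

/-- `m` is a move from `w` to `w'`: a non-empty set of disjoint substrings of `w`, the reversal
of which turns `w` into `w'`. -/
def IsMove (m : Set (List α)) (w w' : List α) : Prop :=
  ∃ L : List (List α), BlockMove L m w w'

/-- The set of inversions of a move: the pairs `i < j` that lie in a common substring, which are
the pairs whose order is reversed by the move. -/
def invSet (m : Set (List α)) : Set (α × α) :=
  {p | p.1 < p.2 ∧ ∃ s ∈ m, p.1 ∈ s ∧ p.2 ∈ s}

/-- There is an allowable sequence in `P` from `σ` to `σ'` all of whose moves belong to `M`: words
`w 0 = σ, …, w l = σ'` of `P` and moves `m k` from `w k` to `w (k + 1)` such that no pair is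
reversed twice. -/
def AllowableSequence (P : Set (List α)) (M : Set (Set (List α))) (σ σ' : List α) : Prop :=
  ∃ (l : ℕ) (w : ℕ → List α) (m : ℕ → Set (List α)),
    w 0 = σ ∧ w l = σ' ∧ (∀ k ≤ l, w k ∈ P) ∧
    (∀ k < l, m k ∈ M ∧ IsMove (m k) (w k) (w (k + 1))) ∧
    (∀ j k, j < k → k < l → Disjoint (invSet (m j)) (invSet (m k)))

/-- The set `P` of permutations of `A` forms an allowable graph of permutations, with `M` as its
set of moves. -/
structure IsAllowableGraph (A : Set α) (P : Set (List α)) (M : Set (Set (List α))) : Prop where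
  words : ∀ w ∈ P, IsWordOn A w
  moves : ∀ m ∈ M, ∃ w ∈ P, ∃ w' ∈ P, IsMove m w w'
  symmetric : ∀ w ∈ P, w.reverse ∈ P
  connected : ∀ σ ∈ P, ∀ σ' ∈ P, AllowableSequence P M σ σ'
  disjoint : ∀ m ∈ M, ∀ s ∈ M, invSet m = invSet s ∨ Disjoint (invSet m) (invSet s)

/-- The graph on `P` whose edges are the pairs that differ by a move in `M`. -/
def moveGraph (P : Set (List α)) (M : Set (Set (List α))) : SimpleGraph P where
  Adj v w := v ≠ w ∧ ∃ m ∈ M, IsMove m v.1 w.1 ∨ IsMove m w.1 v.1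
  symm := ⟨fun _ _ h => ⟨h.1.symm, h.2.imp fun _ hm => ⟨hm.1, hm.2.symm⟩⟩⟩
  loopless := ⟨fun _ h => h.1 rfl⟩

/-- `a` is the minimal letter of the word `b`. -/
def IsMinLetter (b : List α) (a : α) : Prop :=
  a ∈ b ∧ ∀ x ∈ b, a ≤ x

/-- The ground set of the elementary contraction by `m`: the letters outside the substrings of `m`
and the minimal letter of each substring. -/
def contractGround (A : Set α) (m : Set (List α)) : Set α :=
  {a | a ∈ A ∧ ∀ s ∈ m, a ∈ s → IsMinLetter s a}

/-- The elementary contraction `P / m`: each `γ ∈ P` that `m` (or its reverse) separates from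
another `γ' ∈ P` contributes the word obtained by replacing every reversed substring of `γ` by its
minimal letter (a block with one letter is replaced by that letter). -/
def contractWords (P : Set (List α)) (m : Set (List α)) : Set (List α) :=
  {v | ∃ γ ∈ P, ∃ γ' ∈ P, ∃ L : List (List α), ∃ m' : Set (List α),
    (m' = m ∨ m' = List.reverse '' m) ∧ BlockMove L m' γ γ' ∧ List.Forall₂ IsMinLetter L v}

/-- `(A', P')` is a contraction of `(A, P)`: it is obtained by a finite (possibly empty) sequence
of elementary contractions by moves. -/
inductive IsContraction (A : Set α) (P : Set (List α)) : Set α → Set (List α) → Prop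
  | refl : IsContraction A P A P
  | step {A' : Set α} {P' : Set (List α)} {M' : Set (Set (List α))} {m : Set (List α)} :
      IsContraction A P A' P' → IsAllowableGraph A' P' M' → m ∈ M' →
      IsContraction A P (contractGround A' m) (contractWords P' m)

/-- Ordered partitions `(I₁, …, I_l)` of `α`. -/
def IsOrderedPartition (I : List (Finset α)) : Prop :=
  (∀ B ∈ I, B.Nonempty) ∧ I.Pairwise Disjoint ∧ ∀ a, ∃ B ∈ I, a ∈ B

/-- A permutation, as an ordered partition into singletons. -/
def singletons (w : List α) : List (Finset α) :=
  w.map fun a => {a}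

/-- `J` refines `I`: each part of `I` is the union of consecutive parts of `J`. -/
def Refines (J I : List (Finset α)) : Prop :=
  ∃ L : List (List (Finset α)), L.flatten = J ∧ L.map (fun K => K.foldr (· ∪ ·) ∅) = I

/-- The composition `I ∘ J` of ordered partitions: each part `B` of `I` is replaced by the sequence
of the non-empty sets among `B ∩ J₁, B ∩ J₂, …`. -/
def comp (I J : List (Finset α)) : List (Finset α) :=
  I.flatMap fun B => (J.map (B ∩ ·)).filter (· ≠ ∅)

/-- The ordered partition `I` is a sweep of `P`. -/
def IsSweep (P : Set (List α)) (I : List (Finset α)) : Prop :=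
  IsOrderedPartition I ∧ ∀ σ ∈ P, ∃ τ ∈ P, comp I (singletons σ) = singletons τ

/-- The ordered partition `I` is a potential sweep of `P`. -/
def IsPotentialSweep (P : Set (List α)) (I : List (Finset α)) : Prop :=
  IsOrderedPartition I ∧ (∃ σ ∈ P, Refines (singletons σ) I) ∧
    ∀ σ ∈ P, Refines (singletons σ) I → ∃ τ ∈ P, comp I (singletons σ.reverse) = singletons τ

end Words

/-- The words `[σ(1), …, σ(n)]` of the permutations in `P`. -/
def permWords {n : ℕ} (P : Set (Equiv.Perm (Fin n))) : Set (List (Fin n)) :=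
  (fun σ : Equiv.Perm (Fin n) => List.ofFn fun k => σ k) '' P

section OrientedMatroids

variable {E : Type*}

/-- The composition `X ∘ Y` of sign-vectors. -/
def signComp (X Y : E → SignType) : E → SignType :=
  fun e => if X e ≠ 0 then X e else Y e

/-- The separation set of two sign-vectors. -/
def sepSet (X Y : E → SignType) : Set E :=
  {e | X e ≠ 0 ∧ Y e = -X e}

/-- The covector axioms of an oriented matroid on the ground set `E`. -/
structure IsOrientedMatroid (L : Set (E → SignType)) : Prop where
  zero_mem : (fun _ => 0) ∈ L
  neg_mem : ∀ X ∈ L, (fun e => -X e) ∈ L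
  comp_mem : ∀ X ∈ L, ∀ Y ∈ L, signComp X Y ∈ L
  elim : ∀ X ∈ L, ∀ Y ∈ L, ∀ e ∈ sepSet X Y,
    ∃ Z ∈ L, Z e = 0 ∧ ∀ f, f ∉ sepSet X Y → Z f = signComp X Y f

/-- The topes: the covectors that are maximal for the product order induced by `0 ≺ +, -`. -/
def topes (L : Set (E → SignType)) : Set (E → SignType) :=
  {X | X ∈ L ∧ ∀ Y ∈ L, (∀ e, X e = 0 ∨ X e = Y e) → Y = X}

/-- The covectors of the oriented matroid associated to a real vector configuration. -/
def vectorCovectors {ι : Type*} [Fintype ι] (v : E → ι → ℝ) : Set (E → SignType) :=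
  {X | ∃ u : ι → ℝ, ∀ e, X e = SignType.sign (u ⬝ᵥ v e)}

end OrientedMatroids

/-- The pairs `(i, j)` with `i < j`. -/
abbrev Pairs (n : ℕ) : Type := {p : Fin n × Fin n // p.1 < p.2}

/-- The covectors of the braid oriented matroid, given by the vectors `e_j - e_i` for `i < j`. -/
def braidCovectors (n : ℕ) : Set (Pairs n → SignType) :=
  vectorCovectors fun p : Pairs n =>
    (Pi.single p.1.2 (1 : ℝ) - Pi.single p.1.1 (1 : ℝ) : Fin n → ℝ)

/-- Sweep oriented matroids: oriented matroids on the pairs `i < j` all of whose covectors are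
covectors of the braid oriented matroid. -/
def IsSweepOrientedMatroid {n : ℕ} (L : Set (Pairs n → SignType)) : Prop :=
  IsOrientedMatroid L ∧ L ⊆ braidCovectors n

/-- The sign-vector of a permutation: `+` at `(i, j)` if `i` comes before `j` in the word
`[σ(1), …, σ(n)]`, and `-` otherwise. -/
def signVector {n : ℕ} (σ : Equiv.Perm (Fin n)) : Pairs n → SignType :=
  fun p => if σ.symm p.1.1 < σ.symm p.1.2 then 1 else -1

/-- `P` arises from a sweep oriented matroid: the topes of some sweep oriented matroid are the
sign-vectors of the permutations in `P`. -/
def ArisesFromSweepOrientedMatroid {n : ℕ} (P : Set (Equiv.Perm (Fin n))) : Prop :=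
  ∃ L : Set (Pairs n → SignType), IsSweepOrientedMatroid L ∧ topes L = signVector '' P

section PartialCubes

/-- Partial cubes: graphs isomorphic to isometric subgraphs of a hypercube graph. -/
def IsPartialCube {V : Type} (G : SimpleGraph V) : Prop :=
  G.Connected ∧ ∃ (k : ℕ) (φ : V → Fin k → Bool),
    ∀ u v, G.dist u v = hammingDist (φ u) (φ v)

/-- The halfspace of the vertices that are closer to `a` than to `b`. -/
def halfspace {V : Type} (G : SimpleGraph V) (a b : V) : Set V :=
  {x | G.dist x a < G.dist x b}

/-- The spanning subgraph formed by the edges that are in Djoković–Winkler relation `Θ` with the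
edge `ab`. In a partial cube these edges form the `Θ`-class of `ab`. -/
def thetaGraph {V : Type} (G : SimpleGraph V) (a b : V) : SimpleGraph V where
  Adj x y := G.Adj x y ∧ G.dist a x + G.dist b y ≠ G.dist a y + G.dist b x
  symm := ⟨fun _ _ h => ⟨h.1.symm, h.2.symm⟩⟩
  loopless := ⟨fun _ h => h.2 rfl⟩

/-- The contraction of all edges in the `Θ`-class of `ab`. -/
def contractClass {V : Type} (G : SimpleGraph V) (a b : V) :
    SimpleGraph (thetaGraph G a b).ConnectedComponent where
  Adj c d := c ≠ d ∧ ∃ x y, (thetaGraph G a b).connectedComponentMk x = c ∧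
    (thetaGraph G a b).connectedComponentMk y = d ∧ G.Adj x y
  symm := ⟨fun _ _ ⟨hne, x, y, hx, hy, h⟩ => ⟨hne.symm, y, x, hy, hx, h.symm⟩⟩
  loopless := ⟨fun _ h => h.1 rfl⟩

/-- `HasPCMinor H V G`: the graph `H` is, up to isomorphism, a partial cube minor of the graph `G`
on `V`, that is, it is obtained from `G` by a sequence of restrictions to halfspaces and contractions
of `Θ`-classes. -/
inductive HasPCMinor {W : Type} (H : SimpleGraph W) : (V : Type) → SimpleGraph V → Prop
  | iso {V : Type} {G : SimpleGraph V} : Nonempty (G ≃g H) → HasPCMinor H V G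
  | restrict {V : Type} {G : SimpleGraph V} {a b : V} : G.Adj a b →
      HasPCMinor H (halfspace G a b) (G.induce (halfspace G a b)) → HasPCMinor H V G
  | contract {V : Type} {G : SimpleGraph V} {a b : V} : G.Adj a b →
      HasPCMinor H (thetaGraph G a b).ConnectedComponent (contractClass G a b) → HasPCMinor H V G

/-- The hypercube graph `Q_n`. -/
def hypercube (n : ℕ) : SimpleGraph (Fin n → Bool) where
  Adj x y := hammingDist x y = 1
  symm := ⟨fun x y h => by rw [hammingDist_comm]; exact h⟩
  loopless := ⟨fun x h => by simp at h⟩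

/-- The neighbour of the vertex `v = (0, …, 0)` of the hypercube in direction `i`. -/
def cubeNeighbor (n : ℕ) (i : Fin n) : Fin n → Bool :=
  fun j => decide (j = i)

/-- The vertices of `Q_n^{-*}`: those of `Q_n` except the antipode `-v` of `v = (0, …, 0)` and one
neighbour of `v` (by symmetry, the choice of the direction `i` is immaterial). -/
def starVerts (n : ℕ) (i : Fin n) : Set (Fin n → Bool) :=
  {x | x ≠ (fun _ => true) ∧ x ≠ cubeNeighbor n i}

/-- The vertices of `Q_n^{--}(m)` with `m = |S|`: those of `Q_n` except `v = (0, …, 0)`, its antipode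
`-v`, and the `m` neighbours of `v` in the directions of `S` (by symmetry, only `|S|` matters). -/
def minusMinusVerts (n : ℕ) (S : Finset (Fin n)) : Set (Fin n → Bool) :=
  {x | x ≠ (fun _ => false) ∧ x ≠ (fun _ => true) ∧ ∀ i ∈ S, x ≠ cubeNeighbor n i}

/-- The class `F(Q⁻)`: the partial cubes that have no partial cube minor in the family
`Q⁻ = {Q_n^{-*}, Q_n^{--}(m) : 4 ≤ n, 1 ≤ m ≤ n}`. -/
def InFQMinus {V : Type} (G : SimpleGraph V) : Prop :=
  IsPartialCube G ∧ ∀ n : ℕ, 4 ≤ n →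
    (∀ i : Fin n, ¬ HasPCMinor ((hypercube n).induce (starVerts n i)) V G) ∧
    (∀ S : Finset (Fin n), S.Nonempty →
      ¬ HasPCMinor ((hypercube n).induce (minusMinusVerts n S)) V G)

end PartialCubes

end Sweep

/-! A permutation is encoded by the sign-vector `wordSigns`, which records for each ordered pair of
letters which of them comes first. Reversing the word is negation, and a move changes the signs of
the pairs inside its substrings. Let G be the set of these sign-vectors for Π. A sign-vector X cuts
out the face of all T in G that extend its non-zero entries. The face is antipodal if it is
non-empty and closed under T ↦ X∘(-T); it is gated if X∘T and X∘(-T) lie in G for every T in G, so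
that X acts on G like a covector. Each of the four conditions turns out to say the same thing: all
antipodal faces of G are gated (`AntipodalGated`).

Condition (ii). Axioms (P2) and (P3) force every antipodal face to be a weak order, hence an ordered
partition (`IsAllowableGraph.isWeakOrder`). Potential sweeps are the antipodal faces and sweeps are
the gated ones.

Condition (i). In a complex of oriented matroids an antipodal face is always a covector
(`IsCOM.mem_of_isAntipodalFace`), hence gated. Conversely the gated covectors are closed under
composition and, G being antipodal, under negation; the hard point is elimination
(`isCOM_and_antipodalOfContraction`), proved by induction on the number of coordinates. Two
covectors that vanish at a common coordinate a are eliminated in the contraction at a. This needs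
antipodal faces of the contraction to be gated in G, which rests on a companion statement: G is
antipodal as soon as one of its non-empty contractions is. The recurring device is an interval: if B
is missing from G and R is a nearest other missing vector, the interval between them lacks only B
and R, so it is an antipodal face, and gating by it would put B or R into G.

Condition (iv). The pairs reversed by a move form a parallel class. With one representative per
class (`IsTransversal`) the graph becomes an isometric subgraph of a cube; restriction to a
halfspace is passing to a face, and contraction of a Θ-class is deletion of a coordinate. A
minor-minimal set with an ungated antipodal face is a cube with very few vertices missing
(`exists_isCubeDefect`), and these are exactly the members of Q⁻. Conversely complexes of oriented
matroids pass to minors, and no member of Q⁻ is the tope graph of one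
(`IsSignEmbedding.not_com_of_side`).

Condition (iii). Contractions of sweep oriented matroids are again of this kind
(`IsAllowableGraph.isSweepGraph_contract`), and their permutations form an allowable graph, the
moves being passages through walls (`IsSweepGraph.exists_isAllowableGraph`). Conversely, an
antipodal face that vanishes on a move is an antipodal face of the contraction by this move, so
gatedness follows by induction on the ground set (`antipodalGated_of_contractions`). -/

namespace Sweep

/-! ### Sign-vectors: antipodal faces, gated covectors, and complexes of oriented matroids. -/

section SignVectors

variable {E : Type*}

/-- `X` conforms to `T`: `T` extends the non-zero entries of `X`. -/
def Conf (X T : E → SignType) : Prop :=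
  ∀ e, X e ≠ 0 → T e = X e

open Classical in
/-- Setting the entries in `S` to zero. -/
noncomputable def zeroOn (S : Set E) (X : E → SignType) : E → SignType :=
  fun e => if e ∈ S then 0 else X e

open Classical in
/-- Changing the sign of one entry. -/
noncomputable def flipAt (f : E) (X : E → SignType) : E → SignType :=
  fun e => if e = f then -X e else X e

/-- The face of `X` in `G` is non-empty and antipodal. -/
def IsAntipodalFace (G : Set (E → SignType)) (X : E → SignType) : Prop :=
  (∃ T ∈ G, Conf X T) ∧ ∀ T ∈ G, Conf X T → signComp X (-T) ∈ G

/-- The sign-vectors that act on `G` by composition. -/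
def gatedCovectors (G : Set (E → SignType)) : Set (E → SignType) :=
  {X | ∀ T ∈ G, signComp X T ∈ G ∧ signComp X (-T) ∈ G}

/-- All antipodal faces of `G` are gated. -/
def AntipodalGated (G : Set (E → SignType)) : Prop :=
  ∀ X, IsAntipodalFace G X → X ∈ gatedCovectors G

/-- `G` is a set of sign-vectors with common support `D` that is isometric in the cube. -/
structure IsIsometric (D : Set E) (G : Set (E → SignType)) : Prop where
  supp : ∀ T ∈ G, ∀ e, T e ≠ 0 ↔ e ∈ D
  nonempty : G.Nonempty
  flip : ∀ T ∈ G, ∀ T' ∈ G, T ≠ T' → ∃ e, T e ≠ T' e ∧ flipAt e T ∈ G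

/-- The covector axioms of a complex of oriented matroids. -/
structure IsCOM (L : Set (E → SignType)) : Prop where
  face : ∀ X ∈ L, ∀ Y ∈ L, signComp X (-Y) ∈ L
  elim : ∀ X ∈ L, ∀ Y ∈ L, ∀ e ∈ sepSet X Y,
    ∃ Z ∈ L, Z e = 0 ∧ ∀ f, f ∉ sepSet X Y → Z f = signComp X Y f

/-- The elements of `L` with support `D`. -/
def fullTopes (D : Set E) (L : Set (E → SignType)) : Set (E → SignType) :=
  {T | T ∈ L ∧ ∀ e, T e ≠ 0 ↔ e ∈ D}

theorem signComp_of_ne {X Y : E → SignType} {e : E} (h : X e ≠ 0) : signComp X Y e = X e := by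
  simp [signComp, h]

theorem signComp_of_eq {X Y : E → SignType} {e : E} (h : X e = 0) : signComp X Y e = Y e := by
  simp [signComp, h]

theorem signComp_assoc (X Y Z : E → SignType) :
    signComp (signComp X Y) Z = signComp X (signComp Y Z) := by
  funext e
  by_cases h : X e = 0 <;> simp [signComp, h]

theorem neg_signComp (X Y : E → SignType) : -signComp X Y = signComp (-X) (-Y) := by
  funext e
  by_cases h : X e = 0 <;> simp [signComp, h]

theorem zeroOn_of_mem {S : Set E} {X : E → SignType} {e : E} (h : e ∈ S) : zeroOn S X e = 0 := by
  simp [zeroOn, h]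

theorem zeroOn_of_notMem {S : Set E} {X : E → SignType} {e : E} (h : e ∉ S) :
    zeroOn S X e = X e := by
  simp [zeroOn, h]

theorem zeroOn_signComp (S : Set E) (X Y : E → SignType) :
    zeroOn S (signComp X Y) = signComp (zeroOn S X) (zeroOn S Y) := by
  funext e
  by_cases h : e ∈ S <;> simp [signComp, zeroOn, h]

theorem zeroOn_neg (S : Set E) (X : E → SignType) : zeroOn S (-X) = -zeroOn S X := by
  funext e
  by_cases h : e ∈ S <;> simp [zeroOn, h]

theorem flipAt_self (f : E) (X : E → SignType) : flipAt f X f = -X f := by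
  simp [flipAt]

theorem flipAt_of_ne {f e : E} (X : E → SignType) (h : e ≠ f) : flipAt f X e = X e := by
  simp [flipAt, h]

theorem flipAt_flipAt (f : E) (X : E → SignType) : flipAt f (flipAt f X) = X := by
  funext e
  by_cases h : e = f <;> simp [flipAt, h]

theorem flipAt_comm (e f : E) (X : E → SignType) :
    flipAt e (flipAt f X) = flipAt f (flipAt e X) := by
  funext g
  unfold flipAt
  split_ifs <;> rfl

theorem flipAt_neg (f : E) (X : E → SignType) : flipAt f (-X) = -flipAt f X := by
  funext e
  by_cases h : e = f <;> simp [flipAt, h]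

theorem zeroOn_flipAt_of_mem {S : Set E} {f : E} (h : f ∈ S) (X : E → SignType) :
    zeroOn S (flipAt f X) = zeroOn S X := by
  funext e
  by_cases h' : e ∈ S
  · simp [zeroOn, h']
  · have : e ≠ f := fun hh => h' (hh ▸ h)
    simp [zeroOn, h', flipAt, this]

theorem zeroOn_flipAt_of_notMem {S : Set E} {f : E} (h : f ∉ S) (X : E → SignType) :
    zeroOn S (flipAt f X) = flipAt f (zeroOn S X) := by
  funext e
  by_cases h' : e ∈ S <;> by_cases h'' : e = f <;> simp_all [zeroOn, flipAt]

theorem sign_eq_neg_of_ne {a b : SignType} (ha : a ≠ 0) (hb : b ≠ 0) (h : a ≠ b) : b = -a := by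
  revert a b; decide

theorem sign_ne_neg_self {a : SignType} (ha : a ≠ 0) : a ≠ -a := by
  revert a; decide

theorem Conf.signComp (X Y : E → SignType) : Conf X (signComp X Y) :=
  fun _ => signComp_of_ne

theorem Conf.trans {X Y Z : E → SignType} (h : Conf X Y) (h' : Conf Y Z) : Conf X Z := fun e he => by
  rw [h' e (by rw [h e he]; exact he), h e he]

theorem Conf.signComp_eq {X T : E → SignType} (h : Conf X T) : Sweep.signComp X T = T := by
  funext e
  by_cases he : X e = 0
  · exact signComp_of_eq he
  · rw [signComp_of_ne he, h e he]

theorem mem_sepSet {X Y : E → SignType} {e : E} : e ∈ sepSet X Y ↔ X e ≠ 0 ∧ Y e = -X e := Iff.rfl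

theorem signComp_neg_signComp (X T : E → SignType) :
    signComp X (-signComp X T) = signComp X (-T) := by
  funext e
  by_cases h : X e = 0 <;> simp [signComp, h]

theorem signComp_neg_signComp_neg (X T : E → SignType) :
    signComp X (-signComp X (-T)) = signComp X T := by
  rw [signComp_neg_signComp, neg_neg]

/-! ### Complexes of oriented matroids -/

/-- Two applications of face symmetry: X∘(-(X∘(-Y))) = X∘Y. -/
theorem IsCOM.comp {L : Set (E → SignType)} (hL : IsCOM L) {X Y : E → SignType} (hX : X ∈ L)
    (hY : Y ∈ L) : signComp X Y ∈ L := by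
  have := hL.face X hX _ (hL.face X hX Y hY)
  rwa [signComp_neg_signComp_neg] at this

theorem IsCOM.zeroOn_image {L : Set (E → SignType)} (hL : IsCOM L) (S : Set E) :
    IsCOM (zeroOn S '' L) := by
  constructor
  · rintro _ ⟨X, hX, rfl⟩ _ ⟨Y, hY, rfl⟩
    exact ⟨_, hL.face X hX Y hY, by rw [zeroOn_signComp, zeroOn_neg]⟩
  · rintro _ ⟨X, hX, rfl⟩ _ ⟨Y, hY, rfl⟩ e he
    have heS : e ∉ S := fun h => he.1 (zeroOn_of_mem h)
    have he' : e ∈ sepSet X Y := by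
      have := he
      simpa [sepSet, zeroOn, heS] using this
    obtain ⟨Z, hZ, hZe, hZf⟩ := hL.elim X hX Y hY e he'
    refine ⟨_, ⟨Z, hZ, rfl⟩, by rw [zeroOn_of_notMem heS, hZe], fun f hf => ?_⟩
    rw [← zeroOn_signComp]
    by_cases hfS : f ∈ S
    · rw [zeroOn_of_mem hfS, zeroOn_of_mem hfS]
    · rw [zeroOn_of_notMem hfS, zeroOn_of_notMem hfS]
      apply hZf
      simpa [sepSet, zeroOn, hfS] using hf

theorem IsCOM.contract {L : Set (E → SignType)} (hL : IsCOM L) (S : Set E) :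
    IsCOM {X | X ∈ L ∧ ∀ e ∈ S, X e = 0} := by
  constructor
  · rintro X ⟨hX, hX'⟩ Y ⟨hY, hY'⟩
    exact ⟨hL.face X hX Y hY, fun e he => by simp [signComp, hX' e he, hY' e he]⟩
  · rintro X ⟨hX, hX'⟩ Y ⟨hY, hY'⟩ e he
    obtain ⟨Z, hZ, hZe, hZf⟩ := hL.elim X hX Y hY e he
    refine ⟨Z, ⟨hZ, fun f hf => ?_⟩, hZe, hZf⟩
    rw [hZf f (fun h => h.1 (hX' f hf))]
    simp [signComp, hX' f hf, hY' f hf]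

theorem IsCOM.halfspace {L : Set (E → SignType)} (hL : IsCOM L) (f : E) {s : SignType}
    (hs : s ≠ 0) : IsCOM {X | X ∈ L ∧ X f = s} := by
  constructor
  · rintro X ⟨hX, hX'⟩ Y ⟨hY, hY'⟩
    exact ⟨hL.face X hX Y hY, by simp [signComp, hX', hs]⟩
  · rintro X ⟨hX, hX'⟩ Y ⟨hY, hY'⟩ e he
    obtain ⟨Z, hZ, hZe, hZf⟩ := hL.elim X hX Y hY e he
    refine ⟨Z, ⟨hZ, ?_⟩, hZe, hZf⟩
    rw [hZf f (fun h => sign_ne_neg_self hs (by have := h.2; rwa [hX', hY'] at this))]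
    rw [signComp_of_ne (by rw [hX']; exact hs), hX']

/-- In a complex of oriented matroids, a sign-vector whose face is antipodal is a covector. -/
theorem IsCOM.mem_of_isAntipodalFace [Finite E] {L : Set (E → SignType)} (hL : IsCOM L) (D : Set E)
    (hD : ∀ Z ∈ L, ∀ e, Z e ≠ 0 → e ∈ D) {X : E → SignType}
    (hX : IsAntipodalFace (fullTopes D L) X) : X ∈ L := by
  induction hn : D.ncard using Nat.strong_induction_on generalizing D L with
  | _ n ih =>
  obtain ⟨⟨T, hT, hXT⟩, hanti⟩ := hX
  by_cases hfull : ∀ e ∈ D, X e ≠ 0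
  · have : X = T := by
      funext e
      by_cases he : X e = 0
      · have : e ∉ D := fun h => hfull e h he
        rw [he]
        by_contra h
        exact this ((hT.2 e).1 (Ne.symm h))
      · exact (hXT e he).symm
    rw [this]; exact hT.1
  push Not at hfull
  obtain ⟨e, heD, hXe⟩ := hfull
  have hsuppX : ∀ f, X f ≠ 0 → f ∈ D := fun f hf => (hT.2 f).1 (by rw [hXT f hf]; exact hf)
  -- `T` and its opposite X∘(-T) in the face agree on the support of `X` and differ at `e`, so
  -- eliminating `e` keeps `X` intact.
  have key : ∀ T ∈ fullTopes D L, Conf X T → ∃ Z ∈ L, Z e = 0 ∧ Conf X Z := by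
    intro T hT hXT
    obtain ⟨Z, hZ, hZe, hZf⟩ := hL.elim T hT.1 _ (hanti T hT hXT).1 e
      ⟨(hT.2 e).2 heD, by simp [signComp, hXe]⟩
    refine ⟨Z, hZ, hZe, fun f hf => ?_⟩
    rw [hZf f, signComp_of_ne (by rw [hXT f hf]; exact hf), hXT f hf]
    rintro ⟨-, h⟩
    rw [signComp_of_ne hf, hXT f hf] at h
    exact sign_ne_neg_self hf h
  obtain ⟨Z0, hZ0, hZ0e, hXZ0⟩ := key T hT hXT
  -- a covector of maximal support among those that vanish at `e`
  obtain ⟨Z1, ⟨hZ1, hZ1e⟩, hZ1max⟩ := Set.exists_max_image {Z | Z ∈ L ∧ Z e = 0}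
    (fun Z => {f | Z f ≠ 0}.ncard) (Set.toFinite _) ⟨Z0, hZ0, hZ0e⟩
  set D' : Set E := {f | Z1 f ≠ 0} with hD'
  set L' : Set (E → SignType) := {Z | Z ∈ L ∧ ∀ f ∈ ({e} : Set E), Z f = 0} with hL'
  -- Composing `Z1` with `Z` cannot enlarge its support, so the support of `Z1` contains all the
  -- others.
  have hsupp' : ∀ Z ∈ L', ∀ f, Z f ≠ 0 → f ∈ D' := by
    rintro Z ⟨hZ, hZe⟩ f hf
    have h1 : signComp Z1 Z ∈ {Z | Z ∈ L ∧ Z e = 0} :=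
      ⟨hL.comp hZ1 hZ, by simp [signComp, hZ1e, hZe e rfl]⟩
    have h2 := hZ1max _ h1
    have h3 : D' ⊆ {f | signComp Z1 Z f ≠ 0} := fun g hg => by
      change signComp Z1 Z g ≠ 0
      rw [signComp_of_ne hg]; exact hg
    have h4 := Set.eq_of_subset_of_ncard_le h3 h2 (Set.toFinite _)
    rw [h4]
    change signComp Z1 Z f ≠ 0
    by_cases h : Z1 f = 0
    · rw [signComp_of_eq h]; exact hf
    · rw [signComp_of_ne h]; exact h
  have heD' : e ∉ D' := fun h => h hZ1e
  have hD'D : D' ⊆ D := fun f hf => hD Z1 hZ1 f hf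
  refine (ih D'.ncard ?_ (hL.contract {e}) D' hsupp' ⟨?_, ?_⟩ rfl).1
  · rw [← hn]
    exact Set.ncard_lt_ncard ⟨hD'D, fun h => heD' (h heD)⟩ (Set.toFinite _)
  · refine ⟨signComp Z0 Z1, ⟨⟨hL.comp hZ0 hZ1, ?_⟩, fun f => ⟨fun h => ?_, fun h => ?_⟩⟩, ?_⟩
    · rintro f rfl
      simp [signComp, hZ0e, hZ1e]
    · by_cases h' : Z0 f = 0
      · rw [signComp_of_eq h'] at h; exact h
      · exact hsupp' Z0 ⟨hZ0, by rintro f rfl; exact hZ0e⟩ f h'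
    · by_cases h' : Z0 f = 0
      · rw [signComp_of_eq h']; exact h
      · rw [signComp_of_ne h']; exact h'
    · exact hXZ0.trans (Conf.signComp _ _)
  · rintro Y ⟨⟨hY, hYe⟩, hYD'⟩ hXY
    have hYT : ∀ T' ∈ fullTopes D L, signComp Y T' ∈ fullTopes D L := by
      rintro T' ⟨hT', hT'D⟩
      refine ⟨hL.comp hY hT', fun f => ?_⟩
      by_cases h : Y f = 0
      · rw [signComp_of_eq h]; exact hT'D f
      · rw [signComp_of_ne h]; exact ⟨fun _ => hD Y hY f h, fun _ => h⟩
    -- The opposites of Y∘T and of Y∘(X∘(-T)) both agree with X∘(-Y) on `D'` and have opposite signs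
    -- at `e`. Eliminating `e` between them leaves X∘(-Y), since a covector vanishing at `e` has no
    -- support outside `D'`.
    have hW := hanti _ (hYT T hT) (hXY.trans (Conf.signComp _ _))
    have hW' := hanti _ (hYT _ (hanti T hT hXT)) (hXY.trans (Conf.signComp _ _))
    obtain ⟨Z, hZ, hZe, hZf⟩ := hL.elim _ hW.1 _ hW'.1 e ⟨(hW.2 e).2 heD, by
      simp [signComp, hXe, hYe e rfl]⟩
    have hZL' : Z ∈ L' := ⟨hZ, by rintro f rfl; exact hZe⟩
    have : Z = signComp X (-Y) := by
      funext f
      by_cases hf : f ∈ D'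
      · have hYf := (hYD' f).2 hf
        have hns : f ∉ sepSet (signComp X (-signComp Y T))
            (signComp X (-signComp Y (signComp X (-T)))) := by
          rintro ⟨h1, h2⟩
          have : signComp X (-signComp Y (signComp X (-T))) f =
              signComp X (-signComp Y T) f := by
            simp [signComp, hYf]
          rw [this] at h2
          exact sign_ne_neg_self h1 h2
        rw [hZf f hns]
        by_cases hx : X f = 0 <;> simp [signComp, hYf, hx]
      · have hZ0 : Z f = 0 := by
          by_contra h
          exact hf (hsupp' Z hZL' f h)
        have hY0 : Y f = 0 := by
          by_contra h
          exact hf ((hYD' f).1 h)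
        have hX0 : X f = 0 := by
          by_contra h
          exact h ((hXY f h).symm.trans hY0)
        simp [hZ0, signComp, hX0, hY0]
    refine ⟨this ▸ hZL', fun f => ?_⟩
    rw [← hYD' f]
    by_cases hx : X f = 0
    · simp [signComp, hx]
    · rw [signComp_of_ne hx, hXY f hx]

/-- The face of `X` in `G`, with the entries in the support of `X` set to zero. -/
def starOf (G : Set (E → SignType)) (X : E → SignType) : Set (E → SignType) :=
  {T | signComp X T ∈ G ∧ ∀ e, X e ≠ 0 → T e = 0}

/-- The contraction of the element `e`. -/
def contrAt (e : E) (G : Set (E → SignType)) : Set (E → SignType) :=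
  {T | ∃ T' ∈ G, flipAt e T' ∈ G ∧ T = zeroOn {e} T'}

/-- If a contraction of an element is antipodal, so is `G`. -/
def AntipodalOfContraction (D : Set E) (G : Set (E → SignType)) : Prop :=
  ∀ e ∈ D, (contrAt e G).Nonempty → (∀ T ∈ contrAt e G, -T ∈ contrAt e G) → ∀ T ∈ G, -T ∈ G

open Classical in
/-- The common part of two sign-vectors. -/
noncomputable def agree (B R : E → SignType) : E → SignType :=
  fun e => if B e = R e then B e else 0

theorem eq_of_full {D : Set E} {T T' : E → SignType} (hT : ∀ e, T e ≠ 0 ↔ e ∈ D)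
    (hT' : ∀ e, T' e ≠ 0 ↔ e ∈ D) {e : E} (h : T e ≠ T' e) : T' e = -T e := by
  by_cases he : e ∈ D
  · exact sign_eq_neg_of_ne ((hT e).2 he) ((hT' e).2 he) h
  · have h1 : T e = 0 := by by_contra h; exact he ((hT e).1 h)
    have h2 : T' e = 0 := by by_contra h; exact he ((hT' e).1 h)
    simp [h1, h2]

theorem full_eq_zero {D : Set E} {T : E → SignType} (hT : ∀ e, T e ≠ 0 ↔ e ∈ D) {e : E}
    (he : e ∉ D) : T e = 0 := by
  by_contra h; exact he ((hT e).1 h)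

theorem full_neg {D : Set E} {T : E → SignType} (hT : ∀ e, T e ≠ 0 ↔ e ∈ D) (e : E) :
    (-T) e ≠ 0 ↔ e ∈ D := by
  rw [← hT e]; simp

theorem full_flipAt {D : Set E} {T : E → SignType} (hT : ∀ e, T e ≠ 0 ↔ e ∈ D) (f e : E) :
    flipAt f T e ≠ 0 ↔ e ∈ D := by
  rw [← hT e]; unfold flipAt; split_ifs <;> simp

theorem full_zeroOn {D : Set E} {T : E → SignType} (hT : ∀ e, T e ≠ 0 ↔ e ∈ D) (S : Set E) (e : E) :
    zeroOn S T e ≠ 0 ↔ e ∈ D \ S := by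
  unfold zeroOn
  split_ifs with h
  · simp [h]
  · simp [h, ← hT e]

theorem full_signComp {D : Set E} {X T : E → SignType} (hX : ∀ e, X e ≠ 0 → e ∈ D)
    (hT : ∀ e, T e ≠ 0 ↔ e ∈ D) (e : E) : signComp X T e ≠ 0 ↔ e ∈ D := by
  by_cases h : X e = 0
  · rw [signComp_of_eq h]; exact hT e
  · rw [signComp_of_ne h]; exact ⟨fun _ => hX e h, fun _ => h⟩

theorem signComp_eq_of_full {D : Set E} {T T' : E → SignType} (hT : ∀ e, T e ≠ 0 ↔ e ∈ D)
    (hT' : ∀ e, T' e ≠ 0 ↔ e ∈ D) : signComp T T' = T := by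
  funext e
  by_cases h : T e = 0
  · rw [signComp_of_eq h, h]
    exact full_eq_zero hT' fun he => (hT e).2 he h
  · exact signComp_of_ne h

theorem mem_gatedCovectors_of_mem {D : Set E} {G : Set (E → SignType)}
    (hG : ∀ T ∈ G, ∀ e, T e ≠ 0 ↔ e ∈ D) {T : E → SignType} (hT : T ∈ G) :
    T ∈ gatedCovectors G := fun T' hT' => by
  rw [signComp_eq_of_full (hG T hT) (hG T' hT'),
    signComp_eq_of_full (hG T hT) (full_neg (hG T' hT'))]
  exact ⟨hT, hT⟩

theorem gatedCovectors_supp {D : Set E} {G : Set (E → SignType)}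
    (hG : ∀ T ∈ G, ∀ e, T e ≠ 0 ↔ e ∈ D) (hne : G.Nonempty) {X : E → SignType}
    (hX : X ∈ gatedCovectors G) (e : E) (he : X e ≠ 0) : e ∈ D := by
  obtain ⟨T, hT⟩ := hne
  rw [← hG _ (hX T hT).1 e, signComp_of_ne he]
  exact he

theorem gatedCovectors_face {G : Set (E → SignType)} {X Y : E → SignType}
    (hX : X ∈ gatedCovectors G) (hY : Y ∈ gatedCovectors G) :
    signComp X (-Y) ∈ gatedCovectors G := fun T hT => by
  have h1 := (hX _ (hY T hT).1).2
  have h2 := (hX _ (hY T hT).2).2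
  rw [neg_signComp, ← signComp_assoc] at h1 h2
  rw [neg_neg] at h2
  exact ⟨h2, h1⟩

theorem gatedCovectors_comp {G : Set (E → SignType)} {X Y : E → SignType}
    (hX : X ∈ gatedCovectors G) (hY : Y ∈ gatedCovectors G) :
    signComp X Y ∈ gatedCovectors G := fun T hT => by
  rw [signComp_assoc, signComp_assoc]
  exact ⟨(hX _ (hY T hT).1).1, (hX _ (hY T hT).2).1⟩

theorem isAntipodalFace_of_mem {G : Set (E → SignType)} (hne : G.Nonempty) {X : E → SignType}
    (hX : X ∈ gatedCovectors G) : IsAntipodalFace G X := by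
  obtain ⟨T, hT⟩ := hne
  exact ⟨⟨_, (hX T hT).1, Conf.signComp _ _⟩, fun T hT _ => (hX T hT).2⟩

theorem mem_gatedCovectors_of_face {G : Set (E → SignType)} {X : E → SignType}
    (hX : IsAntipodalFace G X) (h : ∀ T ∈ G, signComp X T ∈ G) : X ∈ gatedCovectors G :=
  fun T hT => ⟨h T hT, by
    have := hX.2 _ (h T hT) (Conf.signComp _ _)
    rwa [signComp_neg_signComp] at this⟩

theorem gatedCovectors_zeroOn {G : Set (E → SignType)} {X : E → SignType}
    (hX : X ∈ gatedCovectors G) (S : Set E) : zeroOn S X ∈ gatedCovectors (zeroOn S '' G) := by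
  rintro _ ⟨T, hT, rfl⟩
  rw [← zeroOn_neg, ← zeroOn_signComp, ← zeroOn_signComp]
  exact ⟨⟨_, (hX T hT).1, rfl⟩, ⟨_, (hX T hT).2, rfl⟩⟩

theorem isAntipodalFace_supp {D : Set E} {G : Set (E → SignType)}
    (hG : ∀ T ∈ G, ∀ e, T e ≠ 0 ↔ e ∈ D) {X : E → SignType} (hX : IsAntipodalFace G X) (e : E)
    (he : X e ≠ 0) : e ∈ D := by
  obtain ⟨⟨T, hT, hXT⟩, -⟩ := hX
  rw [← hG T hT e, hXT e he]; exact he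

/-! ### Faces and deletions -/

theorem zeroOn_supp_mem_starOf {G : Set (E → SignType)} {X T : E → SignType} (hT : T ∈ G)
    (hXT : Conf X T) : zeroOn {e | X e ≠ 0} T ∈ starOf G X := by
  refine ⟨?_, fun e he => zeroOn_of_mem he⟩
  convert hT using 1
  funext e
  by_cases h : X e = 0
  · rw [signComp_of_eq h, zeroOn_of_notMem (by simpa using h)]
  · rw [signComp_of_ne h, hXT e h]

/-- Two elements of the face of `X` differ only where `X` vanishes, so shortest paths between them
never leave the face. -/
theorem IsIsometric.star {D : Set E} {G : Set (E → SignType)} (hG : IsIsometric D G)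
    {X : E → SignType} (hX : ∃ T ∈ G, Conf X T) :
    IsIsometric (D \ {e | X e ≠ 0}) (starOf G X) := by
  refine ⟨fun T hT e => ?_, ?_, fun T hT T' hT' hne => ?_⟩
  · by_cases h : X e = 0
    · have := hG.supp _ hT.1 e
      rw [signComp_of_eq h] at this
      simp [this, h]
    · simp [hT.2 e h, h]
  · obtain ⟨T, hT, hXT⟩ := hX
    exact ⟨_, zeroOn_supp_mem_starOf hT hXT⟩
  · have hne' : signComp X T ≠ signComp X T' := by
      intro h
      apply hne
      funext e
      by_cases hx : X e = 0
      · have := congrFun h e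
        rwa [signComp_of_eq hx, signComp_of_eq hx] at this
      · rw [hT.2 e hx, hT'.2 e hx]
    obtain ⟨e, he, hfl⟩ := hG.flip _ hT.1 _ hT'.1 hne'
    have hx : X e = 0 := by
      by_contra hx
      rw [signComp_of_ne hx, signComp_of_ne hx] at he
      exact he rfl
    rw [signComp_of_eq hx, signComp_of_eq hx] at he
    refine ⟨e, he, ?_, fun f hf => ?_⟩
    · convert hfl using 1
      funext f
      by_cases hfe : f = e
      · subst hfe; simp [signComp, flipAt, hx]
      · rw [flipAt_of_ne _ hfe]
        unfold signComp
        rw [flipAt_of_ne _ hfe]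
    · rw [flipAt_of_ne _ (by rintro rfl; exact hf hx), hT.2 f hf]

theorem IsAntipodalFace.of_star {G : Set (E → SignType)} {X Y : E → SignType}
    (hY : IsAntipodalFace (starOf G X) Y) : IsAntipodalFace G (signComp X Y) := by
  obtain ⟨⟨T, hT, hYT⟩, hanti⟩ := hY
  refine ⟨⟨_, hT.1, fun e he => ?_⟩, fun T' hT' hconf => ?_⟩
  · by_cases hx : X e = 0
    · rw [signComp_of_eq hx] at he
      rw [signComp_of_eq hx, signComp_of_eq hx, hYT e he]
    · rw [signComp_of_ne hx, signComp_of_ne hx]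
  · have hXT' := (Conf.signComp X Y).trans hconf
    have h1 := zeroOn_supp_mem_starOf hT' hXT'
    have hY0 : ∀ e, X e ≠ 0 → Y e = 0 := fun e he => by
      by_contra h
      exact h ((hYT e h).symm.trans (hT.2 e he))
    have h2 := (hanti _ h1 fun e he => by
      have hx : X e = 0 := by by_contra hx; exact he (hY0 e hx)
      rw [zeroOn_of_notMem (by simpa using hx)]
      have := hconf e (by rw [signComp_of_eq hx]; exact he)
      rwa [signComp_of_eq hx] at this).1
    convert h2 using 1
    rw [signComp_assoc]
    funext e
    by_cases hx : X e = 0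
    · simp [signComp, hx, zeroOn]
    · simp [signComp, hx]

/-- An antipodal face Y of the star is the antipodal face X∘Y of `G`; the action of X∘Y on `G`
restricts to that of Y on the star. -/
theorem AntipodalGated.star {G : Set (E → SignType)} (hG : AntipodalGated G) (X : E → SignType) :
    AntipodalGated (starOf G X) := by
  intro Y hY
  refine mem_gatedCovectors_of_face hY fun T hT => ⟨?_, fun e he => ?_⟩
  · have := (hG _ hY.of_star _ hT.1).1
    convert this using 1
    funext e
    by_cases hx : X e = 0 <;> simp [signComp, hx]
  · obtain ⟨⟨T', hT', hYT'⟩, -⟩ := hY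
    have : Y e = 0 := by
      by_contra h
      exact h ((hYT' e h).symm.trans (hT'.2 e he))
    rw [signComp_of_eq this, hT.2 e he]

/-- If the first step of a shortest path goes in the deleted direction, it is invisible after
deletion. The next step is then usable, because the new vertex agrees with the target at `f`. -/
theorem IsIsometric.delete {D : Set E} {G : Set (E → SignType)} (hG : IsIsometric D G) (f : E) :
    IsIsometric (D \ {f}) (zeroOn {f} '' G) := by
  have main : ∀ T ∈ G, ∀ T' ∈ G, (∃ e, e ≠ f ∧ T e ≠ T' e) → T f = T' f →
      ∃ e, e ≠ f ∧ T e ≠ T' e ∧ flipAt e T ∈ G := by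
    rintro T hT T' hT' ⟨e, he, hne⟩ hf
    obtain ⟨e', he', hfl⟩ := hG.flip T hT T' hT' (fun h => hne (congrFun h e))
    exact ⟨e', fun h => he' (h ▸ hf), he', hfl⟩
  refine ⟨?_, hG.nonempty.image _, ?_⟩
  · rintro _ ⟨T, hT, rfl⟩
    exact full_zeroOn (hG.supp T hT) _
  · rintro _ ⟨T, hT, rfl⟩ _ ⟨T', hT', rfl⟩ hne
    have : ∃ e, e ≠ f ∧ T e ≠ T' e := by
      by_contra hcon
      push Not at hcon
      apply hne
      funext e
      by_cases he : e = f
      · simp [zeroOn, he]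
      · simp [zeroOn, he, hcon e he]
    obtain ⟨e₀, he₀, hne₀⟩ := this
    obtain ⟨e, he, hfl⟩ := hG.flip T hT T' hT' (fun h => hne₀ (congrFun h e₀))
    by_cases hef : e = f
    · subst hef
      obtain ⟨e', h1, h2, h3⟩ := main _ hfl T' hT' ⟨e₀, he₀, by rwa [flipAt_of_ne _ he₀]⟩
        (by rw [flipAt_self, eq_of_full (hG.supp T hT) (hG.supp T' hT') he])
      rw [flipAt_of_ne _ h1] at h2
      refine ⟨e', by simpa [zeroOn, h1] using h2, _, h3, ?_⟩
      rw [zeroOn_flipAt_of_notMem (by simpa using h1), zeroOn_flipAt_of_mem (Set.mem_singleton _)]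
    · refine ⟨e, by simpa [zeroOn, hef] using he, _, hfl, ?_⟩
      rw [zeroOn_flipAt_of_notMem (by simpa using hef)]

/-- The critical case is a pair T, T' in `G` that differs at both `e` and `f`, so that only the
deletions at `f` are `e`-neighbours. Isometry supplies one of the two vertices between them, and
either one completes an `e`-edge of `G` with the same deletion. -/
theorem contrAt_delete {D : Set E} {G : Set (E → SignType)} (hG : IsIsometric D G) {e f : E}
    (hef : e ≠ f) : contrAt e (zeroOn {f} '' G) = zeroOn {f} '' contrAt e G := by
  have hcomm : ∀ T : E → SignType, zeroOn {e} (zeroOn {f} T) = zeroOn {f} (zeroOn {e} T) := by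
    intro T; funext g; unfold zeroOn; split_ifs <;> rfl
  ext T
  constructor
  · rintro ⟨_, ⟨T, hT, rfl⟩, ⟨T', hT', h⟩, rfl⟩
    rw [← zeroOn_flipAt_of_notMem (by simpa using hef)] at h
    have hg : ∀ g, g ≠ f → T' g = flipAt e T g := fun g hg => by
      have := congrFun h g
      simpa [zeroOn, hg] using this
    have hor : T' = flipAt e T ∨ T' = flipAt f (flipAt e T) := by
      by_cases hf : T' f = flipAt e T f
      · left; funext g
        by_cases hgf : g = f
        · rw [hgf, hf]
        · exact hg g hgf
      · right; funext g
        by_cases hgf : g = f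
        · rw [hgf, flipAt_self]
          exact eq_of_full (full_flipAt (hG.supp T hT) e) (hG.supp T' hT') (Ne.symm hf)
        · rw [flipAt_of_ne _ hgf, hg g hgf]
    by_cases h1 : flipAt e T ∈ G
    · exact ⟨zeroOn {e} T, ⟨T, hT, h1, rfl⟩, (hcomm T).symm⟩
    rcases hor with h2 | h2
    · exact absurd (h2 ▸ hT') h1
    · rw [h2] at hT'
      by_cases hTf : f ∈ D
      · have hne : T ≠ flipAt f (flipAt e T) := fun hh => by
          have := congrFun hh f
          rw [flipAt_self, flipAt_of_ne _ (Ne.symm hef)] at this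
          exact sign_ne_neg_self ((hG.supp T hT f).2 hTf) this
        obtain ⟨g, hg1, hg2⟩ := hG.flip T hT _ hT' hne
        have hg3 : g = e ∨ g = f := by
          by_contra hcon
          push Not at hcon
          rw [flipAt_of_ne _ hcon.2, flipAt_of_ne _ hcon.1] at hg1
          exact hg1 rfl
        rcases hg3 with rfl | rfl
        · exact absurd hg2 h1
        · refine ⟨zeroOn {e} (flipAt g T), ⟨_, hg2, ?_, rfl⟩, ?_⟩
          · rwa [flipAt_comm]
          · rw [← hcomm (flipAt g T), zeroOn_flipAt_of_mem (Set.mem_singleton _), hcomm]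
      · exfalso; apply h1
        convert hT' using 1
        funext g
        by_cases hgf : g = f
        · rw [hgf, flipAt_self, full_eq_zero (full_flipAt (hG.supp T hT) e) hTf]; rfl
        · rw [flipAt_of_ne _ hgf]
  · rintro ⟨_, ⟨T, hT, hT', rfl⟩, rfl⟩
    refine ⟨zeroOn {f} T, ⟨T, hT, rfl⟩, ⟨_, hT', ?_⟩, (hcomm T).symm⟩
    rw [zeroOn_flipAt_of_notMem (by simpa using hef)]

/-! ### Nearest missing sign-vectors -/

/-- A minimiser of the Hamming distance to `B`: an element of `N` strictly between `B` and `R` would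
be closer. -/
theorem exists_nearest [Finite E] {D : Set E} {B : E → SignType} (hB : ∀ e, B e ≠ 0 ↔ e ∈ D)
    {N : Set (E → SignType)} (hN : ∀ T ∈ N, ∀ e, T e ≠ 0 ↔ e ∈ D) (hne : N.Nonempty) :
    ∃ R ∈ N, ∀ V ∈ N, (∀ e, B e = R e → V e = B e) → V = R := by
  obtain ⟨R, hR, hmin⟩ := Set.exists_min_image N (fun T => {e | B e ≠ T e}.ncard)
    (Set.toFinite _) hne
  refine ⟨R, hR, fun V hV hbet => ?_⟩
  have h1 : {e | B e ≠ V e} ⊆ {e | B e ≠ R e} := fun e he h => he (hbet e h).symm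
  have h2 := Set.eq_of_subset_of_ncard_le h1 (hmin V hV) (Set.toFinite _)
  funext e
  by_cases he : B e = R e
  · rw [hbet e he, he]
  · have : e ∈ {e | B e ≠ V e} := by rw [h2]; exact he
    rw [eq_of_full hB (hN V hV) this, eq_of_full hB (hN R hR) he]

/-- The face of `agree B R` is the interval between `B` and `R`. Opposition in this interval is an
involution that exchanges `B` and `R`, so it preserves what remains when just these two are missing.
-/
theorem isAntipodalFace_agree {D : Set E} {G : Set (E → SignType)}
    (hG : ∀ T ∈ G, ∀ e, T e ≠ 0 ↔ e ∈ D) {B R : E → SignType} (hB : ∀ e, B e ≠ 0 ↔ e ∈ D)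
    (hR : ∀ e, R e ≠ 0 ↔ e ∈ D) (hBG : B ∉ G) (hRG : R ∉ G)
    (hbet : ∀ V : E → SignType, (∀ e, V e ≠ 0 ↔ e ∈ D) → (∀ e, B e = R e → V e = B e) →
      V ≠ B → V ≠ R → V ∈ G)
    (hne : ∃ V ∈ G, ∀ e, B e = R e → V e = B e) : IsAntipodalFace G (agree B R) := by
  constructor
  · obtain ⟨V, hV, h⟩ := hne
    refine ⟨V, hV, fun e he => ?_⟩
    unfold agree at he ⊢
    split_ifs at he ⊢ with hh
    · exact h e hh
    · exact absurd rfl he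
  · intro V hV hconf
    have hsupp : ∀ e, agree B R e ≠ 0 → e ∈ D := fun e he => by
      unfold agree at he
      split_ifs at he
      · exact (hB e).1 he
      · exact absurd rfl he
    have hag : ∀ e, B e ≠ R e → signComp (agree B R) (-V) e = - V e := fun e he => by
      simp [signComp, agree, he]
    have hag' : ∀ e, B e = R e → signComp (agree B R) (-V) e = B e := fun e he => by
      by_cases h0 : B e = 0
      · have : V e = 0 := full_eq_zero (hG V hV) fun h => (hB e).2 h h0
        have hz : agree B R e = 0 := by rw [agree, if_pos he, h0]
        rw [signComp_of_eq hz, h0, Pi.neg_apply, this, neg_zero]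
      · have hz : agree B R e = B e := if_pos he
        rw [signComp_of_ne (by rwa [hz]), hz]
    have hVag : ∀ e, B e = R e → V e = B e := fun e he => by
      by_cases h0 : B e = 0
      · rw [h0]; exact full_eq_zero (hG V hV) fun h => (hB e).2 h h0
      · have := hconf e (by simpa [agree, he] using (he ▸ h0))
        rw [this]; simp [agree, he]
    apply hbet _ (full_signComp hsupp (full_neg (hG V hV))) hag'
    · rintro h
      apply hRG
      convert hV using 1
      funext e
      by_cases he : B e = R e
      · rw [hVag e he, he]
      · have := hag e he
        rw [h] at this
        rw [eq_of_full hB hR he, this, neg_neg]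
    · rintro h
      apply hBG
      convert hV using 1
      funext e
      by_cases he : B e = R e
      · rw [hVag e he]
      · have := hag e he
        rw [h] at this
        rw [eq_of_full hR hB (Ne.symm he), this, neg_neg]

/-- Every proper part of the induction on the size of the support. -/
theorem exists_lift [Finite E] {D : Set E} {G : Set (E → SignType)} (hG : IsIsometric D G)
    (hA : AntipodalGated G)
    (IH : ∀ (D' : Set E) (G' : Set (E → SignType)), D'.ncard < D.ncard → IsIsometric D' G' →
      AntipodalGated G' → IsCOM (gatedCovectors G'))
    {f : E} {X : E → SignType} (hX : IsAntipodalFace (zeroOn {f} '' G) X)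
    (hX0 : ∃ e, X e ≠ 0) : ∃ X' ∈ gatedCovectors G, zeroOn {f} X' = X := by
  obtain ⟨⟨_, ⟨T, hT, rfl⟩, hXT⟩, hanti⟩ := hX
  have hXf : X f = 0 := by
    by_contra h
    have := hXT f h
    rw [zeroOn_of_mem (Set.mem_singleton f)] at this
    exact h this.symm
  have hXf' : ∀ e, X e ≠ 0 → e ≠ f := fun e he h => he (h ▸ hXf)
  have hconf_iff : ∀ T, Conf X (zeroOn {f} T) ↔ Conf X T := fun T =>
    forall_congr' fun e => imp_congr_right fun he => by
      rw [zeroOn_of_notMem (by simpa using hXf' e he)]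
  have hXT' : Conf X T := (hconf_iff T).1 hXT
  have hH := hG.star ⟨T, hT, hXT'⟩
  have hHA := hA.star X
  have hlt : (D \ {e | X e ≠ 0}).ncard < D.ncard := by
    obtain ⟨e, he⟩ := hX0
    apply Set.ncard_lt_ncard ⟨Set.sdiff_subset, fun h => ?_⟩ (Set.toFinite _)
    exact (h ((hG.supp T hT e).1 (by rw [hXT' e he]; exact he))).2 he
  have hCOM := (IH _ _ hlt hH hHA).zeroOn_image {f}
  have hmem : zeroOn {f} '' starOf G X ⊆ zeroOn {f} '' gatedCovectors (starOf G X) :=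
    Set.image_mono fun T hT => mem_gatedCovectors_of_mem hH.supp hT
  -- Since `X` is not zero, the star of `X` has smaller support and its gated covectors form a
  -- complex of oriented matroids. After deletion of `f` its topes are antipodal, so zero is a
  -- covector of the deletion. A preimage Y of zero is non-zero at most at `f`, and X∘Y is the lift.
  have h0 : (0 : E → SignType) ∈ zeroOn {f} '' gatedCovectors (starOf G X) := by
    refine hCOM.mem_of_isAntipodalFace ((D \ {e | X e ≠ 0}) \ {f}) ?_ ⟨?_, ?_⟩
    · rintro _ ⟨Y, hY, rfl⟩ e he
      by_cases hef : e = f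
      · exact absurd (zeroOn_of_mem (S := {f}) hef) he
      · rw [zeroOn_of_notMem (by simpa using hef)] at he
        exact ⟨gatedCovectors_supp hH.supp hH.nonempty hY e he, hef⟩
    · obtain ⟨T0, hT0⟩ := hH.nonempty
      exact ⟨_, ⟨hmem ⟨T0, hT0, rfl⟩, full_zeroOn (hH.supp T0 hT0) _⟩, fun e he => absurd rfl he⟩
    · rintro _ ⟨⟨Y, hY, rfl⟩, hfull⟩ -
      have h00 : ∀ Z : E → SignType, signComp 0 Z = Z := fun Z => by funext e; simp [signComp]
      rw [h00]
      obtain ⟨T0, hT0⟩ := hH.nonempty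
      have hT1 := (hY T0 hT0).1
      have hYeq : zeroOn {f} Y = zeroOn {f} (signComp Y T0) := by
        funext e
        by_cases hef : e = f
        · simp [zeroOn, hef]
        · have h1 := hfull e
          simp only [zeroOn_of_notMem (show e ∉ ({f} : Set E) from hef)] at h1 ⊢
          by_cases hy : Y e = 0
          · rw [signComp_of_eq hy, hy]
            refine (full_eq_zero (hH.supp T0 hT0) fun h => ?_).symm
            exact h1.2 ⟨h, hef⟩ hy
          · rw [signComp_of_ne hy]
      rw [hYeq] at hfull ⊢
      obtain ⟨T2, hT2, hT2eq⟩ := hanti _ ⟨_, hT1.1, rfl⟩ ((hconf_iff _).2 (Conf.signComp _ _))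
      have hXT2 : Conf X T2 := (hconf_iff T2).1 (by rw [hT2eq]; exact Conf.signComp _ _)
      refine ⟨hmem ⟨_, zeroOn_supp_mem_starOf hT2 hXT2, ?_⟩, full_neg hfull⟩
      funext e
      by_cases hef : e = f
      · simp [zeroOn, hef]
      · by_cases hx : X e = 0
        · have := congrFun hT2eq e
          simp only [zeroOn_of_notMem (show e ∉ ({f} : Set E) from hef), signComp_of_eq hx] at this
          rw [zeroOn_of_notMem (show e ∉ ({f} : Set E) from hef),
            zeroOn_of_notMem (by simpa using hx), this, Pi.neg_apply, Pi.neg_apply,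
            zeroOn_of_notMem (show e ∉ ({f} : Set E) from hef),
            zeroOn_of_notMem (show e ∉ ({f} : Set E) from hef), signComp_of_eq hx]
        · rw [zeroOn_of_notMem (show e ∉ ({f} : Set E) from hef), zeroOn_of_mem hx, Pi.neg_apply,
            zeroOn_of_notMem (show e ∉ ({f} : Set E) from hef), hT1.2 e hx, neg_zero]
  obtain ⟨Y, hY, hY0⟩ := h0
  refine ⟨signComp X Y, hA _ (isAntipodalFace_of_mem hH.nonempty hY).of_star, ?_⟩
  rw [zeroOn_signComp, hY0]
  funext e
  by_cases hx : X e = 0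
  · simp [signComp, zeroOn, hx]
  · rw [signComp_of_ne (by rwa [zeroOn_of_notMem (by simpa using hXf' e hx)]),
      zeroOn_of_notMem (by simpa using hXf' e hx)]

/-- Non-zero antipodal faces lift to gated covectors of `G` by `exists_lift`; the zero vector acts
as the identity. -/
theorem AntipodalGated.delete [Finite E] {D : Set E} {G : Set (E → SignType)}
    (hG : IsIsometric D G) (hA : AntipodalGated G)
    (IH : ∀ (D' : Set E) (G' : Set (E → SignType)), D'.ncard < D.ncard → IsIsometric D' G' →
      AntipodalGated G' → IsCOM (gatedCovectors G')) (f : E) :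
    AntipodalGated (zeroOn {f} '' G) := by
  intro X hX
  by_cases hX0 : ∃ e, X e ≠ 0
  · obtain ⟨X', hX', rfl⟩ := exists_lift hG hA IH hX hX0
    exact gatedCovectors_zeroOn hX' _
  · push Not at hX0
    refine mem_gatedCovectors_of_face hX fun T hT => ?_
    convert hT using 1
    funext e
    exact signComp_of_eq (hX0 e)

/-- Suppose that B = -T0 is missing. The induction hypothesis, applied to deletions, shows that all
neighbours of B in directions other than `e` are present. A nearest other missing vector R on the
side of B then spans with B an interval that lacks only its two ends, and gating by this antipodal
face produces B or R. -/
theorem antipodalOfContraction [Finite E] {D : Set E} {G : Set (E → SignType)}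
    (hG : IsIsometric D G) (hA : AntipodalGated G)
    (IH : ∀ f ∈ D, AntipodalOfContraction (D \ {f}) (zeroOn {f} '' G)) :
    AntipodalOfContraction D G := by
  intro e heD hKne hK T0 hT0
  by_contra hB
  have hB' : ∀ e, (-T0) e ≠ 0 ↔ e ∈ D := full_neg (hG.supp T0 hT0)
  -- Otherwise `T0` gives an element of the contraction; its antipode comes from an `e`-edge of `G`,
  -- and -T0 is one end of that edge.
  have hT0K : flipAt e T0 ∉ G := by
    intro h
    obtain ⟨T', hT', hT'e, heq⟩ := hK _ ⟨T0, hT0, h, rfl⟩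
    rw [← zeroOn_neg] at heq
    apply hB
    have hg : ∀ g, g ≠ e → (-T0) g = T' g := fun g hg => by
      have := congrFun heq g
      rwa [zeroOn_of_notMem (show g ∉ ({e} : Set E) from hg),
        zeroOn_of_notMem (show g ∉ ({e} : Set E) from hg)] at this
    by_cases hh : (-T0) e = T' e
    · convert hT' using 1
      funext g
      by_cases hge : g = e
      · rw [hge, hh]
      · exact hg g hge
    · convert hT'e using 1
      funext g
      by_cases hge : g = e
      · rw [hge, flipAt_self]
        exact eq_of_full (hG.supp T' hT') hB' (Ne.symm hh)
      · rw [flipAt_of_ne _ hge]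
        exact hg g hge
  -- all other neighbours of the missing sign-vector are present
  have hnb : ∀ f ∈ D, f ≠ e → flipAt f (-T0) ∈ G := by
    intro f hf hfe
    have h1 := IH f hf e ⟨heD, Ne.symm hfe⟩
    rw [contrAt_delete hG (Ne.symm hfe)] at h1
    obtain ⟨T', hT', heq⟩ := h1 (hKne.image _) (by
      rintro _ ⟨T, hT, rfl⟩
      exact ⟨-T, hK T hT, zeroOn_neg _ _⟩) _ ⟨T0, hT0, rfl⟩
    rw [← zeroOn_neg] at heq
    convert hT' using 1
    funext g
    by_cases hgf : g = f
    · subst hgf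
      rw [flipAt_self]
      refine (eq_of_full hB' (hG.supp T' hT') fun h => hB ?_).symm
      convert hT' using 1
      funext g'
      by_cases hg' : g' = g
      · rw [hg', h]
      · have := congrFun heq g'
        rw [zeroOn_of_notMem (show g' ∉ ({g} : Set E) from hg'),
          zeroOn_of_notMem (show g' ∉ ({g} : Set E) from hg')] at this
        exact this.symm
    · rw [flipAt_of_ne _ hgf]
      have := congrFun heq g
      rw [zeroOn_of_notMem (show g ∉ ({f} : Set E) from hgf),
        zeroOn_of_notMem (show g ∉ ({f} : Set E) from hgf)] at this
      exact this.symm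
  -- a nearest missing sign-vector on the same side of `e`
  set N : Set (E → SignType) :=
    {R | (∀ g, R g ≠ 0 ↔ g ∈ D) ∧ R e = -T0 e ∧ R ∉ G ∧ R ≠ -T0} with hN
  have hNne : N.Nonempty := by
    refine ⟨flipAt e T0, full_flipAt (hG.supp T0 hT0) e, flipAt_self e T0, hT0K, fun h => ?_⟩
    by_cases hD : ∃ f ∈ D, f ≠ e
    · obtain ⟨f, hf, hfe⟩ := hD
      have := congrFun h f
      rw [flipAt_of_ne _ hfe] at this
      exact sign_ne_neg_self ((hG.supp T0 hT0 f).2 hf) this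
    -- If `e` is the only coordinate, the edge behind the non-empty contraction already contains
    -- every vector with support `D`.
    · push Not at hD
      obtain ⟨_, T', hT', hT'e, -⟩ := hKne
      have hD' : ∀ g, g ≠ e → g ∉ D := fun g hg hgD => hg (hD g hgD)
      apply hB
      by_cases hh : T' e = (-T0) e
      · convert hT' using 1
        funext g
        by_cases hg : g = e
        · rw [hg, hh]
        · rw [full_eq_zero hB' (hD' g hg), full_eq_zero (hG.supp T' hT') (hD' g hg)]
      · convert hT'e using 1
        funext g
        by_cases hg : g = e
        · rw [hg, flipAt_self]
          exact eq_of_full (hG.supp T' hT') hB' hh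
        · rw [full_eq_zero hB' (hD' g hg), full_eq_zero (hG.supp _ hT'e) (hD' g hg)]
  obtain ⟨R, ⟨hRD, hRe, hRG, hRB⟩, hnear⟩ := exists_nearest hB' (fun T hT => hT.1) hNne
  have hface : IsAntipodalFace G (agree (-T0) R) := by
    refine isAntipodalFace_agree hG.supp hB' hRD hB hRG (fun V hVD hbet hVB hVR => ?_) ?_
    · by_contra hVG
      exact hVR (hnear V ⟨hVD, hbet e hRe.symm, hVG, hVB⟩ hbet)
    · have : ∃ f, (-T0) f ≠ R f := by
        by_contra hcon
        push Not at hcon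
        exact hRB (funext hcon).symm
      obtain ⟨f, hf⟩ := this
      have hfe : f ≠ e := by rintro rfl; exact hf hRe.symm
      have hfD : f ∈ D := by
        by_contra hfD
        exact hf (by rw [full_eq_zero hB' hfD, full_eq_zero hRD hfD])
      refine ⟨_, hnb f hfD hfe, fun g hg => ?_⟩
      rw [flipAt_of_ne]
      rintro rfl
      exact hf hg
  have hgate := hA _ hface
  -- If B and R share a coordinate g other than `e`, gating the neighbour of B in direction g
  -- restores B. Otherwise R is `flipAt e T0`, and gating `T0` yields R.
  by_cases hex : ∃ g ∈ D, g ≠ e ∧ (-T0) g = R g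
  · obtain ⟨g, hgD, hge, hgR⟩ := hex
    apply hB
    convert (hgate _ (hnb g hgD hge)).1 using 1
    funext h
    by_cases hh : (-T0) h = R h
    · by_cases h0 : (-T0) h = 0
      · rw [h0]
        exact (full_eq_zero (full_signComp (isAntipodalFace_supp hG.supp hface)
          (full_flipAt hB' g)) fun hD => (hB' h).2 hD h0).symm
      · have hz : agree (-T0) R h = (-T0) h := if_pos hh
        rw [signComp_of_ne (by rwa [hz]), hz]
    · have hz : agree (-T0) R h = 0 := if_neg hh
      rw [signComp_of_eq hz, flipAt_of_ne]
      rintro rfl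
      exact hh hgR
  · push Not at hex
    apply hRG
    convert (hgate _ hT0).1 using 1
    funext h
    by_cases hhD : h ∈ D
    · by_cases hhe : h = e
      · subst hhe
        have hz : agree (-T0) R h = (-T0) h := if_pos hRe.symm
        rw [signComp_of_ne (by rw [hz]; exact (hB' h).2 hhD), hz, hRe, Pi.neg_apply]
      · have hz : agree (-T0) R h = 0 := if_neg (hex h hhD hhe)
        rw [signComp_of_eq hz, eq_of_full hB' hRD (hex h hhD hhe), Pi.neg_apply, neg_neg]
    · rw [full_eq_zero hRD hhD]
      exact (full_eq_zero (full_signComp (isAntipodalFace_supp hG.supp hface)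
          (hG.supp T0 hT0)) hhD).symm

/-- A shortest path from `X` to `Y` crosses `e` exactly once, and every vertex of it keeps the
entries in which `X` and `Y` agree. -/
theorem IsIsometric.exists_flip_between [Finite E] {D : Set E} {G : Set (E → SignType)}
    (hG : IsIsometric D G) {X Y : E → SignType} (hX : X ∈ G) (hY : Y ∈ G) {e : E}
    (he : X e ≠ Y e) : ∃ T ∈ G, flipAt e T ∈ G ∧ ∀ f, X f = Y f → T f = X f := by
  induction hn : {f | X f ≠ Y f}.ncard using Nat.strong_induction_on generalizing X with
  | _ n ih =>
  obtain ⟨f, hf, hfl⟩ := hG.flip X hX Y hY (fun h => he (congrFun h e))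
  by_cases hfe : f = e
  · subst hfe
    exact ⟨X, hX, hfl, fun _ _ => rfl⟩
  · have hYf : Y f = flipAt f X f := by
      rw [flipAt_self]; exact eq_of_full (hG.supp X hX) (hG.supp Y hY) hf
    obtain ⟨T, hT, hTe, hTf⟩ := ih _ (by
      rw [← hn]
      refine Set.ncard_lt_ncard ⟨fun g hg h => ?_, fun h => ?_⟩ (Set.toFinite _)
      · apply hg
        rw [flipAt_of_ne _ (by rintro rfl; exact hf h), h]
      · exact h hf hYf.symm) hfl (by rwa [flipAt_of_ne _ (Ne.symm hfe)]) rfl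
    refine ⟨T, hT, hTe, fun g hg => ?_⟩
    have hgf : g ≠ f := by rintro rfl; exact hf hg
    rw [hTf g (by rwa [flipAt_of_ne _ hgf]), flipAt_of_ne _ hgf]

theorem contrAt_supp {D : Set E} {G : Set (E → SignType)} (hG : ∀ T ∈ G, ∀ e, T e ≠ 0 ↔ e ∈ D)
    (a : E) : ∀ T ∈ contrAt a G, ∀ e, T e ≠ 0 ↔ e ∈ D \ {a} := by
  rintro _ ⟨T, hT, -, rfl⟩
  exact full_zeroOn (hG T hT) _

theorem flipAt_signComp {W T : E → SignType} {a : E} (ha : W a = 0) :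
    flipAt a (signComp W T) = signComp W (flipAt a T) := by
  funext e
  by_cases he : e = a
  · subst he; simp [flipAt, signComp, ha]
  · simp [flipAt, signComp, he]

theorem zeroOn_eq_self {W : E → SignType} {a : E} (ha : W a = 0) : zeroOn {a} W = W := by
  funext e
  by_cases he : e = a
  · subst he; simp [zeroOn, ha]
  · simp [zeroOn, he]

theorem signComp_mem_contrAt {G : Set (E → SignType)} {W T : E → SignType} {a : E}
    (hW : W ∈ gatedCovectors G) (ha : W a = 0) (hT : T ∈ contrAt a G) :
    signComp W T ∈ contrAt a G ∧ signComp W (-T) ∈ contrAt a G := by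
  obtain ⟨T, hT, hT', rfl⟩ := hT
  refine ⟨⟨signComp W T, (hW T hT).1, ?_, ?_⟩, ⟨signComp W (-T), (hW T hT).2, ?_, ?_⟩⟩
  · rw [flipAt_signComp ha]; exact (hW _ hT').1
  · rw [zeroOn_signComp, zeroOn_eq_self ha]
  · rw [flipAt_signComp ha, flipAt_neg]; exact (hW _ hT').2
  · rw [zeroOn_signComp, zeroOn_eq_self ha, zeroOn_neg]

theorem conf_zeroOn_iff {W T : E → SignType} {a : E} (ha : W a = 0) :
    Conf W (zeroOn {a} T) ↔ Conf W T :=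
  forall_congr' fun e => imp_congr_right fun he => by
    rw [zeroOn_of_notMem]
    rintro rfl
    exact he ha

/-- The star of `W` in `G` has an antipodal contraction at `a`, so it is antipodal itself: by
induction if `W` is not zero, and by `hZ` if the star is all of `G`. Hence `W` is an antipodal face
of `G`, and these are gated. -/
theorem mem_gatedCovectors_of_contrAt [Finite E] {D : Set E} {G : Set (E → SignType)}
    (hG : IsIsometric D G) (hA : AntipodalGated G)
    (IH : ∀ (D' : Set E) (G' : Set (E → SignType)), D'.ncard < D.ncard → IsIsometric D' G' →
      AntipodalGated G' → AntipodalOfContraction D' G') (hZ : AntipodalOfContraction D G)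
    {a : E} (haD : a ∈ D) {W : E → SignType} (ha : W a = 0)
    (hW : IsAntipodalFace (contrAt a G) W) : W ∈ gatedCovectors G := by
  obtain ⟨⟨_, ⟨T, hT, hT', rfl⟩, hWT⟩, hanti⟩ := hW
  have hWT := (conf_zeroOn_iff ha).1 hWT
  have hex : ∃ T ∈ G, Conf W T := ⟨T, hT, hWT⟩
  have hH := hG.star hex
  have haS : a ∉ {e | W e ≠ 0} := fun h => h ha
  have hZH : AntipodalOfContraction (D \ {e | W e ≠ 0}) (starOf G W) := by
    by_cases hW0 : ∃ e, W e ≠ 0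
    · refine IH _ _ ?_ hH (hA.star W)
      obtain ⟨e, he⟩ := hW0
      apply Set.ncard_lt_ncard ⟨Set.sdiff_subset, fun h => ?_⟩ (Set.toFinite _)
      exact (h ((hG.supp T hT e).1 (by rw [hWT e he]; exact he))).2 he
    · push Not at hW0
      have h1 : {e | W e ≠ 0} = ∅ := by
        ext e; simp [hW0 e]
      have h2 : starOf G W = G := by
        ext T
        have : signComp W T = T := by funext e; exact signComp_of_eq (hW0 e)
        simp [starOf, this, hW0]
      rw [h1, h2, Set.sdiff_empty]
      exact hZ
  have hflip : ∀ T, zeroOn {e | W e ≠ 0} (flipAt a T) = flipAt a (zeroOn {e | W e ≠ 0} T) :=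
    zeroOn_flipAt_of_notMem haS
  have hconf : ∀ T, Conf W T → Conf W (flipAt a T) := fun T hT e he => by
    rw [flipAt_of_ne, hT e he]
    rintro rfl; exact he ha
  have hcomm : ∀ (S S' : Set E) (T : E → SignType), zeroOn S (zeroOn S' T) =
      zeroOn S' (zeroOn S T) := by
    intro S S' T; funext g; unfold zeroOn; split_ifs <;> rfl
  have hanti' := hZH a ⟨haD, haS⟩ ⟨_, _, zeroOn_supp_mem_starOf hT hWT,
      by rw [← hflip]; exact zeroOn_supp_mem_starOf hT' (hconf T hWT), rfl⟩ (by
    rintro _ ⟨T1, hT1, hT1', rfl⟩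
    have h1 : zeroOn {a} (signComp W T1) ∈ contrAt a G :=
      ⟨_, hT1.1, by rw [flipAt_signComp ha]; exact hT1'.1, rfl⟩
    obtain ⟨T2, hT2, hT2', heq⟩ := hanti _ h1 ((conf_zeroOn_iff ha).2 (Conf.signComp _ _))
    have hWT2 : Conf W T2 := (conf_zeroOn_iff ha).1 (by rw [← heq]; exact Conf.signComp _ _)
    refine ⟨_, zeroOn_supp_mem_starOf hT2 hWT2,
      by rw [← hflip]; exact zeroOn_supp_mem_starOf hT2' (hconf T2 hWT2), ?_⟩
    rw [hcomm, ← heq]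
    funext e
    by_cases he : W e = 0
    · rw [zeroOn_of_notMem (by simpa using he), signComp_of_eq he, zeroOn_signComp,
        Pi.neg_apply, Pi.neg_apply, zeroOn_eq_self ha, signComp_of_eq he]
    · rw [zeroOn_of_mem he, Pi.neg_apply]
      have := hT1.2 e he
      unfold zeroOn
      simp [this])
  have hface : IsAntipodalFace (starOf G W) 0 := by
    refine ⟨⟨_, zeroOn_supp_mem_starOf hT hWT, fun e he => absurd rfl he⟩, fun T1 hT1 _ => ?_⟩
    convert hanti' T1 hT1 using 1
    funext e
    simp [signComp]
  convert hA _ hface.of_star using 1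
  funext e
  by_cases he : W e = 0 <;> simp [signComp, he]

/-- Both W∘T and W∘(-T) belong to the contraction and obey its parallelism. If `W` vanished at only
one of `f` and `f'`, the relation would fail for one of the two. -/
theorem gatedCovectors_parallel {D : Set E} {G : Set (E → SignType)}
    (hG : ∀ T ∈ G, ∀ e, T e ≠ 0 ↔ e ∈ D) {a f f' : E} {s : SignType} (hs : s ≠ 0)
    (hf : f ∈ D \ {a}) (hne : (contrAt a G).Nonempty) (hpar : ∀ T ∈ contrAt a G, T f' = s * T f)
    {W : E → SignType} (hW : W ∈ gatedCovectors G) (ha : W a = 0) : W f' = s * W f := by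
  obtain ⟨T, hT⟩ := hne
  obtain ⟨h1, h2⟩ := signComp_mem_contrAt hW ha hT
  have h1 := hpar _ h1
  have h2 := hpar _ h2
  have h3 := hpar _ hT
  have hTf : T f ≠ 0 := (contrAt_supp hG a T hT f).2 hf
  simp only [signComp, Pi.neg_apply, h3] at h1 h2
  revert h1 h2 hTf
  generalize T f = t
  generalize W f = w
  generalize W f' = w'
  revert hs
  clear h3 hpar
  revert s t w w'
  decide

/-- Let T'' be nearest to T among the elements between T and T'. The interval between T and T''
contains just these two, so `agree T T''` is an antipodal face and hence gated. Composing with it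
turns every V into T or T'', which makes all coordinates separating T from T'' parallel. Without
parallel coordinates, T'' is a neighbour of T. -/
theorem IsIsometric.contrAt [Finite E] {D : Set E} {G : Set (E → SignType)} (hG : IsIsometric D G)
    {a : E} (hne : (contrAt a G).Nonempty)
    (hgate : ∀ W : E → SignType, W a = 0 → IsAntipodalFace (Sweep.contrAt a G) W →
      W ∈ gatedCovectors G)
    (hpar : ∀ f f' s, f ≠ f' → f ∈ D \ {a} → f' ∈ D \ {a} → s ≠ 0 →
      ¬ ∀ T ∈ Sweep.contrAt a G, T f' = s * T f) :
    IsIsometric (D \ {a}) (Sweep.contrAt a G) := by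
  have hsupp := contrAt_supp hG.supp a
  refine ⟨hsupp, hne, fun T hT T' hT' hTT' => ?_⟩
  obtain ⟨T'', ⟨hT'', hne'', hbet''⟩, hnear⟩ := exists_nearest (hsupp T hT)
    (N := {V | V ∈ Sweep.contrAt a G ∧ V ≠ T ∧ ∀ e, T e = T' e → V e = T e})
    (fun V hV => hsupp V hV.1) ⟨T', hT', hTT'.symm, fun e h => h.symm⟩
  have hadj : ∀ V ∈ Sweep.contrAt a G, (∀ e, T e = T'' e → V e = T e) → V = T ∨ V = T'' := by
    intro V hV hbet
    by_cases hVT : V = T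
    · exact Or.inl hVT
    · exact Or.inr (hnear V ⟨hV, hVT, fun e he => hbet e (hbet'' e he).symm⟩ hbet)
  have hWT : ∀ e, T e ≠ T'' e → agree T T'' e = 0 := fun e he => if_neg he
  have hWT' : ∀ e, T e = T'' e → agree T T'' e = T e := fun e he => if_pos he
  have hTa : T a = 0 := full_eq_zero (hsupp T hT) fun h => h.2 rfl
  have hT''a : T'' a = 0 := full_eq_zero (hsupp T'' hT'') fun h => h.2 rfl
  have hface : IsAntipodalFace (Sweep.contrAt a G) (agree T T'') := by
    refine ⟨⟨T, hT, fun e he => ?_⟩, fun V hV hconf => ?_⟩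
    · by_cases h : T e = T'' e
      · exact (hWT' e h).symm
      · exact absurd (hWT e h) he
    · have hbet : ∀ e, T e = T'' e → V e = T e := fun e he => by
        by_cases h0 : T e = 0
        · rw [h0]
          exact full_eq_zero (hsupp V hV) fun h => (hsupp T hT e).2 h h0
        · rw [hconf e (by rwa [hWT' e he]), hWT' e he]
      rcases hadj V hV hbet with rfl | rfl
      · convert hT'' using 1
        funext e
        by_cases he : V e = T'' e
        · by_cases h0 : V e = 0
          · rw [signComp_of_eq (by rw [hWT' e he, h0]), ← he, Pi.neg_apply, h0, neg_zero]
          · rw [signComp_of_ne (by rwa [hWT' e he]), hWT' e he, he]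
        · rw [signComp_of_eq (hWT e he), eq_of_full (hsupp V hV) (hsupp T'' hT'') he, Pi.neg_apply]
      · convert hT using 1
        funext e
        by_cases he : T e = V e
        · by_cases h0 : T e = 0
          · rw [signComp_of_eq (by rw [hWT' e he, h0]), Pi.neg_apply, ← he, h0, neg_zero]
          · rw [signComp_of_ne (by rwa [hWT' e he]), hWT' e he]
        · rw [signComp_of_eq (hWT e he), Pi.neg_apply, eq_of_full (hsupp T hT) (hsupp V hV) he,
            neg_neg]
  have hWa : agree T T'' a = 0 := by rw [hWT' a (by rw [hTa, hT''a]), hTa]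
  have hW := hgate _ hWa hface
  obtain ⟨f, hf⟩ := Function.ne_iff.1 hne''
  have hfD : ∀ f, T'' f ≠ T f → f ∈ D \ {a} := fun f hf => by
    by_contra h
    exact hf (by rw [full_eq_zero (hsupp T hT) h, full_eq_zero (hsupp T'' hT'') h])
  refine ⟨f, fun h => hf (hbet'' f h), ?_⟩
  by_cases hone : ∀ f', T'' f' ≠ T f' → f' = f
  · convert hT'' using 1
    funext g
    by_cases hg : g = f
    · rw [hg, flipAt_self, eq_of_full (hsupp T hT) (hsupp T'' hT'') (Ne.symm hf)]
    · rw [flipAt_of_ne _ hg]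
      by_contra h
      exact hg (hone g (Ne.symm h))
  · push Not at hone
    obtain ⟨f', hf', hff'⟩ := hone
    have h0 := (hsupp T hT f).2 (hfD f hf)
    have h0' := (hsupp T hT f').2 (hfD f' hf')
    refine absurd ?_ (hpar f f' (T f * T f') (Ne.symm hff') (hfD f hf) (hfD f' hf')
      (mul_ne_zero h0 h0'))
    intro V hV
    have h1 := (signComp_mem_contrAt hW hWa hV).1
    have h2 : signComp (agree T T'') V f = V f := signComp_of_eq (hWT f (Ne.symm hf))
    have h2' : signComp (agree T T'') V f' = V f' := signComp_of_eq (hWT f' (Ne.symm hf'))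
    have h3 : V f = T f ∧ V f' = T f' ∨ V f = - T f ∧ V f' = - T f' := by
      rcases hadj _ h1 (fun e he => by
        by_cases h0 : T e = 0
        · rw [signComp_of_eq (by rw [hWT' e he, h0]), h0]
          exact full_eq_zero (hsupp V hV) fun h => (hsupp T hT e).2 h h0
        · rw [signComp_of_ne (by rwa [hWT' e he]), hWT' e he]) with h | h
      · left; rw [← h2, ← h2', h]; exact ⟨rfl, rfl⟩
      · right; rw [← h2, ← h2', h]
        exact ⟨eq_of_full (hsupp T hT) (hsupp T'' hT'') (Ne.symm hf),
          eq_of_full (hsupp T hT) (hsupp T'' hT'') (Ne.symm hf')⟩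
    revert h0 h0' h3
    generalize T f = t
    generalize T f' = t'
    generalize V f = v
    generalize V f' = v'
    revert t t' v v'
    decide

theorem sepSet_signComp_comm (X Y : E → SignType) :
    sepSet (signComp X Y) (signComp Y X) = sepSet X Y := by
  ext e
  simp only [mem_sepSet, signComp]
  generalize X e = x
  generalize Y e = y
  revert x y
  decide

theorem signComp_signComp_comm (X Y : E → SignType) :
    signComp (signComp X Y) (signComp Y X) = signComp X Y := by
  funext e
  by_cases hx : X e = 0 <;> by_cases hy : Y e = 0 <;> simp [signComp, hx, hy]

/-- Parallel coordinates of the contraction would spoil its isometry, so elimination is carried out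
after deleting `f'`, where induction applies. The result is lifted back to `G`; as the lift vanishes
at `a`, its entry at `f'` is forced by the entry at `f`. -/
theorem gatedCovectors_elim_of_parallel [Finite E] {D : Set E} {G : Set (E → SignType)}
    (hG : IsIsometric D G) (hA : AntipodalGated G)
    (IH : ∀ (D' : Set E) (G' : Set (E → SignType)), D'.ncard < D.ncard → IsIsometric D' G' →
      AntipodalGated G' → IsCOM (gatedCovectors G')) (hZ : AntipodalOfContraction D G)
    {a : E} (haD : a ∈ D) (hne : (contrAt a G).Nonempty) {f f' : E} {s : SignType} (hff' : f ≠ f')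
    (hf : f ∈ D \ {a}) (hf' : f' ∈ D \ {a}) (hs : s ≠ 0)
    (hpar : ∀ T ∈ contrAt a G, T f' = s * T f) {X Y : E → SignType}
    (hX : X ∈ gatedCovectors G) (hY : Y ∈ gatedCovectors G) (hXa : X a = 0) (hYa : Y a = 0)
    {e : E} (he : e ∈ sepSet X Y) :
    ∃ Z ∈ gatedCovectors G, Z e = 0 ∧ ∀ g, g ∉ sepSet X Y → Z g = signComp X Y g := by
  have hlt : (D \ {f'}).ncard < D.ncard := Set.ncard_sdiff_singleton_lt_of_mem hf'.1
  have hG' := hG.delete f'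
  have hA' := hA.delete hG IH f'
  have hC := IH _ _ hlt hG' hA'
  have hrel : ∀ W ∈ gatedCovectors G, W a = 0 → W f' = s * W f := fun W hW ha =>
    gatedCovectors_parallel hG.supp hs hf hne hpar hW ha
  have hsep : f' ∈ sepSet X Y ↔ f ∈ sepSet X Y := by
    rw [mem_sepSet, mem_sepSet, hrel X hX hXa, hrel Y hY hYa]
    generalize X f = x
    generalize Y f = y
    revert hs
    clear hpar hrel
    revert s x y
    decide
  obtain ⟨e', he', hef', hee'⟩ : ∃ e', e' ∈ sepSet X Y ∧ e' ≠ f' ∧ (e' = e ∨ (e = f' ∧ e' = f)) := by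
    by_cases h : e = f'
    · subst h; exact ⟨f, hsep.1 he, hff', Or.inr ⟨rfl, rfl⟩⟩
    · exact ⟨e, he, h, Or.inl rfl⟩
  have hnot : ∀ g, g ≠ f' → g ∉ ({f'} : Set E) := fun g hg => hg
  have hsep' : ∀ g, g ≠ f' → (g ∈ sepSet (zeroOn {f'} X) (zeroOn {f'} Y) ↔ g ∈ sepSet X Y) := by
    intro g hg
    rw [mem_sepSet, mem_sepSet, zeroOn_of_notMem (hnot g hg), zeroOn_of_notMem (hnot g hg)]
  obtain ⟨Z, hZ', hZe, hZf⟩ := hC.elim _ (gatedCovectors_zeroOn hX {f'}) _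
    (gatedCovectors_zeroOn hY {f'}) e' ((hsep' e' hef').2 he')
  rw [← zeroOn_signComp] at hZf
  have hZg : ∀ g, g ≠ f' → g ∉ sepSet X Y → Z g = signComp X Y g := fun g hg hgs => by
    rw [hZf g (fun h => hgs ((hsep' g hg).1 h)), zeroOn_of_notMem (hnot g hg)]
  have haf' : a ≠ f' := fun h => hf'.2 h.symm
  have hXYa : signComp X Y a = 0 := by rw [signComp_of_eq hXa, hYa]
  have hZa : Z a = 0 := by
    rw [hZg a haf' fun h => h.1 hXa, hXYa]
  obtain ⟨Z', hZ'G, hZ'Z⟩ : ∃ Z' ∈ gatedCovectors G, zeroOn {f'} Z' = Z := by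
    by_cases h0 : ∃ e, Z e ≠ 0
    · exact exists_lift hG hA IH (isAntipodalFace_of_mem hG'.nonempty hZ') h0
    · push Not at h0
      have hcomp : ∀ T, signComp Z T = T := fun T => by funext e; exact signComp_of_eq (h0 e)
      -- `exists_lift` does not cover Z = 0. Zero lifts to itself if `G` is antipodal, and by `hZ`
      -- it suffices that the contraction at `a` is. Its deletion at `f'` is antipodal because Z = 0
      -- is gated there, and the entries at `f'` follow those at `f`.
      have hneg : ∀ T ∈ G, -T ∈ G := by
        refine hZ a haD hne fun T hT => ?_
        obtain ⟨T1, hT1, hT1', hT1eq⟩ := hT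
        have h1 := (hZ' _ ⟨T1, hT1, rfl⟩).2
        have h2 := (hZ' _ ⟨_, hT1', rfl⟩).2
        rw [hcomp, zeroOn_flipAt_of_notMem (hnot a haf'), ← flipAt_neg] at h2
        rw [hcomp] at h1
        have h3 : zeroOn {a} (-zeroOn {f'} T1) ∈ contrAt a (zeroOn {f'} '' G) := ⟨_, h1, h2, rfl⟩
        rw [contrAt_delete hG haf'] at h3
        obtain ⟨T2, hT2, hT2eq⟩ := h3
        convert hT2 using 1
        have h4 : ∀ g, g ≠ f' → (-T) g = T2 g := fun g hg => by
          have := congrFun hT2eq g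
          rw [zeroOn_of_notMem (hnot g hg)] at this
          rw [this, zeroOn_neg, Pi.neg_apply, Pi.neg_apply, hT1eq]
          unfold zeroOn
          simp [hg]
        funext g
        by_cases hg : g = f'
        · subst hg
          have := h4 f hff'
          rw [Pi.neg_apply] at this
          rw [Pi.neg_apply, hpar T ⟨T1, hT1, hT1', hT1eq⟩, hpar T2 hT2, ← this]
          simp
        · exact h4 g hg
      refine ⟨0, fun T hT => ?_, ?_⟩
      · have h00 : ∀ Z : E → SignType, signComp 0 Z = Z := fun Z => by funext e; simp [signComp]
        rw [h00, h00]
        exact ⟨hT, hneg T hT⟩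
      · funext g
        rw [h0 g]
        unfold zeroOn
        simp
  have hZ'g : ∀ g, g ≠ f' → Z' g = Z g := fun g hg => by
    rw [← hZ'Z, zeroOn_of_notMem (hnot g hg)]
  have hZ'f' := hrel Z' hZ'G (by rw [hZ'g a haf', hZa])
  refine ⟨Z', hZ'G, ?_, fun g hg => ?_⟩
  · rcases hee' with rfl | ⟨rfl, rfl⟩
    · rw [hZ'g _ hef', hZe]
    · rw [hZ'f', hZ'g _ hff', hZe, mul_zero]
  · by_cases hgf : g = f'
    · subst hgf
      rw [hZ'f', hrel _ (gatedCovectors_comp hX hY) hXYa, hZ'g f hff',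
        hZg f hff' fun h => hg (hsep.2 h)]
    · rw [hZ'g g hgf, hZg g hgf hg]

/-- The two statements need each other. The second, for `G`, uses the second for deletions, which
are antipodally gated by the first for smaller supports. The first, for `G`, then eliminates inside
the contraction at a common zero `a`, where the second identifies antipodal faces of the contraction
with gated covectors of `G`. -/
theorem isCOM_and_antipodalOfContraction [Finite E] (D : Set E) (G : Set (E → SignType))
    (hG : IsIsometric D G) (hA : AntipodalGated G) :
    IsCOM (gatedCovectors G) ∧ AntipodalOfContraction D G := by
  induction hn : D.ncard using Nat.strong_induction_on generalizing D G with
  | _ n ih =>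
  subst hn
  have IH1 : ∀ (D' : Set E) (G' : Set (E → SignType)), D'.ncard < D.ncard → IsIsometric D' G' →
      AntipodalGated G' → IsCOM (gatedCovectors G') := fun D' G' hlt h1 h2 =>
    (ih _ hlt D' G' h1 h2 rfl).1
  have IH2 : ∀ (D' : Set E) (G' : Set (E → SignType)), D'.ncard < D.ncard → IsIsometric D' G' →
      AntipodalGated G' → AntipodalOfContraction D' G' := fun D' G' hlt h1 h2 =>
    (ih _ hlt D' G' h1 h2 rfl).2
  have hZ : AntipodalOfContraction D G := antipodalOfContraction hG hA fun f hf =>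
    IH2 _ _ (Set.ncard_sdiff_singleton_lt_of_mem hf) (hG.delete f) (hA.delete hG IH1 f)
  refine ⟨⟨fun X hX Y hY => gatedCovectors_face hX hY, ?_⟩, hZ⟩
  -- X∘Y and Y∘X have equal zero sets, while the separation set and the target X∘Y are unchanged.
  suffices key : ∀ X ∈ gatedCovectors G, ∀ Y ∈ gatedCovectors G, (∀ g, X g = 0 ↔ Y g = 0) →
      ∀ e ∈ sepSet X Y, ∃ Z ∈ gatedCovectors G, Z e = 0 ∧
        ∀ g, g ∉ sepSet X Y → Z g = signComp X Y g by
    intro X hX Y hY e he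
    have := key _ (gatedCovectors_comp hX hY) _ (gatedCovectors_comp hY hX) (fun g => by
      simp only [signComp]
      generalize X g = x
      generalize Y g = y
      revert x y
      decide) e (by rwa [sepSet_signComp_comm])
    rwa [sepSet_signComp_comm, signComp_signComp_comm] at this
  intro X hX Y hY hXY e he
  have hXD := gatedCovectors_supp hG.supp hG.nonempty hX
  have hYD := gatedCovectors_supp hG.supp hG.nonempty hY
  obtain ⟨T₀, hT₀⟩ := hG.nonempty
  have hneXY : ∀ T ∈ G, signComp X T e ≠ signComp Y T e := fun T hT => by
    rw [signComp_of_ne he.1, signComp_of_ne (by rw [he.2]; simpa using he.1), he.2]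
    exact sign_ne_neg_self he.1
  obtain ⟨T, hT, hTe, hTbet⟩ := hG.exists_flip_between (hX T₀ hT₀).1 (hY T₀ hT₀).1 (hneXY T₀ hT₀)
  by_cases hfull : ∀ a ∈ D, X a ≠ 0
  · -- full covectors
    have hX0 : ∀ g, X g = 0 → g ∉ D := fun g hg h => hfull g h hg
    have hfull0 : ∀ T ∈ G, ∀ g, X g = 0 → T g = 0 := fun T hT g hg =>
      full_eq_zero (hG.supp T hT) (hX0 g hg)
    refine ⟨zeroOn {e} T, fun T' hT' => ?_, zeroOn_of_mem (Set.mem_singleton e), fun g hg => ?_⟩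
    · have : ∀ T' : E → SignType, (∀ g, T' g ≠ 0 ↔ g ∈ D) → signComp (zeroOn {e} T) T' ∈ G := by
        intro T' hT'
        by_cases hh : T' e = T e
        · convert hT using 1
          funext g
          by_cases hge : g = e
          · rw [hge, signComp_of_eq (zeroOn_of_mem (Set.mem_singleton e)), hh]
          · rw [← congrFun (signComp_eq_of_full (hG.supp T hT) hT') g]
            simp [signComp, zeroOn, hge]
        · convert hTe using 1
          funext g
          by_cases hge : g = e
          · rw [hge, signComp_of_eq (zeroOn_of_mem (Set.mem_singleton e)), flipAt_self]
            exact eq_of_full (hG.supp T hT) hT' (Ne.symm hh)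
          · rw [flipAt_of_ne _ hge, ← congrFun (signComp_eq_of_full (hG.supp T hT) hT') g]
            simp [signComp, zeroOn, hge]
      exact ⟨this _ (hG.supp T' hT'), this _ (full_neg (hG.supp T' hT'))⟩
    · have hge : g ≠ e := by rintro rfl; exact hg he
      rw [zeroOn_of_notMem (show g ∉ ({e} : Set E) from hge)]
      by_cases hx : X g = 0
      · rw [hfull0 T hT g hx, signComp_of_eq hx, (hXY g).1 hx]
      · have hy : Y g ≠ 0 := fun hy => hx ((hXY g).2 hy)
        have hxy : X g = Y g := by
          by_contra hne
          exact hg ⟨hx, sign_eq_neg_of_ne hx hy hne⟩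
        rw [hTbet g (by rw [signComp_of_ne hx, signComp_of_ne hy, hxy]), signComp_of_ne hx,
          signComp_of_ne hx]
  · push Not at hfull
    obtain ⟨a, haD, hXa⟩ := hfull
    have hYa := (hXY a).1 hXa
    -- As `X` vanishes at `a`, the elements X∘T₀ and X∘(-T₀) of `G` lie on different sides of `a`,
    -- so some edge crosses `a`.
    have hne : (contrAt a G).Nonempty := by
      obtain ⟨T', hT', hTa', -⟩ := hG.exists_flip_between (e := a) (hX T₀ hT₀).1 (hX T₀ hT₀).2 (by
        rw [signComp_of_eq hXa, signComp_of_eq hXa]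
        exact sign_ne_neg_self ((hG.supp T₀ hT₀ a).2 haD))
      exact ⟨_, T', hT', hTa', rfl⟩
    by_cases hpar : ∃ f f' s, f ≠ f' ∧ f ∈ D \ {a} ∧ f' ∈ D \ {a} ∧ s ≠ 0 ∧
        ∀ T ∈ contrAt a G, T f' = s * T f
    · obtain ⟨f, f', s, hff', hf, hf', hs, hpar⟩ := hpar
      exact gatedCovectors_elim_of_parallel hG hA IH1 hZ haD hne hff' hf hf' hs hpar hX hY hXa hYa he
    · have hgate : ∀ W : E → SignType, W a = 0 → IsAntipodalFace (contrAt a G) W →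
          W ∈ gatedCovectors G := fun W ha hW =>
        mem_gatedCovectors_of_contrAt hG hA IH2 hZ haD ha hW
      have hKa : ∀ W, IsAntipodalFace (contrAt a G) W → W a = 0 := fun W hW => by
        by_contra h
        exact (isAntipodalFace_supp (contrAt_supp hG.supp a) hW a h).2 rfl
      have hK := hG.contrAt hne hgate (by
        intro f f' s h1 h2 h3 h4 h5
        exact hpar ⟨f, f', s, h1, h2, h3, h4, h5⟩)
      have hKA : AntipodalGated (contrAt a G) := fun W hW T hT =>
        signComp_mem_contrAt (hgate W (hKa W hW) hW) (hKa W hW) hT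
      obtain ⟨Z, hZK, hZe, hZf⟩ := (IH1 _ _ (Set.ncard_sdiff_singleton_lt_of_mem haD) hK hKA).elim X
        (fun T hT => signComp_mem_contrAt hX hXa hT) Y
        (fun T hT => signComp_mem_contrAt hY hYa hT) e he
      have hZW := isAntipodalFace_of_mem hne hZK
      exact ⟨Z, hgate Z (hKa Z hZW) hZW, hZe, hZf⟩

open Classical in
/-- The sign-vector with the single non-zero entry `s` at `f`. -/
noncomputable def singleAt (f : E) (s : SignType) : E → SignType :=
  fun e => if e = f then s else 0

theorem singleAt_self (f : E) (s : SignType) : singleAt f s f = s := by simp [singleAt]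

theorem singleAt_of_ne {f e : E} (s : SignType) (h : e ≠ f) : singleAt f s e = 0 := by
  simp [singleAt, h]

/-- `G` misses exactly, on one side of `e`, the sign-vector `B` and its antipode in that side, and on
the other side some of the neighbours of `-B` and possibly `-B`, but no neighbour if `-B ∈ G`. -/
structure IsCubeDefect (D : Set E) (G : Set (E → SignType)) (e : E) (B : E → SignType) : Prop where
  mem : e ∈ D
  four_le : 4 ≤ D.ncard
  full : ∀ f, B f ≠ 0 ↔ f ∈ D
  notMem : B ∉ G
  notMem_flip : flipAt e (-B) ∉ G
  side : ∀ V : E → SignType, (∀ f, V f ≠ 0 ↔ f ∈ D) → V e = B e → V ≠ B → V ≠ flipAt e (-B) → V ∈ G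
  flip_mem : flipAt e B ∈ G
  otherSide : ∀ V : E → SignType, (∀ f, V f ≠ 0 ↔ f ∈ D) → V e = -B e → V ∉ G →
    V = -B ∨ ∃ g ∈ D, g ≠ e ∧ V = flipAt g (-B)
  neg_mem : -B ∈ G → ∀ g ∈ D, g ≠ e → flipAt g (-B) ∈ G

theorem eq_or_eq_flipAt {D : Set E} {V W : E → SignType} (hV : ∀ e, V e ≠ 0 ↔ e ∈ D)
    (hW : ∀ e, W e ≠ 0 ↔ e ∈ D) {f : E} (h : ∀ g, g ≠ f → V g = W g) : V = W ∨ V = flipAt f W := by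
  by_cases hf : V f = W f
  · left; funext g
    by_cases hg : g = f
    · rw [hg, hf]
    · exact h g hg
  · right; funext g
    by_cases hg : g = f
    · rw [hg, flipAt_self]; exact eq_of_full hW hV (Ne.symm hf)
    · rw [flipAt_of_ne _ hg, h g hg]

/-- Composition with `X` can be carried out inside the halfspace of `f` that contains both the face
of `X` and `T`, and there gatedness is assumed. In a minimal counterexample this leaves only the `T`
that oppose `X` on its whole support. -/
theorem signComp_mem_of_star {G : Set (E → SignType)} {f : E} {X T : E → SignType}
    (hA : AntipodalGated (starOf G (singleAt f (X f)))) (hX : IsAntipodalFace G X) (hf : X f ≠ 0)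
    (hT : T ∈ G) (hTf : T f = X f) : signComp X T ∈ G := by
  have hsupp : {e | singleAt f (X f) e ≠ 0} = {f} := by
    ext e
    by_cases h : e = f
    · subst h; simp [singleAt_self, hf]
    · simp [singleAt_of_ne _ h, h]
  have hmem : ∀ V ∈ G, V f = X f → zeroOn {f} V ∈ starOf G (singleAt f (X f)) := by
    intro V hV hVf
    rw [← hsupp]
    refine zeroOn_supp_mem_starOf hV fun e he => ?_
    by_cases h : e = f
    · subst h; rw [hVf, singleAt_self]
    · exact absurd (singleAt_of_ne _ h) he
  have hcomp : ∀ V, signComp (singleAt f (X f)) (signComp (zeroOn {f} X) V) = signComp X V := by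
    intro V; funext e
    by_cases h : e = f
    · subst h; simp [signComp, singleAt_self, hf]
    · simp [signComp, singleAt_of_ne _ h, zeroOn, h]
  have hface : IsAntipodalFace (starOf G (singleAt f (X f))) (zeroOn {f} X) := by
    obtain ⟨⟨T₀, hT₀, hXT₀⟩, hanti⟩ := hX
    refine ⟨⟨_, hmem T₀ hT₀ (hXT₀ f hf), fun e he => ?_⟩, fun V hV hconf => ⟨?_, fun e he => ?_⟩⟩
    · by_cases h : e = f
      · exact absurd (zeroOn_of_mem (S := {f}) h) he
      · rw [zeroOn_of_notMem (show e ∉ ({f} : Set E) from h),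
          zeroOn_of_notMem (show e ∉ ({f} : Set E) from h)] at *
        exact hXT₀ e he
    · rw [hcomp]
      convert hanti _ hV.1 (fun e he => ?_) using 1
      · funext e
        by_cases h : e = f
        · subst h; simp [signComp, hf]
        · simp [signComp, singleAt_of_ne _ h]
      · by_cases h : e = f
        · subst h; rw [signComp_of_ne (by rwa [singleAt_self]), singleAt_self]
        · rw [signComp_of_eq (singleAt_of_ne _ h)]
          have := hconf e
          rw [zeroOn_of_notMem (show e ∉ ({f} : Set E) from h)] at this
          exact this he
    · have h : e = f := by
        by_contra h; exact he (singleAt_of_ne _ h)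
      rw [signComp_of_eq (zeroOn_of_mem (S := {f}) h), Pi.neg_apply, hV.2 e he, neg_zero]
  have := (hA _ hface _ (hmem T hT hTf)).1.1
  rw [hcomp] at this
  convert this using 1
  funext e
  by_cases h : e = f
  · subst h; rw [signComp_of_ne hf, signComp_of_ne hf]
  · unfold signComp
    rw [zeroOn_of_notMem (show e ∉ ({f} : Set E) from h)]

/-- A `T` with X∘T missing opposes `X` on the whole support. If the support had a second element f,
then after deleting f the vector X would still describe an antipodal face: conformity at `e` already
rules out the bad elements. Gatedness of the deletion gives some V in `G` that agrees with X∘T off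
f; it does not oppose X at `e`, so X∘V = X∘T is present after all. -/
theorem eq_singleAt_of_minimal {D : Set E} {G : Set (E → SignType)} (hG : IsIsometric D G)
    (hstar : ∀ f ∈ D, ∀ s ≠ 0, (∃ T ∈ G, T f = s) → AntipodalGated (starOf G (singleAt f s)))
    (hdel : ∀ f ∈ D, AntipodalGated (zeroOn {f} '' G)) {X : E → SignType}
    (hX : IsAntipodalFace G X) {T : E → SignType} (hT : T ∈ G) (hXT : signComp X T ∉ G) :
    ∃ e ∈ D, X e ≠ 0 ∧ T e = -X e ∧ ∀ g, g ≠ e → X g = 0 := by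
  have hXD := isAntipodalFace_supp hG.supp hX
  have h2 : ∀ V ∈ G, signComp X V ∉ G → ∀ f, X f ≠ 0 → V f = -X f := by
    intro V hV hXV f hf
    have hf' := hXD f hf
    refine sign_eq_neg_of_ne hf ((hG.supp V hV f).2 hf') fun h => hXV ?_
    exact signComp_mem_of_star (hstar f hf' _ hf ⟨V, hV, h.symm⟩) hX hf hV h.symm
  have h3 : ∃ e, X e ≠ 0 := by
    by_contra hcon
    push Not at hcon
    apply hXT
    convert hT using 1
    funext g
    exact signComp_of_eq (hcon g)
  obtain ⟨e, he⟩ := h3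
  refine ⟨e, hXD e he, he, h2 T hT hXT e he, fun f hfe => ?_⟩
  by_contra hf
  have hfD := hXD f hf
  have hnot : ∀ g, g ≠ f → g ∉ ({f} : Set E) := fun g hg => hg
  have hV : ∀ V ∈ G, Conf (zeroOn {f} X) (zeroOn {f} V) → signComp X V ∈ G := by
    intro V hV hconf
    by_contra hcon
    have h4 := hconf e
    rw [zeroOn_of_notMem (hnot e (Ne.symm hfe)), zeroOn_of_notMem (hnot e (Ne.symm hfe)),
      h2 V hV hcon e he] at h4
    exact sign_ne_neg_self he (h4 he).symm
  have hface : IsAntipodalFace (zeroOn {f} '' G) (zeroOn {f} X) := by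
    constructor
    · obtain ⟨⟨T₀, hT₀, hXT₀⟩, -⟩ := hX
      refine ⟨_, ⟨T₀, hT₀, rfl⟩, fun g hg => ?_⟩
      by_cases h : g = f
      · exact absurd (zeroOn_of_mem (S := {f}) h) hg
      · rw [zeroOn_of_notMem (hnot g h)] at *
        rw [zeroOn_of_notMem (hnot g h), hXT₀ g hg]
    · rintro _ ⟨V, hVG, rfl⟩ hconf
      refine ⟨_, hX.2 _ (hV V hVG hconf) (Conf.signComp _ _), ?_⟩
      rw [signComp_neg_signComp, zeroOn_signComp, zeroOn_neg]
  obtain ⟨V, hVG, hVeq⟩ := (hdel f hfD _ hface _ ⟨T, hT, rfl⟩).1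
  rw [← zeroOn_signComp] at hVeq
  have hVg : ∀ g, g ≠ f → V g = signComp X T g := fun g hg => by
    have := congrFun hVeq g
    rwa [zeroOn_of_notMem (hnot g hg), zeroOn_of_notMem (hnot g hg)] at this
  apply hXT
  convert hV V hVG (by
    rw [hVeq, zeroOn_signComp]
    exact Conf.signComp _ _) using 1
  funext g
  by_cases hx : X g = 0
  · rw [signComp_of_eq (Y := V) hx, hVg g (by rintro rfl; exact hf hx)]
  · rw [signComp_of_ne hx, signComp_of_ne hx]

/-- By minimality the bad face is one side of a coordinate e, and B = X∘T is a missing vector whose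
neighbour across e is present. Deletions show that all neighbours of B on its side are present. If
any vector were missing other than the few allowed ones, a nearest such R would span with B an
antipodal face containing an element on which gating restores B. -/
theorem exists_isCubeDefect [Finite E] {D : Set E} {G : Set (E → SignType)} (hG : IsIsometric D G)
    (hstar : ∀ f ∈ D, ∀ s ≠ 0, (∃ T ∈ G, T f = s) → AntipodalGated (starOf G (singleAt f s)))
    (hdel : ∀ f ∈ D, AntipodalGated (zeroOn {f} '' G)) (hA : ¬ AntipodalGated G) :
    ∃ e B, IsCubeDefect D G e B := by
  unfold AntipodalGated at hA
  push Not at hA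
  obtain ⟨X, hX, hXA⟩ := hA
  obtain ⟨T, hT, hXT⟩ : ∃ T ∈ G, signComp X T ∉ G := by
    by_contra hcon
    push Not at hcon
    exact hXA (mem_gatedCovectors_of_face hX hcon)
  obtain ⟨e, heD, he, hTe, hX0⟩ := eq_singleAt_of_minimal hG hstar hdel hX hT hXT
  have hfullT := hG.supp T hT
  obtain ⟨B, hBdef⟩ : ∃ B, B = signComp X T := ⟨_, rfl⟩
  rw [← hBdef] at hXT
  have hBe : B e = X e := by rw [hBdef, signComp_of_ne he]
  have hBg : ∀ g, g ≠ e → B g = T g := fun g hg => by rw [hBdef, signComp_of_eq (hX0 g hg)]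
  have hBT : flipAt e B = T := by
    funext g
    by_cases hg : g = e
    · rw [hg, flipAt_self, hBe, hTe]
    · rw [flipAt_of_ne _ hg, hBg g hg]
  have hB : ∀ f, B f ≠ 0 ↔ f ∈ D := by
    rw [← flipAt_flipAt e B, hBT]; exact full_flipAt hfullT e
  have hXconf : ∀ V : E → SignType, V e = B e → Conf X V := fun V hV g hg => by
    by_cases h : g = e
    · rw [h, hV, hBe]
    · exact absurd (hX0 g h) hg
  have hXV : ∀ V : E → SignType, signComp X (-V) = flipAt e (-V) ∨ V e ≠ X e := by
    intro V
    by_cases h : V e = X e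
    · left; funext g
      by_cases hg : g = e
      · rw [hg, signComp_of_ne he, flipAt_self, Pi.neg_apply, neg_neg, h]
      · rw [signComp_of_eq (hX0 g hg), flipAt_of_ne _ hg]
    · exact Or.inr h
  have hanti : ∀ V ∈ G, V e = B e → flipAt e (-V) ∈ G := fun V hV hVe => by
    have := hX.2 V hV (hXconf V hVe)
    rcases hXV V with h | h
    · rwa [h] at this
    · exact absurd (hVe.trans hBe) h
  -- the neighbours of `B` on its side
  have hnb : ∀ f ∈ D, f ≠ e → flipAt f B ∈ G := by
    intro f hfD hfe
    have hnot : ∀ g, g ≠ f → g ∉ ({f} : Set E) := fun g hg => hg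
    have hXf := zeroOn_eq_self (hX0 f hfe)
    have hface : IsAntipodalFace (zeroOn {f} '' G) X := by
      obtain ⟨⟨T₀, hT₀, hXT₀⟩, hanti'⟩ := hX
      refine ⟨⟨_, ⟨T₀, hT₀, rfl⟩, (conf_zeroOn_iff (hX0 f hfe)).2 hXT₀⟩, ?_⟩
      rintro _ ⟨V, hV, rfl⟩ hconf
      refine ⟨_, hanti' V hV ((conf_zeroOn_iff (hX0 f hfe)).1 hconf), ?_⟩
      rw [zeroOn_signComp, hXf, zeroOn_neg]
    obtain ⟨V, hVG, hVeq⟩ := (hdel f hfD _ hface _ ⟨T, hT, rfl⟩).1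
    have hVeq' : zeroOn {f} V = zeroOn {f} B := by rw [hVeq, hBdef, zeroOn_signComp, hXf]
    rcases eq_or_eq_flipAt (hG.supp V hVG) hB (f := f) (fun g hg => by
      have := congrFun hVeq' g
      rwa [zeroOn_of_notMem (hnot g hg), zeroOn_of_notMem (hnot g hg)] at this) with h | h
    · exact absurd (h ▸ hVG) hXT
    · exact h ▸ hVG
  have hB'full : ∀ f, flipAt e (-B) f ≠ 0 ↔ f ∈ D := full_flipAt (full_neg hB) e
  have hB'e : flipAt e (-B) e = B e := by rw [flipAt_self, Pi.neg_apply, neg_neg]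
  have hB'g : ∀ g, g ≠ e → flipAt e (-B) g = -B g := fun g hg => by
    rw [flipAt_of_ne _ hg, Pi.neg_apply]
  -- Opposition in the side of `e` is V ↦ `flipAt e (-V)`; it preserves the part of `G` on that side
  -- and exchanges B with this vector.
  have hB'G : flipAt e (-B) ∉ G := by
    intro h
    apply hXT
    convert hanti _ h hB'e using 1
    rw [← flipAt_neg, neg_neg, flipAt_flipAt]
  have hBne : ∀ g ∈ D, B g ≠ -B g := fun g hg => sign_ne_neg_self ((hB g).2 hg)
  -- composition with the common part of two missing sign-vectors
  have hgate : ∀ R W : E → SignType, IsAntipodalFace G (agree B R) → W ∈ G →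
      (∀ h, B h ≠ R h → W h = B h) → ¬ ∃ h ∈ D, B h = R h ∧ W h = B h := by
    rintro R W hface hW hWB ⟨h, hhD, hhR, hhW⟩
    have hz : agree B R h = B h := if_pos hhR
    have hBh := (hB h).2 hhD
    have h1 := signComp_mem_of_star (f := h) (X := agree B R) (T := W)
      (hstar h hhD _ (by rwa [hz]) ⟨W, hW, by rw [hz, hhW]⟩) hface (by rwa [hz]) hW (by rw [hz, hhW])
    apply hXT
    convert h1 using 1
    funext g
    by_cases hg : B g = R g
    · by_cases h0 : B g = 0
      · rw [h0]
        refine (full_eq_zero (full_signComp (isAntipodalFace_supp hG.supp hface) (hG.supp W hW))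
          fun hD => (hB g).2 hD h0).symm
      · have hz : agree B R g = B g := if_pos hg
        rw [signComp_of_ne (by rwa [hz]), hz]
    · rw [signComp_of_eq (show agree B R g = 0 from if_neg hg), hWB g hg]
  -- A nearest exception R shares with B a coordinate g other than `e`. The antipode of B within the
  -- side does not share g, so it is outside the interval, and gating `T` restores B.
  have hside : ∀ V : E → SignType, (∀ f, V f ≠ 0 ↔ f ∈ D) → V e = B e → V ≠ B →
      V ≠ flipAt e (-B) → V ∈ G := by
    intro V₀ hV₀D hV₀e hV₀B hV₀B'
    by_contra hV₀G
    obtain ⟨R, ⟨hRD, hRe, hRB, hRB', hRG⟩, hnear⟩ := exists_nearest hB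
      (N := {V | (∀ f, V f ≠ 0 ↔ f ∈ D) ∧ V e = B e ∧ V ≠ B ∧ V ≠ flipAt e (-B) ∧ V ∉ G})
      (fun V hV => hV.1) ⟨V₀, hV₀D, hV₀e, hV₀B, hV₀B', hV₀G⟩
    obtain ⟨g, hgD, hge, hgR⟩ : ∃ g ∈ D, g ≠ e ∧ B g = R g := by
      by_contra hcon
      push Not at hcon
      apply hRB'
      funext g
      by_cases hgD : g ∈ D
      · by_cases hge : g = e
        · rw [hge, hRe, hB'e]
        · rw [hB'g g hge, eq_of_full hB hRD (hcon g hgD hge)]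
      · rw [full_eq_zero hRD hgD, full_eq_zero hB'full hgD]
    refine hgate R T (isAntipodalFace_agree hG.supp hB hRD hXT hRG (fun V hVD hbet hVB hVR => ?_) ?_)
      hT (fun h hh => (hBg h (by rintro rfl; exact hh hRe.symm)).symm) ⟨g, hgD, hgR, (hBg g hge).symm⟩
    · by_contra hVG
      refine hVR (hnear V ⟨hVD, hbet e hRe.symm, hVB, ?_, hVG⟩ hbet)
      rintro rfl
      have := hbet g hgR
      rw [hB'g g hge] at this
      exact hBne g hgD this.symm
    · obtain ⟨f, hf⟩ := Function.ne_iff.1 hRB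
      have hfD : f ∈ D := by
        by_contra hfD
        exact hf (by rw [full_eq_zero hB hfD, full_eq_zero hRD hfD])
      refine ⟨_, hnb f hfD (by rintro rfl; exact hf hRe), fun h hh => ?_⟩
      rw [flipAt_of_ne]
      rintro rfl
      exact hf hh.symm
  -- The exceptions agree with B in at least two coordinates g, h other than `e`. The neighbour of B
  -- in direction g still agrees with B at h, so gating it by the interval up to a nearest exception
  -- restores B.
  have hother : ∀ V : E → SignType, (∀ f, V f ≠ 0 ↔ f ∈ D) → V e = -B e → V ∉ G →
      V = -B ∨ ∃ g ∈ D, g ≠ e ∧ V = flipAt g (-B) := by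
    intro V₀ hV₀D hV₀e hV₀G
    by_contra hV₀
    -- far from `-B`
    have hfar : ∀ V : E → SignType, (∀ f, V f ≠ 0 ↔ f ∈ D) → V e = -B e →
        (¬ (V = -B ∨ ∃ g ∈ D, g ≠ e ∧ V = flipAt g (-B)) ↔
          ∃ g ∈ D, ∃ h ∈ D, g ≠ e ∧ h ≠ e ∧ g ≠ h ∧ V g = B g ∧ V h = B h) := by
      intro V hVD hVe
      constructor
      · intro hcon
        push Not at hcon
        obtain ⟨hV1, hV2⟩ := hcon
        obtain ⟨g, hg⟩ := Function.ne_iff.1 hV1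
        have hgD : g ∈ D := by
          by_contra hgD
          exact hg (by rw [full_eq_zero hVD hgD, full_eq_zero (full_neg hB) hgD])
        have hge : g ≠ e := by rintro rfl; exact hg hVe
        obtain ⟨h, hh⟩ := Function.ne_iff.1 (hV2 g hgD hge)
        have hhD : h ∈ D := by
          by_contra hhD
          exact hh (by rw [full_eq_zero hVD hhD, full_eq_zero (full_flipAt (full_neg hB) g) hhD])
        have hhg : h ≠ g := by
          rintro rfl
          apply hh
          rw [flipAt_self, eq_of_full (full_neg hB) hVD (Ne.symm hg)]
        rw [flipAt_of_ne _ hhg] at hh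
        refine ⟨g, hgD, h, hhD, hge, by rintro rfl; exact hh hVe, hhg.symm, ?_, ?_⟩
        · rw [eq_of_full (full_neg hB) hVD (Ne.symm hg), Pi.neg_apply, neg_neg]
        · rw [eq_of_full (full_neg hB) hVD (Ne.symm hh), Pi.neg_apply, neg_neg]
      · rintro ⟨g, hgD, h, hhD, -, -, hgh, hVg, hVh⟩ (rfl | ⟨k, -, -, rfl⟩)
        · exact hBne g hgD hVg.symm
        · by_cases hk : g = k
          · rw [flipAt_of_ne _ (fun hh => hgh (hk.trans hh.symm))] at hVh
            exact hBne h hhD hVh.symm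
          · rw [flipAt_of_ne _ hk] at hVg
            exact hBne g hgD hVg.symm
    obtain ⟨R, ⟨hRD, hRe, hRG, hRfar⟩, hnear⟩ := exists_nearest hB
      (N := {V | (∀ f, V f ≠ 0 ↔ f ∈ D) ∧ V e = -B e ∧ V ∉ G ∧
        ¬ (V = -B ∨ ∃ g ∈ D, g ≠ e ∧ V = flipAt g (-B))})
      (fun V hV => hV.1) ⟨V₀, hV₀D, hV₀e, hV₀G, hV₀⟩
    obtain ⟨g, hgD, h, hhD, hge, hhe, hgh, hgR, hhR⟩ := (hfar R hRD hRe).1 hRfar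
    have hRT : ∃ f ∈ D, f ≠ e ∧ B f ≠ R f := by
      by_contra hcon
      push Not at hcon
      apply hRG
      convert hT using 1
      funext f
      by_cases hfD : f ∈ D
      · by_cases hfe : f = e
        · rw [hfe, hRe, hTe, hBe]
        · rw [← hcon f hfD hfe, hBg f hfe]
      · rw [full_eq_zero hRD hfD, full_eq_zero hfullT hfD]
    refine hgate R (flipAt g B) (isAntipodalFace_agree hG.supp hB hRD hXT hRG
      (fun V hVD hbet hVB hVR => ?_) ?_) (hnb g hgD hge) (fun k hk => ?_)
      ⟨h, hhD, hhR.symm, by rw [flipAt_of_ne _ hgh.symm]⟩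
    · by_cases hVe : V e = B e
      · refine hside V hVD hVe hVB ?_
        rintro rfl
        have := hbet g hgR.symm
        rw [hB'g g hge] at this
        exact hBne g hgD this.symm
      · have hVe' := eq_of_full hB hVD (Ne.symm hVe)
        by_contra hVG
        exact hVR (hnear V ⟨hVD, hVe', hVG, (hfar V hVD hVe').2
          ⟨g, hgD, h, hhD, hge, hhe, hgh, hbet g hgR.symm, hbet h hhR.symm⟩⟩ hbet)
    · obtain ⟨f, hfD, hfe, hf⟩ := hRT
      refine ⟨_, hnb f hfD hfe, fun k hk => ?_⟩
      rw [flipAt_of_ne]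
      rintro rfl
      exact hf hk
    · rw [flipAt_of_ne]
      rintro rfl
      exact hk hgR.symm
  refine ⟨e, B, heD, ?_, hB, hXT, hB'G, hside, hBT ▸ hT, hother, fun hneg g hgD hge => ?_⟩
  -- With one coordinate, B would be in the face of X. With two, a neighbour of B would equal its
  -- missing antipode in the side. With three, two neighbours of B would be at distance two with
  -- both intermediate vertices missing, against isometry.
  · by_contra hcard
    have hD' : (D \ {e}).ncard ≤ 2 := by
      have := Set.ncard_sdiff_singleton_add_one heD (Set.toFinite D)
      omega
    have hD0 : ∃ f ∈ D, f ≠ e := by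
      by_contra hcon
      push Not at hcon
      obtain ⟨⟨V, hV, hXV'⟩, -⟩ := hX
      apply hXT
      convert hV using 1
      funext g
      by_cases hgD : g ∈ D
      · rw [hcon g hgD, hBe, hXV' e he]
      · rw [full_eq_zero hB hgD, full_eq_zero (hG.supp V hV) hgD]
    obtain ⟨f, hfD, hfe⟩ := hD0
    have hflip : ∃ g ∈ D, g ≠ e ∧ g ≠ f := by
      by_contra hcon
      push Not at hcon
      apply hB'G
      convert hnb f hfD hfe using 1
      funext g
      by_cases hgD : g ∈ D
      · by_cases hge : g = e
        · rw [hge, hB'e, flipAt_of_ne _ (Ne.symm hfe)]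
        · rw [hcon g hgD hge, flipAt_self, hB'g f hfe]
      · rw [full_eq_zero hB'full hgD, full_eq_zero (full_flipAt hB f) hgD]
    obtain ⟨g, hgD, hge, hgf⟩ := hflip
    have hDeq : ∀ k ∈ D, k = e ∨ k = f ∨ k = g := by
      intro k hk
      by_contra hcon
      push Not at hcon
      have : ({f, g, k} : Set E) ⊆ D \ {e} := by
        rintro x (rfl | rfl | rfl)
        · exact ⟨hfD, hfe⟩
        · exact ⟨hgD, hge⟩
        · exact ⟨hk, hcon.1⟩
      have h1 := Set.ncard_le_ncard this (Set.toFinite _)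
      rw [Set.ncard_eq_three.2 ⟨f, g, k, hgf.symm, hcon.2.1.symm, hcon.2.2.symm, rfl⟩] at h1
      omega
    have hfg : flipAt f (flipAt g B) = flipAt e (-B) := by
      funext k
      by_cases hkD : k ∈ D
      · rcases hDeq k hkD with rfl | rfl | rfl
        · rw [flipAt_of_ne _ (Ne.symm hfe), flipAt_of_ne _ (Ne.symm hge), hB'e]
        · rw [flipAt_self, flipAt_of_ne _ (Ne.symm hgf), hB'g k hfe]
        · rw [flipAt_of_ne _ hgf, flipAt_self, hB'g k hge]
      · rw [full_eq_zero hB'full hkD, full_eq_zero (full_flipAt (full_flipAt hB g) f) hkD]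
    have hne : flipAt f B ≠ flipAt g B := fun h => by
      have := congrFun h f
      rw [flipAt_self, flipAt_of_ne _ (Ne.symm hgf)] at this
      exact hBne f hfD this.symm
    obtain ⟨k, hk, hkG⟩ := hG.flip _ (hnb f hfD hfe) _ (hnb g hgD hge) hne
    by_cases hkf : k = f
    · rw [hkf, flipAt_flipAt] at hkG
      exact hXT hkG
    · by_cases hkg : k = g
      · rw [hkg, flipAt_comm, hfg] at hkG
        exact hB'G hkG
      · rw [flipAt_of_ne _ hkf, flipAt_of_ne _ hkg] at hk
        exact hk rfl
  · -- `-B` and its neighbour on the other side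
    have h1 : flipAt e (flipAt g (-B)) ∈ G := by
      have := hanti _ (hnb g hgD hge) (by rw [flipAt_of_ne _ (Ne.symm hge)])
      rwa [← flipAt_neg] at this
    have hne : -B ≠ flipAt e (flipAt g (-B)) := fun h => by
      have := congrFun h g
      rw [flipAt_of_ne _ hge, flipAt_self, Pi.neg_apply, neg_neg] at this
      exact hBne g hgD this.symm
    -- From -B to `flipAt e (flipAt g (-B))` there are two shortest paths, and the one through
    -- `flipAt e (-B)` is blocked.
    obtain ⟨k, hk, hkG⟩ := hG.flip _ hneg _ h1 hne
    by_cases hke : k = e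
    · exact absurd (hke ▸ hkG) hB'G
    · by_cases hkg : k = g
      · exact hkg ▸ hkG
      · rw [flipAt_of_ne _ hke, flipAt_of_ne _ hkg] at hk
        exact absurd rfl hk

end SignVectors

/-! ### Partial cubes as sets of sign-vectors: distances, minors, and the excluded cubes. -/

section PartialCubes

variable {E : Type*}

/-- `φ` is an isometric embedding of the graph `Γ` into the cube of sign-vectors with support `D`. -/
structure IsSignEmbedding {V : Type} (Γ : SimpleGraph V) (D : Set E) (φ : V → E → SignType) :
    Prop where
  inj : Function.Injective φ
  iso : IsIsometric D (Set.range φ)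
  adj : ∀ x y, Γ.Adj x y ↔ ∃ f ∈ D, φ y = flipAt f (φ x)

theorem ncard_ne_flipAt [Finite E] {D : Set E} {T S : E → SignType}
    (hS : ∀ e, S e ≠ 0 ↔ e ∈ D) {f : E} (hf : f ∈ D) (h : T f = S f) :
    {e | T e ≠ flipAt f S e}.ncard = {e | T e ≠ S e}.ncard + 1 := by
  rw [← Set.ncard_insert_of_notMem (show f ∉ {e | T e ≠ S e} from fun hh => hh h)]
  congr 1
  ext e
  by_cases he : e = f
  · subst he
    simp only [Set.mem_ofPred_eq, Set.mem_insert_iff, true_or, iff_true, flipAt_self, h]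
    exact sign_ne_neg_self ((hS e).2 hf)
  · simp [flipAt_of_ne _ he, he]

namespace IsSignEmbedding

variable {V : Type} {Γ : SimpleGraph V} {D : Set E} {φ : V → E → SignType}

theorem full (h : IsSignEmbedding Γ D φ) (x : V) (e : E) : φ x e ≠ 0 ↔ e ∈ D :=
  h.iso.supp _ ⟨x, rfl⟩ e

theorem ncard_le_length [Finite E] (h : IsSignEmbedding Γ D φ) {x y : V} (p : Γ.Walk x y) :
    {e | φ x e ≠ φ y e}.ncard ≤ p.length := by
  induction p with
  | nil => simp
  | @cons x z y hadj p ih =>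
    obtain ⟨f, hf, hz⟩ := (h.adj x z).1 hadj
    rw [SimpleGraph.Walk.length_cons]
    refine le_trans (Set.ncard_le_ncard (t := insert f {e | φ z e ≠ φ y e}) (fun e he => ?_)
      (Set.toFinite _)) ((Set.ncard_insert_le _ _).trans (by omega))
    by_cases hef : e = f
    · exact Or.inl hef
    · right
      change φ z e ≠ φ y e
      rwa [hz, flipAt_of_ne _ hef]

theorem exists_walk [Finite E] (h : IsSignEmbedding Γ D φ) (x y : V) :
    ∃ p : Γ.Walk x y, p.length = {e | φ x e ≠ φ y e}.ncard := by
  induction hn : {e | φ x e ≠ φ y e}.ncard using Nat.strong_induction_on generalizing x with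
  | _ n ih =>
  by_cases hxy : φ x = φ y
  · obtain rfl := h.inj hxy
    exact ⟨SimpleGraph.Walk.nil, by simp [← hn]⟩
  · obtain ⟨f, hf, z, hz⟩ := h.iso.flip _ ⟨x, rfl⟩ _ ⟨y, rfl⟩ hxy
    have hfD : f ∈ D := by
      by_contra hfD
      exact hf (by rw [full_eq_zero (h.full x) hfD, full_eq_zero (h.full y) hfD])
    have hyz : φ y f = φ z f := by
      rw [hz, flipAt_self]; exact eq_of_full (h.full x) (h.full y) hf
    have h1 := ncard_ne_flipAt (h.full z) hfD hyz
    rw [show flipAt f (φ z) = φ x by rw [hz, flipAt_flipAt]] at h1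
    have hcomm : ∀ a b : V, {e | φ a e ≠ φ b e} = {e | φ b e ≠ φ a e} := fun a b => by
      ext e; exact ne_comm
    rw [hcomm y x, hcomm y z, hn] at h1
    obtain ⟨p, hp⟩ := ih _ (by omega) z rfl
    exact ⟨SimpleGraph.Walk.cons ((h.adj x z).2 ⟨f, hfD, hz⟩) p, by
      rw [SimpleGraph.Walk.length_cons, hp]; exact h1.symm⟩

theorem dist_eq [Finite E] (h : IsSignEmbedding Γ D φ) (x y : V) :
    Γ.dist x y = {e | φ x e ≠ φ y e}.ncard := by
  obtain ⟨p, hp⟩ := h.exists_walk x y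
  apply le_antisymm
  · rw [← hp]; exact SimpleGraph.dist_le p
  · obtain ⟨q, hq⟩ := p.reachable.exists_walk_length_eq_dist
    rw [← hq]; exact h.ncard_le_length q

theorem dist_flip [Finite E] (h : IsSignEmbedding Γ D φ) {a b : V} {f : E} (hf : f ∈ D)
    (hab : φ b = flipAt f (φ a)) (x : V) :
    (φ x f = φ a f ∧ Γ.dist x b = Γ.dist x a + 1) ∨
      (φ x f ≠ φ a f ∧ Γ.dist x a = Γ.dist x b + 1) := by
  rw [h.dist_eq, h.dist_eq]
  by_cases hx : φ x f = φ a f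
  · left
    refine ⟨hx, ?_⟩
    rw [hab]
    exact ncard_ne_flipAt (h.full a) hf hx
  · right
    refine ⟨hx, ?_⟩
    have hab' : φ a = flipAt f (φ b) := by rw [hab, flipAt_flipAt]
    rw [hab']
    refine ncard_ne_flipAt (h.full b) hf ?_
    rw [hab, flipAt_self]
    exact eq_of_full (h.full a) (h.full x) (Ne.symm hx)

theorem mem_halfspace [Finite E] (h : IsSignEmbedding Γ D φ) {a b : V} {f : E} (hf : f ∈ D)
    (hab : φ b = flipAt f (φ a)) (x : V) : x ∈ halfspace Γ a b ↔ φ x f = φ a f := by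
  change Γ.dist x a < Γ.dist x b ↔ _
  rcases h.dist_flip hf hab x with ⟨h1, h2⟩ | ⟨h1, h2⟩
  · simp [h1, h2]
  · simp only [h1, iff_false]; omega

/-- The distances of a vertex to `a` and to `b` differ by one, the sign telling its side of `f`. The
two sums therefore differ exactly when x and y lie on different sides, and for an edge this means
that it has direction `f`. -/
theorem thetaGraph_adj [Finite E] (h : IsSignEmbedding Γ D φ) {a b : V} {f : E} (hf : f ∈ D)
    (hab : φ b = flipAt f (φ a)) (x y : V) :
    (thetaGraph Γ a b).Adj x y ↔ φ y = flipAt f (φ x) := by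
  change (Γ.Adj x y ∧ Γ.dist a x + Γ.dist b y ≠ Γ.dist a y + Γ.dist b x) ↔ _
  rw [Γ.dist_comm (u := a) (v := x), Γ.dist_comm (u := b) (v := y), Γ.dist_comm (u := a) (v := y),
    Γ.dist_comm (u := b) (v := x)]
  have hne : Γ.dist x a + Γ.dist y b ≠ Γ.dist y a + Γ.dist x b ↔ φ x f ≠ φ y f := by
    rcases h.dist_flip hf hab x with ⟨h1, h2⟩ | ⟨h1, h2⟩ <;>
      rcases h.dist_flip hf hab y with ⟨h3, h4⟩ | ⟨h3, h4⟩
    · simp only [h1, h3, ne_eq, not_true_eq_false, iff_false, not_not]; omega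
    · have : φ x f ≠ φ y f := by rw [h1]; exact Ne.symm h3
      simp only [this, ne_eq, not_false_eq_true, iff_true]; omega
    · have : φ x f ≠ φ y f := by rw [h3]; exact h1
      simp only [this, ne_eq, not_false_eq_true, iff_true]; omega
    · have : φ x f = φ y f := by
        rw [eq_of_full (h.full a) (h.full x) (Ne.symm h1),
          eq_of_full (h.full a) (h.full y) (Ne.symm h3)]
      simp only [this, ne_eq, not_true_eq_false, iff_false, not_not]; omega
  rw [hne]
  constructor
  · rintro ⟨hadj, hxy⟩
    obtain ⟨g, -, hy⟩ := (h.adj x y).1 hadj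
    have : f = g := by
      by_contra hfg
      exact hxy (by rw [hy, flipAt_of_ne _ hfg])
    rwa [this]
  · intro hy
    refine ⟨(h.adj x y).2 ⟨f, hf, hy⟩, ?_⟩
    rw [hy, flipAt_self]
    exact sign_ne_neg_self ((h.full x f).2 hf)

theorem range_restrict {s : SignType} (hs : s ≠ 0) (f : E) (S : Set V)
    (hS : ∀ x, x ∈ S ↔ φ x f = s) :
    Set.range (fun x : S => zeroOn {f} (φ x)) = starOf (Set.range φ) (singleAt f s) := by
  have hsupp : {e | singleAt f s e ≠ 0} = {f} := by
    ext e
    by_cases h : e = f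
    · subst h; simp [singleAt_self, hs]
    · simp [singleAt_of_ne _ h, h]
  ext T
  constructor
  · rintro ⟨⟨x, hx⟩, rfl⟩
    rw [← hsupp]
    refine zeroOn_supp_mem_starOf ⟨x, rfl⟩ fun e he => ?_
    by_cases h : e = f
    · subst h; rw [(hS x).1 hx, singleAt_self]
    · exact absurd (singleAt_of_ne _ h) he
  · rintro ⟨⟨x, hx⟩, hT⟩
    refine ⟨⟨x, (hS x).2 ?_⟩, ?_⟩
    · rw [hx, signComp_of_ne (by rwa [singleAt_self]), singleAt_self]
    · funext e
      by_cases h : e = f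
      · subst h
        change zeroOn {e} (φ x) e = _
        rw [zeroOn_of_mem (Set.mem_singleton e), hT e (by rwa [singleAt_self])]
      · change zeroOn {f} (φ x) e = _
        rw [zeroOn_of_notMem (show e ∉ ({f} : Set E) from h), hx,
          signComp_of_eq (singleAt_of_ne _ h)]

theorem restrict (h : IsSignEmbedding Γ D φ) {s : SignType} (hs : s ≠ 0) {f : E} (hf : f ∈ D)
    (S : Set V) (hS : ∀ x, x ∈ S ↔ φ x f = s) (hne : S.Nonempty) :
    IsSignEmbedding (Γ.induce S) (D \ {f}) (fun x : S => zeroOn {f} (φ x)) := by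
  have hnot : ∀ g, g ≠ f → g ∉ ({f} : Set E) := fun g hg => hg
  have heq : ∀ x ∈ S, ∀ T : E → SignType, T f = s → zeroOn {f} (φ x) = zeroOn {f} T → φ x = T := by
    intro x hx T hT hxT
    funext e
    by_cases he : e = f
    · rw [he, (hS x).1 hx, hT]
    · have := congrFun hxT e
      rwa [zeroOn_of_notMem (hnot e he), zeroOn_of_notMem (hnot e he)] at this
  refine ⟨?_, ?_, ?_⟩
  · rintro ⟨x, hx⟩ ⟨y, hy⟩ hxy
    exact Subtype.ext (h.inj (heq x hx _ ((hS y).1 hy) hxy))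
  · rw [range_restrict hs f S hS]
    have hsupp : {e | singleAt f s e ≠ 0} = {f} := by
      ext e
      by_cases h : e = f
      · subst h; simp [singleAt_self, hs]
      · simp [singleAt_of_ne _ h, h]
    rw [← hsupp]
    obtain ⟨x, hx⟩ := hne
    refine h.iso.star ⟨φ x, ⟨x, rfl⟩, fun e he => ?_⟩
    by_cases h : e = f
    · subst h; rw [(hS x).1 hx, singleAt_self]
    · exact absurd (singleAt_of_ne _ h) he
  · rintro ⟨x, hx⟩ ⟨y, hy⟩
    rw [SimpleGraph.comap_adj]
    change Γ.Adj x y ↔ _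
    rw [h.adj]
    constructor
    · rintro ⟨g, hg, hgy⟩
      have hgf : g ≠ f := by
        rintro rfl
        have := congrFun hgy g
        rw [(hS y).1 hy, flipAt_self, (hS x).1 hx] at this
        exact sign_ne_neg_self hs this
      refine ⟨g, ⟨hg, hgf⟩, ?_⟩
      change zeroOn {f} (φ y) = flipAt g (zeroOn {f} (φ x))
      rw [hgy, zeroOn_flipAt_of_notMem (hnot g hgf)]
    · rintro ⟨g, ⟨hg, hgf⟩, hgy⟩
      refine ⟨g, hg, heq y hy _ ?_ ?_⟩
      · rw [flipAt_of_ne _ (Ne.symm hgf), (hS x).1 hx]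
      · rw [zeroOn_flipAt_of_notMem (hnot g hgf)]
        exact hgy

/-- A constant coordinate belongs to no edge, so it gives neither a halfspace nor a Θ-class. It can
be dropped without changing the graph, which keeps inductions on the number of coordinates going. -/
theorem of_const (h : IsSignEmbedding Γ D φ) {s : SignType} (hs : s ≠ 0) {f : E} (hf : f ∈ D)
    (hconst : ∀ x, φ x f = s) :
    IsSignEmbedding Γ (D \ {f}) (fun x => zeroOn {f} (φ x)) := by
  obtain ⟨_, x₀, -⟩ := h.iso.nonempty
  have h1 := h.restrict hs hf Set.univ (fun x => by simp [hconst]) ⟨x₀, trivial⟩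
  refine ⟨fun x y hxy => ?_, ?_, fun x y => ?_⟩
  · exact congrArg Subtype.val (@h1.inj ⟨x, trivial⟩ ⟨y, trivial⟩ hxy)
  · convert h1.iso using 1
    ext T
    constructor
    · rintro ⟨x, rfl⟩; exact ⟨⟨x, trivial⟩, rfl⟩
    · rintro ⟨⟨x, -⟩, rfl⟩; exact ⟨x, rfl⟩
  · exact h1.adj ⟨x, trivial⟩ ⟨y, trivial⟩

theorem connectedComponent_eq [Finite E] (h : IsSignEmbedding Γ D φ) {a b : V} {f : E} (hf : f ∈ D)
    (hab : φ b = flipAt f (φ a)) (x y : V) :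
    (thetaGraph Γ a b).connectedComponentMk x = (thetaGraph Γ a b).connectedComponentMk y ↔
      zeroOn {f} (φ x) = zeroOn {f} (φ y) := by
  rw [SimpleGraph.ConnectedComponent.eq]
  constructor
  · rintro ⟨p⟩
    induction p with
    | nil => rfl
    | cons hadj p ih =>
      rw [← ih, (h.thetaGraph_adj hf hab _ _).1 hadj,
        zeroOn_flipAt_of_mem (Set.mem_singleton f)]
  · intro hxy
    rcases eq_or_eq_flipAt (h.full y) (h.full x) (f := f) (fun g hg => by
      have := congrFun hxy g
      rw [zeroOn_of_notMem (show g ∉ ({f} : Set E) from hg),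
        zeroOn_of_notMem (show g ∉ ({f} : Set E) from hg)] at this
      exact this.symm) with h1 | h1
    · rw [h.inj h1]
    · exact ((h.thetaGraph_adj hf hab x y).2 h1).reachable

theorem contract [Finite E] (h : IsSignEmbedding Γ D φ) {a b : V} {f : E} (hf : f ∈ D)
    (hab : φ b = flipAt f (φ a)) :
    ∃ ψ : (thetaGraph Γ a b).ConnectedComponent → E → SignType,
      IsSignEmbedding (contractClass Γ a b) (D \ {f}) ψ ∧
        Set.range ψ = zeroOn {f} '' Set.range φ := by
  set mk := (thetaGraph Γ a b).connectedComponentMk with hmk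
  have hmk_eq := h.connectedComponent_eq hf hab
  have hnot : ∀ g, g ≠ f → g ∉ ({f} : Set E) := fun g hg => hg
  have hψ : ∀ x, zeroOn {f} (φ (Quot.out (mk x))) = zeroOn {f} (φ x) := fun x =>
    (hmk_eq _ _).1 (Quot.out_eq (mk x))
  have hsurj : ∀ c : (thetaGraph Γ a b).ConnectedComponent, mk (Quot.out c) = c :=
    fun c => Quot.out_eq c
  have hrange : Set.range (fun c : (thetaGraph Γ a b).ConnectedComponent =>
      zeroOn {f} (φ (Quot.out c))) = zeroOn {f} '' Set.range φ := by
    ext T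
    constructor
    · rintro ⟨c, rfl⟩; exact ⟨_, ⟨_, rfl⟩, rfl⟩
    · rintro ⟨_, ⟨x, rfl⟩, rfl⟩; exact ⟨mk x, hψ x⟩
  refine ⟨fun c => zeroOn {f} (φ (Quot.out c)), ⟨fun c d hcd => ?_, ?_, fun c d => ?_⟩, hrange⟩
  · rw [← hsurj c, ← hsurj d]
    exact (hmk_eq _ _).2 hcd
  · rw [hrange]; exact h.iso.delete f
  · obtain ⟨x, rfl⟩ : ∃ x, mk x = c := ⟨_, hsurj c⟩
    obtain ⟨y, rfl⟩ : ∃ y, mk y = d := ⟨_, hsurj d⟩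
    simp only [hψ]
    constructor
    · rintro ⟨hne, x', y', hx', hy', hadj⟩
      obtain ⟨g, hg, hgy⟩ := (h.adj x' y').1 hadj
      rw [← (hmk_eq _ _).1 hx', ← (hmk_eq _ _).1 hy', hgy]
      have hgf : g ≠ f := by
        rintro rfl
        apply hne
        rw [← hx', ← hy', hmk_eq, hgy, zeroOn_flipAt_of_mem (Set.mem_singleton g)]
      exact ⟨g, ⟨hg, hgf⟩, zeroOn_flipAt_of_notMem (hnot g hgf) _⟩
    · rintro ⟨g, ⟨hg, hgf⟩, hgy⟩
      rw [← zeroOn_flipAt_of_notMem (hnot g hgf)] at hgy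
      have hgx := (full_zeroOn (h.full x) {f} g).2 ⟨hg, hgf⟩
      refine ⟨fun hcd => ?_, ?_⟩
      · have h1 := congrFun (((hmk_eq x y).1 hcd).trans hgy) g
        rw [zeroOn_flipAt_of_notMem (hnot g hgf), flipAt_self] at h1
        exact sign_ne_neg_self hgx h1
      · rcases eq_or_eq_flipAt (h.full y) (full_flipAt (h.full x) g) (f := f) (fun k hk => by
          have := congrFun hgy k
          rwa [zeroOn_of_notMem (hnot k hk), zeroOn_of_notMem (hnot k hk)] at this) with h1 | h1
        · exact ⟨x, y, rfl, rfl, (h.adj x y).2 ⟨g, hg, h1⟩⟩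
        · have hne : φ x ≠ φ y := fun hh => by
            have := congrFun (hh.trans h1) f
            rw [flipAt_self, flipAt_of_ne _ (Ne.symm hgf)] at this
            exact sign_ne_neg_self ((h.full x f).2 hf) this
          -- Here x and y differ in both f and g. Isometry provides a vertex between them, which is
          -- in the component of x or of y.
          obtain ⟨k, hk, z, hz⟩ := h.iso.flip _ ⟨x, rfl⟩ _ ⟨y, rfl⟩ hne
          have hkfg : k = f ∨ k = g := by
            by_contra hcon
            push Not at hcon
            rw [h1, flipAt_of_ne _ hcon.1, flipAt_of_ne _ hcon.2] at hk
            exact hk rfl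
          rcases hkfg with rfl | rfl
          · refine ⟨z, y, ?_, rfl, (h.adj z y).2 ⟨g, hg, ?_⟩⟩
            · rw [hmk_eq, hz, zeroOn_flipAt_of_mem (Set.mem_singleton k)]
            · rw [hz, h1, flipAt_comm]
          · refine ⟨x, z, rfl, ?_, (h.adj x z).2 ⟨k, hg, hz⟩⟩
            rw [hmk_eq, hz, h1, zeroOn_flipAt_of_mem (Set.mem_singleton f)]

end IsSignEmbedding

open Classical in
/-- The sign-vector with support `D` that agrees with `B` where `y` is true, and is opposite to it
where `y` is false. -/
noncomputable def ofCube {D : Set E} {n : ℕ} (ι : D ≃ Fin n) (B : E → SignType)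
    (y : Fin n → Bool) : E → SignType :=
  fun e => if h : e ∈ D then (if y (ι ⟨e, h⟩) then B e else -B e) else 0

open Classical in
/-- The vertex of the cube that describes where `T` agrees with `B`. -/
noncomputable def toCube {D : Set E} {n : ℕ} (ι : D ≃ Fin n) (B T : E → SignType) : Fin n → Bool :=
  fun i => decide (T (ι.symm i) = B (ι.symm i))

section Cube

variable {D : Set E} {n : ℕ} (ι : D ≃ Fin n) {B : E → SignType}

theorem full_ofCube (hB : ∀ e, B e ≠ 0 ↔ e ∈ D) (y : Fin n → Bool) (e : E) :
    ofCube ι B y e ≠ 0 ↔ e ∈ D := by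
  unfold ofCube
  split_ifs with h h'
  · exact hB e
  · exact full_neg hB e
  · simp [h]

theorem toCube_ofCube (hB : ∀ e, B e ≠ 0 ↔ e ∈ D) (y : Fin n → Bool) :
    toCube ι B (ofCube ι B y) = y := by
  funext i
  have h := sign_ne_neg_self ((hB _).2 (ι.symm i).2)
  unfold toCube ofCube
  cases hy : y i <;> simp [hy, Ne.symm h]

theorem ofCube_toCube (hB : ∀ e, B e ≠ 0 ↔ e ∈ D) {T : E → SignType} (hT : ∀ e, T e ≠ 0 ↔ e ∈ D) :
    ofCube ι B (toCube ι B T) = T := by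
  funext e
  unfold toCube ofCube
  split_ifs with h h'
  · simpa using Eq.symm (by simpa using h')
  · simp only [Equiv.symm_apply_apply, decide_eq_true_eq] at h'
    exact (eq_of_full hB hT (Ne.symm h')).symm
  · exact (full_eq_zero hT h).symm

theorem ofCube_true (hB : ∀ e, B e ≠ 0 ↔ e ∈ D) : ofCube ι B (fun _ => true) = B := by
  funext e
  by_cases h : e ∈ D
  · simp [ofCube, h]
  · simp [ofCube, h, full_eq_zero hB h]

theorem ofCube_false (hB : ∀ e, B e ≠ 0 ↔ e ∈ D) : ofCube ι B (fun _ => false) = -B := by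
  funext e
  by_cases h : e ∈ D
  · simp [ofCube, h]
  · simp [ofCube, h, full_eq_zero hB h]

theorem ofCube_cubeNeighbor (hB : ∀ e, B e ≠ 0 ↔ e ∈ D) {g : E} (hg : g ∈ D) :
    ofCube ι B (cubeNeighbor n (ι ⟨g, hg⟩)) = flipAt g (-B) := by
  funext e
  unfold ofCube cubeNeighbor
  by_cases h : e ∈ D
  · by_cases hge : e = g
    · subst hge
      simp [h, flipAt_self]
    · rw [flipAt_of_ne _ hge]
      simp [h, hge]
  · simp only [h, dite_false]
    exact (full_eq_zero (full_flipAt (full_neg hB) g) h).symm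

theorem hammingDist_toCube (hB : ∀ e, B e ≠ 0 ↔ e ∈ D)
    {T T' : E → SignType} (hT : ∀ e, T e ≠ 0 ↔ e ∈ D)
    (hT' : ∀ e, T' e ≠ 0 ↔ e ∈ D) :
    hammingDist (toCube ι B T) (toCube ι B T') = {e | T e ≠ T' e}.ncard := by
  classical
  have h1 : {e | T e ≠ T' e} = (fun i => (ι.symm i : E)) '' {i | toCube ι B T i ≠ toCube ι B T' i} := by
    ext e
    constructor
    · intro he
      have heD : e ∈ D := by
        by_contra h
        exact he (by rw [full_eq_zero hT h, full_eq_zero hT' h])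
      refine ⟨ι ⟨e, heD⟩, ?_, by simp⟩
      have he' : T e ≠ T' e := he
      change toCube ι B T _ ≠ toCube ι B T' _
      unfold toCube
      simp only [Equiv.symm_apply_apply, ne_eq, decide_eq_decide]
      intro hiff
      by_cases h : T e = B e
      · exact he' (h.trans (hiff.1 h).symm)
      · exact he' (by rw [eq_of_full hB hT (Ne.symm h),
          eq_of_full hB hT' (Ne.symm (fun hh => h (hiff.2 hh)))])
    · rintro ⟨i, hi, rfl⟩ he
      apply hi
      unfold toCube
      rw [he]
  have hinj : Function.Injective fun i => (ι.symm i : E) :=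
    Subtype.val_injective.comp ι.symm.injective
  rw [h1, Set.ncard_image_of_injective _ hinj,
    Set.ncard_eq_toFinset_card']
  unfold hammingDist
  congr 1
  ext i
  simp

end Cube

namespace IsSignEmbedding

variable {V : Type} {Γ : SimpleGraph V} {D : Set E} {φ : V → E → SignType}

theorem isPartialCube [Finite E] (h : IsSignEmbedding Γ D φ) : IsPartialCube Γ := by
  obtain ⟨_, x₀, -⟩ := h.iso.nonempty
  refine ⟨SimpleGraph.connected_iff _ |>.2 ⟨fun x y => ?_, ⟨x₀⟩⟩, D.ncard,
    fun x => toCube (Finite.equivFinOfCardEq rfl) (φ x₀) (φ x), fun x y => ?_⟩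
  · obtain ⟨p, -⟩ := h.exists_walk x y
    exact p.reachable
  · rw [h.dist_eq]
    exact (hammingDist_toCube (D := D) _ (h.full x₀) (h.full x) (h.full y)).symm

theorem nonempty_iso [Finite E] (h : IsSignEmbedding Γ D φ) {n : ℕ} (ι : D ≃ Fin n)
    {B : E → SignType} (hB : ∀ e, B e ≠ 0 ↔ e ∈ D) {S : Set (Fin n → Bool)}
    (hS : ∀ y, y ∈ S ↔ ofCube ι B y ∈ Set.range φ) :
    Nonempty (Γ ≃g (hypercube n).induce S) := by
  have hmem : ∀ x, toCube ι B (φ x) ∈ S := fun x => by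
    rw [hS, ofCube_toCube ι hB (h.full x)]; exact ⟨x, rfl⟩
  refine ⟨⟨Equiv.ofBijective (fun x => ⟨toCube ι B (φ x), hmem x⟩) ⟨fun x y hxy => ?_, ?_⟩, ?_⟩⟩
  · apply h.inj
    rw [← ofCube_toCube ι hB (h.full x), ← ofCube_toCube ι hB (h.full y)]
    exact congrArg (ofCube ι B) (congrArg Subtype.val hxy)
  · rintro ⟨y, hy⟩
    obtain ⟨x, hx⟩ := (hS y).1 hy
    exact ⟨x, Subtype.ext (by
      change toCube ι B (φ x) = y
      rw [hx, toCube_ofCube ι hB])⟩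
  · intro x y
    rw [SimpleGraph.comap_adj]
    change hammingDist (toCube ι B (φ x)) (toCube ι B (φ y)) = 1 ↔ _
    rw [hammingDist_toCube ι hB (h.full x) (h.full y), ← h.dist_eq,
      SimpleGraph.dist_eq_one_iff_adj]

/-- A graph without the excluded minors has gated antipodal faces. -/
theorem antipodalGated [Finite E] (h : IsSignEmbedding Γ D φ)
    (hminor : ∀ n : ℕ, 4 ≤ n →
      (∀ i : Fin n, ¬ HasPCMinor ((hypercube n).induce (starVerts n i)) V Γ) ∧
      (∀ S : Finset (Fin n), S.Nonempty →
        ¬ HasPCMinor ((hypercube n).induce (minusMinusVerts n S)) V Γ)) :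
    AntipodalGated (Set.range φ) := by
  induction hn : D.ncard using Nat.strong_induction_on generalizing V D with
  | _ n ih =>
  by_contra hA
  have hstar : ∀ f ∈ D, ∀ s ≠ 0, (∃ T ∈ Set.range φ, T f = s) →
      AntipodalGated (starOf (Set.range φ) (singleAt f s)) := by
    intro f hf s hs hex
    have hlt : (D \ {f}).ncard < n := hn ▸ Set.ncard_sdiff_singleton_lt_of_mem hf
    obtain ⟨_, ⟨x₀, rfl⟩, hx₀⟩ := hex
    by_cases hconst : ∀ x, φ x f = s
    · have := ih _ hlt (h.of_const hs hf hconst) hminor rfl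
      rw [← range_restrict hs f Set.univ (fun x => by simp [hconst])]
      convert this using 1
      ext T
      constructor
      · rintro ⟨⟨x, -⟩, rfl⟩; exact ⟨x, rfl⟩
      · rintro ⟨x, rfl⟩; exact ⟨⟨x, trivial⟩, rfl⟩
    · push Not at hconst
      obtain ⟨x₁, hx₁⟩ := hconst
      obtain ⟨a, b, hab, hfa⟩ : ∃ a b, φ b = flipAt f (φ a) ∧ φ a f = s := by
        obtain ⟨_, ⟨a, rfl⟩, ⟨b, hb⟩, -⟩ := h.iso.exists_flip_between (e := f) ⟨x₀, rfl⟩ ⟨x₁, rfl⟩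
          (by rw [hx₀]; exact Ne.symm hx₁)
        by_cases ha : φ a f = s
        · exact ⟨a, b, hb, ha⟩
        · refine ⟨b, a, by rw [hb, flipAt_flipAt], ?_⟩
          rw [hb, flipAt_self, ← hx₀]
          exact (eq_of_full (h.full a) (h.full x₀) (by rw [hx₀]; exact ha)).symm
      have hS : ∀ x, x ∈ halfspace Γ a b ↔ φ x f = s := fun x => by
        rw [h.mem_halfspace hf hab, hfa]
      have hadj := (h.adj a b).2 ⟨f, hf, hab⟩
      rw [← range_restrict hs f _ hS]
      refine ih _ hlt (h.restrict hs hf _ hS ⟨a, (hS a).2 hfa⟩) (fun m hm => ?_) rfl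
      exact ⟨fun i hi => (hminor m hm).1 i (HasPCMinor.restrict hadj hi),
        fun S hS' hi => (hminor m hm).2 S hS' (HasPCMinor.restrict hadj hi)⟩
  have hdel : ∀ f ∈ D, AntipodalGated (zeroOn {f} '' Set.range φ) := by
    intro f hf
    have hlt : (D \ {f}).ncard < n := hn ▸ Set.ncard_sdiff_singleton_lt_of_mem hf
    by_cases hex : ∃ a b, φ b = flipAt f (φ a)
    · obtain ⟨a, b, hab⟩ := hex
      obtain ⟨ψ, hψ, hrange⟩ := h.contract hf hab
      have hadj := (h.adj a b).2 ⟨f, hf, hab⟩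
      rw [← hrange]
      refine ih _ hlt hψ (fun m hm => ?_) rfl
      exact ⟨fun i hi => (hminor m hm).1 i (HasPCMinor.contract hadj hi),
        fun S hS' hi => (hminor m hm).2 S hS' (HasPCMinor.contract hadj hi)⟩
    · obtain ⟨_, x₀, rfl⟩ := h.iso.nonempty
      have hconst : ∀ x, φ x f = φ x₀ f := by
        intro x
        by_contra hx
        obtain ⟨_, ⟨a, rfl⟩, ⟨b, hb⟩, -⟩ := h.iso.exists_flip_between (e := f) ⟨x, rfl⟩ ⟨x₀, rfl⟩ hx
        exact hex ⟨a, b, hb⟩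
      have := ih _ hlt (h.of_const ((h.full x₀ f).2 hf) hf hconst) hminor rfl
      convert this using 1
      ext T
      constructor
      · rintro ⟨_, ⟨x, rfl⟩, rfl⟩; exact ⟨x, rfl⟩
      · rintro ⟨x, rfl⟩; exact ⟨_, ⟨x, rfl⟩, rfl⟩
  -- Halfspaces and contractions are gated by induction, so a failure here is minor-minimal.
  obtain ⟨e, B, hdef⟩ := exists_isCubeDefect h.iso hstar hdel hA
  have hD4 := hdef.four_le
  obtain ⟨ι⟩ : Nonempty (D ≃ Fin D.ncard) := ⟨Finite.equivFinOfCardEq rfl⟩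
  have hB := hdef.full
  have hinj : Function.Injective (ofCube ι B) := fun y z hyz => by
    rw [← toCube_ofCube ι hB y, hyz, toCube_ofCube ι hB]
  have htrue := ofCube_true ι hB
  have hfalse := ofCube_false ι hB
  have hnb := fun (g : E) (hg : g ∈ D) => ofCube_cubeNeighbor ι hB hg
  have hother : ∀ y, ofCube ι B y ∉ Set.range φ → y = (fun _ => true) ∨
      y = (fun _ => false) ∨ ∃ i, y = cubeNeighbor _ i := by
    intro y hy
    have hfull := full_ofCube ι hB y
    by_cases hye : ofCube ι B y e = B e
    · by_contra hcon
      push Not at hcon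
      refine hy (hdef.side _ hfull hye (fun h => hcon.1 (hinj (h.trans htrue.symm))) fun h =>
        hcon.2.2 _ (hinj (h.trans (hnb e hdef.mem).symm)))
    · rcases hdef.otherSide _ hfull (eq_of_full hB hfull (Ne.symm hye)) hy with h | ⟨g, hg, -, h⟩
      · exact Or.inr (Or.inl (hinj (h.trans hfalse.symm)))
      · exact Or.inr (Or.inr ⟨_, hinj (h.trans (hnb g hg).symm)⟩)
  have hneig : ∀ i, ∃ (g : E) (hg : g ∈ D), i = ι ⟨g, hg⟩ := fun i =>
    ⟨_, (ι.symm i).2, by simp⟩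
  -- Cube coordinates put B at the all-true vertex and -B at the all-false vertex v. If -B is
  -- present, only B and one neighbour of v are missing, which is Q_n^{-*}. Otherwise B, v and some
  -- neighbours of v are missing, among them the neighbour in direction e, which is Q_n^{--}(m) with
  -- m ≥ 1.
  by_cases hneg : -B ∈ Set.range φ
  · refine (hminor _ hD4).1 (ι ⟨e, hdef.mem⟩) (HasPCMinor.iso (h.nonempty_iso ι hB fun y => ?_))
    constructor
    · rintro ⟨hy1, hy2⟩
      by_contra hy
      rcases hother y hy with rfl | rfl | ⟨i, rfl⟩
      · exact hy1 rfl
      · exact hy (hfalse ▸ hneg)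
      · obtain ⟨g, hg, rfl⟩ := hneig i
        by_cases hge : g = e
        · subst hge; exact hy2 rfl
        · exact hy ((hnb g hg).symm ▸ hdef.neg_mem hneg g hg hge)
    · intro hy
      refine ⟨?_, ?_⟩
      · rintro rfl; exact hdef.notMem (htrue ▸ hy)
      · rintro rfl; exact hdef.notMem_flip (hnb e hdef.mem ▸ hy)
  · classical
    refine (hminor _ hD4).2 (Finset.univ.filter fun i =>
      ofCube ι B (cubeNeighbor _ i) ∉ Set.range φ) ⟨ι ⟨e, hdef.mem⟩, ?_⟩
      (HasPCMinor.iso (h.nonempty_iso ι hB fun y => ?_))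
    · rw [Finset.mem_filter, hnb e hdef.mem]
      exact ⟨Finset.mem_univ _, hdef.notMem_flip⟩
    · constructor
      · rintro ⟨hy1, hy2, hy3⟩
        by_contra hy
        rcases hother y hy with rfl | rfl | ⟨i, rfl⟩
        · exact hy2 rfl
        · exact hy1 rfl
        · exact hy3 i (Finset.mem_filter.2 ⟨Finset.mem_univ _, hy⟩) rfl
      · intro hy
        refine ⟨?_, ?_, ?_⟩
        · rintro rfl; exact hneg (hfalse ▸ hy)
        · rintro rfl; exact hdef.notMem (htrue ▸ hy)
        · rintro i hi rfl; exact (Finset.mem_filter.1 hi).2 hy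

end IsSignEmbedding

/-- The vertices of a subset of the cube, as sign-vectors. -/
def cubeSigns {n : ℕ} {S : Set (Fin n → Bool)} (x : S) : Fin n → SignType :=
  fun i => if x.1 i then 1 else -1

theorem cubeSigns_apply_eq_iff {n : ℕ} {S : Set (Fin n → Bool)} (x y : S) (i : Fin n) :
    cubeSigns x i = cubeSigns y i ↔ x.1 i = y.1 i := by
  unfold cubeSigns
  cases x.1 i <;> cases y.1 i <;> simp

open Classical in
/-- Changing one coordinate of a vertex of the cube. -/
noncomputable def cubeFlip {n : ℕ} (i : Fin n) (x : Fin n → Bool) : Fin n → Bool :=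
  fun j => if j = i then !x j else x j

theorem cubeSigns_eq_flipAt_iff {n : ℕ} {S : Set (Fin n → Bool)} (x y : S) (i : Fin n) :
    cubeSigns y = flipAt i (cubeSigns x) ↔ y.1 = cubeFlip i x.1 := by
  rw [funext_iff, funext_iff]
  refine forall_congr' fun j => ?_
  unfold cubeSigns flipAt cubeFlip
  by_cases h : j = i
  · subst h
    simp only [if_true]
    generalize x.1 j = p
    generalize y.1 j = q
    cases p <;> cases q <;> simp
  · simp only [h, if_false]
    generalize x.1 j = p
    generalize y.1 j = q
    cases p <;> cases q <;> simp

theorem hammingDist_eq_one_iff {n : ℕ} (x y : Fin n → Bool) :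
    hammingDist x y = 1 ↔ ∃ i, y = cubeFlip i x := by
  unfold hammingDist
  rw [Finset.card_eq_one]
  refine exists_congr fun i => ?_
  constructor
  · intro h
    funext j
    have := Finset.ext_iff.1 h j
    simp only [Finset.mem_filter, Finset.mem_univ, true_and, Finset.mem_singleton] at this
    unfold cubeFlip
    split_ifs with hj
    · have := this.2 hj
      revert this
      cases x j <;> cases y j <;> simp
    · by_contra hne
      exact hj (this.1 (Ne.symm hne))
  · rintro rfl
    ext j
    simp only [Finset.mem_filter, Finset.mem_univ, true_and, Finset.mem_singleton]
    unfold cubeFlip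
    split_ifs with hj
    · simp [hj]
    · simp [hj]

theorem isSignEmbedding_cubeSigns {n : ℕ} {S : Set (Fin n → Bool)} (hne : S.Nonempty)
    (hS : ∀ x ∈ S, ∀ y ∈ S, x ≠ y → ∃ i, x i ≠ y i ∧ cubeFlip i x ∈ S) :
    IsSignEmbedding ((hypercube n).induce S) Set.univ (cubeSigns (S := S)) := by
  have hinj : Function.Injective (cubeSigns (S := S)) := fun x y hxy => by
    apply Subtype.ext
    funext i
    exact (cubeSigns_apply_eq_iff x y i).1 (congrFun hxy i)
  refine ⟨hinj, ⟨?_, ?_, ?_⟩, fun x y => ?_⟩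
  · rintro _ ⟨x, rfl⟩ e
    unfold cubeSigns
    split_ifs <;> simp
  · obtain ⟨x, hx⟩ := hne
    exact ⟨_, ⟨x, hx⟩, rfl⟩
  · rintro _ ⟨x, rfl⟩ _ ⟨y, rfl⟩ hxy
    obtain ⟨i, hi, hiS⟩ := hS x.1 x.2 y.1 y.2 (fun h => hxy (by rw [Subtype.ext h]))
    exact ⟨i, fun h => hi ((cubeSigns_apply_eq_iff x y i).1 h), ⟨_, hiS⟩,
      (cubeSigns_eq_flipAt_iff x ⟨_, hiS⟩ i).2 rfl⟩
  · rw [SimpleGraph.comap_adj]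
    change hammingDist x.1 y.1 = 1 ↔ _
    rw [hammingDist_eq_one_iff]
    simp only [cubeSigns_eq_flipAt_iff, Set.mem_univ, true_and]

namespace IsSignEmbedding

/-- Each separating entry of one embedding is a separating entry of any other embedding. -/
theorem exists_entry {F : Type*} [Finite E] [Finite F] {V : Type} {Γ : SimpleGraph V} {D : Set E}
    {φ : V → E → SignType} (h : IsSignEmbedding Γ D φ) {D' : Set F} {ψ : V → F → SignType}
    (h' : IsSignEmbedding Γ D' ψ) {g : E} {x y : V} (hxy : φ x g ≠ φ y g) :
    ∃ j ∈ D', ∀ u v, φ u g = φ v g ↔ ψ u j = ψ v j := by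
  obtain ⟨_, ⟨a, rfl⟩, ⟨b, hb⟩, -⟩ := h.iso.exists_flip_between ⟨x, rfl⟩ ⟨y, rfl⟩ hxy
  have hg : g ∈ D := by
    by_contra hg
    exact hxy (by rw [full_eq_zero (h.full x) hg, full_eq_zero (h.full y) hg])
  obtain ⟨j, hj, hjb⟩ := (h'.adj a b).1 ((h.adj a b).2 ⟨g, hg, hb⟩)
  -- Both conditions describe the halfspace of the edge ab, which depends on the graph alone.
  have key : ∀ u, φ u g = φ a g ↔ ψ u j = ψ a j := fun u => by
    rw [← h.mem_halfspace hg hb, ← h'.mem_halfspace hj hjb]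
  refine ⟨j, hj, fun u v => ?_⟩
  have hu := key u
  have hv := key v
  by_cases h1 : φ u g = φ a g
  · rw [h1, hu.1 h1, eq_comm, hv, eq_comm]
  · by_cases h2 : φ v g = φ a g
    · rw [h2, hv.1 h2, hu]
    · have e1 := eq_of_full (h.full a) (h.full u) (Ne.symm h1)
      have e2 := eq_of_full (h.full a) (h.full v) (Ne.symm h2)
      have e3 := eq_of_full (h'.full a) (h'.full u) (Ne.symm fun hh => h1 (hu.2 hh))
      have e4 := eq_of_full (h'.full a) (h'.full v) (Ne.symm fun hh => h2 (hv.2 hh))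
      simp [e1, e2, e3, e4]

variable [Finite E] {D : Set E} {L : Set (E → SignType)}

/-- A subset of the cube that misses, on one side of a coordinate, exactly one antipodal pair, and
contains the neighbour of one of these on the other side, is not the tope graph of a complex of
oriented matroids. -/
theorem not_com_of_side {n : ℕ} {S : Set (Fin n → Bool)} {i : Fin n} (hn : 4 ≤ n)
    (hS : ∀ x ∈ S, ∀ y ∈ S, x ≠ y → ∃ i, x i ≠ y i ∧ cubeFlip i x ∈ S)
    (h1 : (fun _ => true) ∉ S) (h2 : cubeNeighbor n i ∉ S)
    (hside : ∀ y : Fin n → Bool, y i = true → y ≠ (fun _ => true) → y ≠ cubeNeighbor n i → y ∈ S)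
    (hflip : cubeFlip i (fun _ => true) ∈ S) {φ : S → E → SignType}
    (h : IsSignEmbedding ((hypercube n).induce S) D φ) (hL : IsCOM L)
    (hLD : ∀ Z ∈ L, ∀ e, Z e ≠ 0 → e ∈ D) (htope : fullTopes D L = Set.range φ) : False := by
  classical
  have h' := isSignEmbedding_cubeSigns ⟨_, hflip⟩ hS
  have hentry : ∀ g (x y : S), φ x g ≠ φ y g → ∃ j, ∀ u v, φ u g = φ v g ↔ u.1 j = v.1 j := by
    intro g x y hxy
    obtain ⟨j, -, hj⟩ := h.exists_entry h' hxy
    exact ⟨j, fun u v => by rw [hj, cubeSigns_apply_eq_iff]⟩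
  have hentry' : ∀ j (x y : S), x.1 j ≠ y.1 j → ∃ g ∈ D, ∀ u v, φ u g = φ v g ↔ u.1 j = v.1 j := by
    intro j x y hxy
    obtain ⟨g, hg, hgj⟩ := h'.exists_entry h (g := j)
      (fun hh => hxy ((cubeSigns_apply_eq_iff x y j).1 hh))
    exact ⟨g, hg, fun u v => by rw [← hgj, cubeSigns_apply_eq_iff]⟩
  -- The witness has a single false coordinate k different from i and j; it is then neither of the
  -- two missing vertices on this side.
  have hpt : ∀ j, j ≠ i → ∃ x : S, x.1 i = true ∧ x.1 j = true := by
    intro j hj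
    have : ∃ k, k ≠ i ∧ k ≠ j := by
      have hc : ({i, j} : Finset (Fin n)).card < Fintype.card (Fin n) := by
        have := Finset.card_le_two (a := i) (b := j)
        rw [Fintype.card_fin]; omega
      obtain ⟨k, hk⟩ := Finset.exists_mem_notMem_of_card_lt_card (t := Finset.univ) hc
      refine ⟨k, fun hh => hk.2 (by simp [hh]), fun hh => hk.2 (by simp [hh])⟩
    obtain ⟨k, hki, hkj⟩ := this
    refine ⟨⟨fun l => decide (l ≠ k), hside _ (by simp [Ne.symm hki]) (fun hh => ?_) fun hh => ?_⟩,
      by simp [Ne.symm hki], by simp [Ne.symm hkj]⟩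
    · have := congrFun hh k
      simp at this
    · have := congrFun hh j
      simp [cubeNeighbor, Ne.symm hkj, hj] at this
  -- the antipode on the side of `i`
  have hanti : ∀ x : S, x.1 i = true → ∃ x' : S, x'.1 i = true ∧ ∀ j, j ≠ i → x'.1 j = !x.1 j := by
    intro x hx
    refine ⟨⟨fun j => if j = i then true else !x.1 j, hside _ (by simp) (fun hh => ?_) fun hh => ?_⟩,
      by simp, fun j hj => by simp [hj]⟩
    · apply h2
      convert x.2 using 1
      funext j
      by_cases hj : j = i
      · simp [cubeNeighbor, hj, hx]
      · have := congrFun hh j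
        simp only [hj, if_false] at this
        simp [cubeNeighbor, hj] at this ⊢
        exact this
    · apply h1
      convert x.2 using 1
      funext j
      by_cases hj : j = i
      · simp [hj, hx]
      · have := congrFun hh j
        simp only [hj, if_false, cubeNeighbor, decide_false] at this
        simpa using this.symm
  have hw : (⟨_, hflip⟩ : S).1 i = false := by simp [cubeFlip]
  have hwj : ∀ j, j ≠ i → (⟨_, hflip⟩ : S).1 j = true := fun j hj => by simp [cubeFlip, hj]
  obtain ⟨k, hki⟩ : ∃ k, k ≠ i := by
    have : Nontrivial (Fin n) := Fin.nontrivial_iff_two_le.2 (by omega)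
    exact exists_ne i
  obtain ⟨x₀, hx₀, -⟩ := hpt k hki
  obtain ⟨f, hfD, hf⟩ := hentry' i x₀ ⟨_, hflip⟩ (by rw [hx₀, hw]; simp)
  -- `X` keeps the signs common to all vertices with coordinate `i` true, so its face is that side.
  -- The side lacks just one antipodal pair, hence is antipodal, which makes `X` a covector.
  set X : E → SignType := fun g => if ∀ x : S, x.1 i = true → φ x g = φ x₀ g then φ x₀ g else 0
    with hXdef
  have hX1 : ∀ g, (∀ x : S, x.1 i = true → φ x g = φ x₀ g) → X g = φ x₀ g := fun g hg => if_pos hg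
  have hX2 : ∀ g, ¬ (∀ x : S, x.1 i = true → φ x g = φ x₀ g) → X g = 0 := fun g hg => if_neg hg
  have hXf : X f = φ x₀ f := hX1 f fun x hx => (hf x x₀).2 (hx.trans hx₀.symm)
  have hconf : ∀ x : S, Conf X (φ x) ↔ x.1 i = true := by
    intro x
    constructor
    · intro hc
      have := hc f (by rw [hXf]; exact (h.full x₀ f).2 hfD)
      rw [hXf, hf, hx₀] at this
      exact this
    · intro hx g hg
      by_cases hcon : ∀ x : S, x.1 i = true → φ x g = φ x₀ g
      · rw [hX1 g hcon, hcon x hx]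
      · exact absurd (hX2 g hcon) hg
  have hnon : ∀ g, X g = 0 → g ∈ D → ∃ j, j ≠ i ∧ ∀ u v, φ u g = φ v g ↔ u.1 j = v.1 j := by
    intro g hg hgD
    have : ¬ ∀ x : S, x.1 i = true → φ x g = φ x₀ g := fun hcon =>
      (h.full x₀ g).2 hgD ((hX1 g hcon).symm.trans hg)
    push Not at this
    obtain ⟨x, hx, hxg⟩ := this
    obtain ⟨j, hj⟩ := hentry g x x₀ hxg
    refine ⟨j, ?_, hj⟩
    rintro rfl
    exact hxg ((hj x x₀).2 (hx.trans hx₀.symm))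
  have hXD : ∀ g, X g ≠ 0 → g ∈ D := by
    intro g hg
    by_cases hcon : ∀ x : S, x.1 i = true → φ x g = φ x₀ g
    · rw [hX1 g hcon] at hg
      exact (h.full x₀ g).1 hg
    · exact absurd (hX2 g hcon) hg
  have hXL : X ∈ L := by
    refine hL.mem_of_isAntipodalFace D hLD ?_
    rw [htope]
    refine ⟨⟨_, ⟨x₀, rfl⟩, (hconf x₀).2 hx₀⟩, ?_⟩
    rintro _ ⟨x, rfl⟩ hc
    have hx := (hconf x).1 hc
    obtain ⟨x', hx', hxx'⟩ := hanti x hx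
    refine ⟨x', ?_⟩
    funext g
    by_cases hg : X g = 0
    · rw [signComp_of_eq hg, Pi.neg_apply]
      by_cases hgD : g ∈ D
      · obtain ⟨j, hji, hj⟩ := hnon g hg hgD
        refine eq_of_full (h.full x) (h.full x') fun hh => ?_
        have := (hj x x').1 hh
        rw [hxx' j hji] at this
        revert this
        cases x.1 j <;> simp
      · rw [full_eq_zero (h.full x) hgD, full_eq_zero (h.full x') hgD, neg_zero]
    · rw [signComp_of_ne hg]
      exact ((hconf x').2 hx') g hg
  -- Composing the covector `X` with the neighbour of the all-true vertex across `i` must give a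
  -- vertex of the side with all other coordinates true, and this vertex is missing.
  have hmem : signComp X (φ ⟨_, hflip⟩) ∈ Set.range φ := by
    rw [← htope]
    have hwL : φ ⟨_, hflip⟩ ∈ fullTopes D L := by rw [htope]; exact ⟨_, rfl⟩
    exact ⟨hL.comp hXL hwL.1, full_signComp hXD hwL.2⟩
  obtain ⟨u, hu⟩ := hmem
  have hui : u.1 i = true := (hconf u).1 (by rw [hu]; exact Conf.signComp _ _)
  apply h1
  convert u.2 using 1
  funext j
  by_cases hj : j = i
  · rw [hj, hui]
  · obtain ⟨x, hx, hxj⟩ := hpt j hj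
    obtain ⟨x', hx', hxx'⟩ := hanti x hx
    have hne : x.1 j ≠ x'.1 j := by rw [hxx' j hj, hxj]; simp
    obtain ⟨g, hgD, hg⟩ := hentry' j x x' hne
    have hXg : X g = 0 := hX2 g fun hcon =>
      hne ((hg x x').1 ((hcon x hx).trans (hcon x' hx').symm))
    have := congrFun hu g
    rw [signComp_of_eq hXg, hg, hwj j hj] at this
    exact this.symm

/-- Tope graphs of complexes of oriented matroids are closed under minors: a halfspace corresponds
to the covectors with a fixed sign at f, and a contracted Θ-class to the deletion of f. A minor
isomorphic to H would thus make H such a tope graph. -/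
theorem not_hasPCMinor {W : Type} {H : SimpleGraph W}
    (hH : ∀ (D : Set E) (L : Set (E → SignType)) (φ : W → E → SignType), IsSignEmbedding H D φ →
      IsCOM L → (∀ Z ∈ L, ∀ e, Z e ≠ 0 → e ∈ D) → fullTopes D L = Set.range φ → False)
    {V : Type} {Γ : SimpleGraph V} (hminor : HasPCMinor H V Γ) {φ : V → E → SignType}
    (h : IsSignEmbedding Γ D φ) (hL : IsCOM L) (hLD : ∀ Z ∈ L, ∀ e, Z e ≠ 0 → e ∈ D)
    (htope : fullTopes D L = Set.range φ) : False := by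
  induction hminor generalizing D L with
  | iso hiso =>
    obtain ⟨θ⟩ := hiso
    have hrange : Set.range (fun w => φ (θ.symm w)) = Set.range φ :=
      (θ.symm.surjective).range_comp φ
    refine hH D L (fun w => φ (θ.symm w)) ⟨h.inj.comp θ.symm.injective, ?_, fun x y => ?_⟩ hL hLD
      (htope.trans hrange.symm)
    · rw [hrange]; exact h.iso
    · rw [← θ.symm.map_adj_iff]; exact h.adj _ _
  | @restrict V Γ a b hadj _ ih =>
    obtain ⟨f, hf, hab⟩ := (h.adj a b).1 hadj
    have hS : ∀ x, x ∈ halfspace Γ a b ↔ φ x f = φ a f := h.mem_halfspace hf hab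
    have hs := (h.full a f).2 hf
    refine ih (h.restrict hs hf _ hS ⟨a, (hS a).2 rfl⟩)
      ((hL.halfspace f hs).zeroOn_image {f}) ?_ ?_
    · rintro _ ⟨Z, ⟨hZ, -⟩, rfl⟩ e he
      by_cases hef : e = f
      · exact absurd (zeroOn_of_mem (S := {f}) hef) he
      · rw [zeroOn_of_notMem (show e ∉ ({f} : Set E) from hef)] at he
        exact ⟨hLD Z hZ e he, hef⟩
    · ext T
      constructor
      · rintro ⟨⟨Z, ⟨hZ, hZf⟩, rfl⟩, hfull⟩
        have : Z ∈ fullTopes D L := by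
          refine ⟨hZ, fun e => ⟨hLD Z hZ e, fun he => ?_⟩⟩
          by_cases hef : e = f
          · rw [hef, hZf]; exact hs
          · have := (hfull e).2 ⟨he, hef⟩
            rwa [zeroOn_of_notMem (show e ∉ ({f} : Set E) from hef)] at this
        rw [htope] at this
        obtain ⟨x, rfl⟩ := this
        exact ⟨⟨x, (hS x).2 hZf⟩, rfl⟩
      · rintro ⟨⟨x, hx⟩, rfl⟩
        have : φ x ∈ fullTopes D L := by rw [htope]; exact ⟨x, rfl⟩
        exact ⟨⟨_, ⟨this.1, (hS x).1 hx⟩, rfl⟩, full_zeroOn this.2 _⟩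
  | @contract V Γ a b hadj _ ih =>
    obtain ⟨f, hf, hab⟩ := (h.adj a b).1 hadj
    obtain ⟨ψ, hψ, hrange⟩ := h.contract hf hab
    refine ih hψ (hL.zeroOn_image {f}) ?_ ?_
    · rintro _ ⟨Z, hZ, rfl⟩ e he
      by_cases hef : e = f
      · exact absurd (zeroOn_of_mem (S := {f}) hef) he
      · rw [zeroOn_of_notMem (show e ∉ ({f} : Set E) from hef)] at he
        exact ⟨hLD Z hZ e he, hef⟩
    · rw [hrange]
      ext T
      constructor
      · rintro ⟨⟨Z, hZ, rfl⟩, hfull⟩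
        have haL : φ a ∈ fullTopes D L := by rw [htope]; exact ⟨a, rfl⟩
        -- A covector whose only possible zero in `D` is `f` becomes a tope by composition with any
        -- tope, without change off `f`.
        have : signComp Z (φ a) ∈ fullTopes D L :=
          ⟨hL.comp hZ haL.1, full_signComp (hLD Z hZ) haL.2⟩
        rw [htope] at this
        refine ⟨_, this, ?_⟩
        funext e
        by_cases hef : e = f
        · rw [zeroOn_of_mem (S := {f}) hef, zeroOn_of_mem (S := {f}) hef]
        · have h1 := hfull e
          rw [zeroOn_of_notMem (show e ∉ ({f} : Set E) from hef)] at *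
          rw [zeroOn_of_notMem (show e ∉ ({f} : Set E) from hef)]
          by_cases hz : Z e = 0
          · rw [signComp_of_eq hz, hz]
            exact full_eq_zero haL.2 fun he => h1.2 ⟨he, hef⟩ hz
          · exact signComp_of_ne hz
      · rintro ⟨_, ⟨x, rfl⟩, rfl⟩
        have : φ x ∈ fullTopes D L := by rw [htope]; exact ⟨x, rfl⟩
        exact ⟨⟨_, this.1, rfl⟩, full_zeroOn this.2 _⟩

end IsSignEmbedding

end PartialCubes

/-! ### Isometry of the excluded cubes, and membership in F(Q⁻). -/

section PartialCubes

theorem exists_ne_three {n : ℕ} (hn : 4 ≤ n) (i j k : Fin n) : ∃ l, l ≠ i ∧ l ≠ j ∧ l ≠ k := by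
  classical
  have hc : ({i, j, k} : Finset (Fin n)).card < Fintype.card (Fin n) := by
    have := Finset.card_le_three (a := i) (b := j) (c := k)
    rw [Fintype.card_fin]; omega
  obtain ⟨l, hl⟩ := Finset.exists_mem_notMem_of_card_lt_card (t := Finset.univ) hc
  exact ⟨l, fun h => hl.2 (by simp [h]), fun h => hl.2 (by simp [h]), fun h => hl.2 (by simp [h])⟩

theorem cubeFlip_self {n : ℕ} (i : Fin n) (x : Fin n → Bool) : cubeFlip i x i = !x i := by
  simp [cubeFlip]

theorem cubeFlip_of_ne {n : ℕ} {i j : Fin n} (x : Fin n → Bool) (h : j ≠ i) :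
    cubeFlip i x j = x j := by
  simp [cubeFlip, h]

/-- A subset of the cube is isometric if no two missing vertices block all shortest paths. -/
theorem exists_cubeFlip_mem {n : ℕ} {S : Set (Fin n → Bool)}
    (hS : ∀ x ∈ S, ∀ y ∈ S, ∀ j k, j ≠ k → x j ≠ y j → x k ≠ y k → cubeFlip j x ∉ S →
      cubeFlip k x ∉ S → ∃ l, x l ≠ y l ∧ cubeFlip l x ∈ S) :
    ∀ x ∈ S, ∀ y ∈ S, x ≠ y → ∃ i, x i ≠ y i ∧ cubeFlip i x ∈ S := by
  intro x hx y hy hxy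
  obtain ⟨j, hj⟩ := Function.ne_iff.1 hxy
  by_cases hjS : cubeFlip j x ∈ S
  · exact ⟨j, hj, hjS⟩
  have : ∃ k, k ≠ j ∧ x k ≠ y k := by
    by_contra hcon
    push Not at hcon
    apply hjS
    convert hy using 1
    funext k
    by_cases hk : k = j
    · subst hk
      rw [cubeFlip_self]
      revert hj
      cases x k <;> cases y k <;> simp
    · rw [cubeFlip_of_ne _ hk, hcon k hk]
  obtain ⟨k, hkj, hk⟩ := this
  by_cases hkS : cubeFlip k x ∈ S
  · exact ⟨k, hk, hkS⟩
  exact hS x hx y hy j k (Ne.symm hkj) hj hk hjS hkS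

/-- The two missing vertices are at distance n - 1 ≥ 3, so they have no common neighbour. -/
theorem starVerts_isometric {n : ℕ} (hn : 4 ≤ n) (i : Fin n) :
    ∀ x ∈ starVerts n i, ∀ y ∈ starVerts n i, x ≠ y →
      ∃ j, x j ≠ y j ∧ cubeFlip j x ∈ starVerts n i := by
  refine exists_cubeFlip_mem fun x hx y hy j k hjk hj hk hjS hkS => ?_
  obtain ⟨l, hli, hlj, hlk⟩ := exists_ne_three hn i j k
  unfold starVerts at hjS hkS
  simp only [Set.mem_ofPred_eq, not_and_or, ne_eq, not_not] at hjS hkS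
  exfalso
  have e1 := cubeFlip_of_ne x hlj
  have e2 := cubeFlip_of_ne x hlk
  have e3 := cubeFlip_self j x
  have e4 := cubeFlip_of_ne x hjk
  rcases hjS with h | h <;> rcases hkS with h' | h' <;> rw [h] at e1 e3 <;> rw [h'] at e2 e4 <;>
    simp_all [cubeNeighbor]

/-- Two missing vertices can both be neighbours of a present x only if they are neighbours of v in
two directions j and k, and x is true exactly at j and k. The target y is false at both and is not
v, so it is true at some l; flipping l gives x three true coordinates, which for n ≥ 4 is present.
-/
theorem minusMinusVerts_isometric {n : ℕ} (hn : 4 ≤ n) (S : Finset (Fin n)) :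
    ∀ x ∈ minusMinusVerts n S, ∀ y ∈ minusMinusVerts n S, x ≠ y →
      ∃ j, x j ≠ y j ∧ cubeFlip j x ∈ minusMinusVerts n S := by
  refine exists_cubeFlip_mem fun x hx y hy j k hjk hj hk hjS hkS => ?_
  have hmiss : ∀ z : Fin n → Bool, z ∉ minusMinusVerts n S →
      z = (fun _ => true) ∨ z = (fun _ => false) ∨ ∃ s, z = cubeNeighbor n s := by
    intro z hz
    by_contra hcon
    push Not at hcon
    exact hz ⟨hcon.2.1, hcon.1, fun i _ => hcon.2.2 i⟩
  have two : ∀ s, cubeFlip j x = cubeNeighbor n s → s = k ∨ s = j := by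
    intro s h
    by_contra hcon
    push Not at hcon
    obtain ⟨l, hls, hlj, hlk⟩ := exists_ne_three hn s j k
    have e1 := cubeFlip_of_ne x hlj
    have e2 := cubeFlip_of_ne x hlk
    have e3 := cubeFlip_self j x
    have e4 := cubeFlip_of_ne x hjk
    have e5 := cubeFlip_of_ne x hcon.1
    have e6 := cubeFlip_of_ne x hcon.2
    have e7 := cubeFlip_self k x
    have e8 := cubeFlip_of_ne x (Ne.symm hjk)
    rw [h] at e1 e3 e6 e8
    rcases hmiss _ hkS with h' | h' | ⟨t, h'⟩ <;> rw [h'] at e2 e4 e5 e7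
    · simp_all [cubeNeighbor]
    · simp_all [cubeNeighbor]
    · have : s = t := by simp_all [cubeNeighbor]
      subst this
      simp_all [cubeNeighbor]
  obtain ⟨l, hlj, hlk, -⟩ := exists_ne_three hn j k k
  obtain ⟨l', hlj', hlk', hll'⟩ := exists_ne_three hn j k l
  have e1 := cubeFlip_of_ne x hlj
  have e1' := cubeFlip_of_ne x hlj'
  have e2 := cubeFlip_of_ne x hlk
  have e2' := cubeFlip_of_ne x hlk'
  have e3 := cubeFlip_self j x
  have e4 := cubeFlip_of_ne x hjk
  have e7 := cubeFlip_self k x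
  have e8 := cubeFlip_of_ne x (Ne.symm hjk)
  have hxg : ∀ g, x g = if g = j then !cubeFlip j x g else cubeFlip j x g := by
    intro g
    unfold cubeFlip
    split_ifs <;> simp
  rcases hmiss _ hjS with h | h | ⟨s, h⟩
  · exfalso
    clear hxg
    rw [h] at e1 e1' e3 e8
    rcases hmiss _ hkS with h' | h' | ⟨t, h'⟩ <;> rw [h'] at e2 e2' e4 e7
    · simp_all
    · simp_all
    · simp_all [cubeNeighbor]
  · exfalso
    clear hxg
    rw [h] at e1 e1' e3 e8
    rcases hmiss _ hkS with h' | h' | ⟨t, h'⟩ <;> rw [h'] at e2 e2' e4 e7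
    · simp_all
    · simp_all
    · simp_all [cubeNeighbor]
  · rcases two s h with rfl | rfl
    · rw [h] at hxg
      have hyj : y j = false := by
        have := hxg j
        simp only [if_true, cubeNeighbor, hjk, decide_false, Bool.not_false] at this
        rw [this] at hj
        revert hj
        cases y j <;> simp
      have hyk : y s = false := by
        have := hxg s
        simp only [Ne.symm hjk, if_false, cubeNeighbor, decide_true] at this
        rw [this] at hk
        revert hk
        cases y s <;> simp
      have hl : ∃ l, l ≠ j ∧ l ≠ s ∧ x l ≠ y l := by
        by_contra hcon
        push Not at hcon
        apply hy.1
        funext g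
        by_cases hgj : g = j
        · rw [hgj, hyj]
        · by_cases hgs : g = s
          · rw [hgs, hyk]
          · rw [← hcon g hgj hgs, hxg g]
            simp [hgj, hgs, cubeNeighbor]
      obtain ⟨l, hlj, hls, hxl⟩ := hl
      refine ⟨l, hxl, ?_⟩
      by_contra hlS
      obtain ⟨g, hgj, hgs, hgl⟩ := exists_ne_three hn j s l
      have f1 := (cubeFlip_of_ne x hgl).trans (hxg g)
      have f2 := (cubeFlip_of_ne x (Ne.symm hlj)).trans (hxg j)
      have f3 := (cubeFlip_of_ne x (Ne.symm hls)).trans (hxg s)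
      rcases hmiss _ hlS with h' | h' | ⟨t, h'⟩ <;> rw [h'] at f1 f2 f3
      · simp [hgj, cubeNeighbor, hgs] at f1
      · simp [cubeNeighbor, hjk] at f2
      · simp only [if_true, cubeNeighbor, hjk, decide_false, Bool.not_false,
          decide_eq_true_eq] at f2
        simp only [Ne.symm hjk, if_false, cubeNeighbor, decide_true, decide_eq_true_eq] at f3
        exact absurd (f2.trans f3.symm) hjk
    · exfalso
      apply hx.1
      rw [h] at hxg
      funext g
      rw [hxg g]
      by_cases hg : g = s <;> simp [cubeNeighbor, hg]

theorem not_hasPCMinor_of_isCOM {E : Type*} [Finite E] {D : Set E} {L : Set (E → SignType)}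
    {V : Type} {Γ : SimpleGraph V} {φ : V → E → SignType}
    (h : IsSignEmbedding Γ D φ) (hL : IsCOM L) (hLD : ∀ Z ∈ L, ∀ e, Z e ≠ 0 → e ∈ D)
    (htope : fullTopes D L = Set.range φ) : InFQMinus Γ := by
  refine ⟨h.isPartialCube, fun n hn => ⟨fun i hminor => ?_, fun S hS hminor => ?_⟩⟩
  · refine IsSignEmbedding.not_hasPCMinor (E := E) (fun D L φ hφ hL hLD htope => ?_) hminor h hL hLD
      htope
    refine IsSignEmbedding.not_com_of_side (i := i) hn (starVerts_isometric hn i) (fun h => h.1 rfl)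
      (fun h => h.2 rfl) (fun y _ h1 h2 => ⟨h1, h2⟩) ⟨fun hh => ?_, fun hh => ?_⟩ hφ hL hLD htope
    · have := congrFun hh i
      simp [cubeFlip] at this
    · have := congrFun hh i
      simp [cubeFlip, cubeNeighbor] at this
  · obtain ⟨i, hi⟩ := hS
    refine IsSignEmbedding.not_hasPCMinor (E := E) (fun D L φ hφ hL hLD htope => ?_) hminor h hL hLD
      htope
    refine IsSignEmbedding.not_com_of_side (i := i) hn (minusMinusVerts_isometric hn S)
      (fun h => h.2.1 rfl) (fun h => h.2.2 i hi rfl) (fun y hy h1 h2 => ?_)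
      ⟨fun hh => ?_, fun hh => ?_, fun j hj hh => ?_⟩ hφ hL hLD htope
    · refine ⟨?_, h1, ?_⟩
      · rintro rfl; simp at hy
      · rintro j hj rfl
        apply h2
        have : i = j := by simpa [cubeNeighbor] using hy
        rw [this]
    · obtain ⟨l, hl, -⟩ := exists_ne_three hn i i i
      have := congrFun hh l
      simp [cubeFlip, hl] at this
    · have := congrFun hh i
      simp [cubeFlip] at this
    · obtain ⟨l, hl, hl', -⟩ := exists_ne_three hn i j j
      have := congrFun hh l
      simp [cubeFlip, hl, cubeNeighbor, hl'] at this

end PartialCubes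

/-! ### Words as sign-vectors on ordered pairs, weak orders, and the effect of moves. -/

section WordSigns

variable {α : Type*}

theorem pair_sublist_cons {a b x : α} {t : List α} :
    [a, b].Sublist (x :: t) ↔ [a, b].Sublist t ∨ (a = x ∧ b ∈ t) := by
  rw [List.sublist_cons_iff]
  constructor
  · rintro (h | ⟨r, hr, h⟩)
    · exact Or.inl h
    · right
      simp only [List.cons.injEq] at hr
      exact ⟨hr.1, List.singleton_sublist.1 (hr.2 ▸ h)⟩
  · rintro (h | ⟨rfl, h⟩)
    · exact Or.inl h
    · exact Or.inr ⟨[b], rfl, List.singleton_sublist.2 h⟩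

theorem mem_of_pair_sublist {a b : α} {w : List α} (h : [a, b].Sublist w) : a ∈ w ∧ b ∈ w :=
  ⟨h.subset (by simp), h.subset (by simp)⟩

theorem pair_sublist_append {a b : α} {l₁ l₂ : List α} :
    [a, b].Sublist (l₁ ++ l₂) ↔ [a, b].Sublist l₁ ∨ (a ∈ l₁ ∧ b ∈ l₂) ∨ [a, b].Sublist l₂ := by
  induction l₁ with
  | nil => simp
  | cons x t ih =>
    rw [List.cons_append, pair_sublist_cons, ih, pair_sublist_cons, List.mem_append, List.mem_cons]
    tauto

theorem pair_sublist_reverse {a b : α} {w : List α} :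
    [a, b].Sublist w.reverse ↔ [b, a].Sublist w := by
  rw [← List.reverse_sublist]
  simp

theorem pair_sublist_flatten {a b : α} {L : List (List α)} :
    [a, b].Sublist L.flatten ↔ (∃ B ∈ L, [a, b].Sublist B) ∨
      ∃ B B', [B, B'].Sublist L ∧ a ∈ B ∧ b ∈ B' := by
  induction L with
  | nil => simp
  | cons C L ih =>
    rw [List.flatten_cons, pair_sublist_append, ih]
    constructor
    · rintro (h | ⟨h, h'⟩ | ⟨B, hB, h⟩ | ⟨B, B', h, h'⟩)
      · exact Or.inl ⟨C, by simp, h⟩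
      · obtain ⟨B', hB', hb⟩ := List.mem_flatten.1 h'
        exact Or.inr ⟨C, B', pair_sublist_cons.2 (Or.inr ⟨rfl, hB'⟩), h, hb⟩
      · exact Or.inl ⟨B, by simp [hB], h⟩
      · exact Or.inr ⟨B, B', pair_sublist_cons.2 (Or.inl h), h'⟩
    · rintro (⟨B, hB, h⟩ | ⟨B, B', h, ha, hb⟩)
      · rcases List.mem_cons.1 hB with rfl | hB
        · exact Or.inl h
        · exact Or.inr (Or.inr (Or.inl ⟨B, hB, h⟩))
      · rcases pair_sublist_cons.1 h with h₁ | ⟨rfl, h₁⟩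
        · exact Or.inr (Or.inr (Or.inr ⟨B, B', h₁, ha, hb⟩))
        · exact Or.inr (Or.inl ⟨ha, List.mem_flatten.2 ⟨B', h₁, hb⟩⟩)

theorem ne_of_pair_sublist {a b : α} {w : List α} (hw : w.Nodup) (h : [a, b].Sublist w) :
    a ≠ b := by
  have := h.nodup hw
  simpa using this

theorem pair_sublist_asymm {a b : α} {w : List α} (hw : w.Nodup) (h : [a, b].Sublist w) :
    ¬ [b, a].Sublist w := by
  induction w with
  | nil => simp
  | cons x t ih =>
    have hx := (List.nodup_cons.1 hw).1
    have ht := (List.nodup_cons.1 hw).2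
    rw [pair_sublist_cons] at h ⊢
    rintro (h' | ⟨rfl, h'⟩)
    · rcases h with h | ⟨rfl, h⟩
      · exact ih ht h h'
      · exact hx (mem_of_pair_sublist h').2
    · rcases h with h | ⟨rfl, h⟩
      · exact hx (mem_of_pair_sublist h).2
      · exact hx h

theorem pair_sublist_trans {a b c : α} {w : List α} (hw : w.Nodup) (h : [a, b].Sublist w)
    (h' : [b, c].Sublist w) : [a, c].Sublist w := by
  induction w with
  | nil => simp at h
  | cons x t ih =>
    have hx := (List.nodup_cons.1 hw).1
    have ht := (List.nodup_cons.1 hw).2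
    rw [pair_sublist_cons] at h h' ⊢
    rcases h' with h' | ⟨rfl, h'⟩
    · rcases h with h | ⟨rfl, h⟩
      · exact Or.inl (ih ht h h')
      · exact Or.inr ⟨rfl, (mem_of_pair_sublist h').2⟩
    · rcases h with h | ⟨rfl, h⟩
      · exact absurd (mem_of_pair_sublist h).2 hx
      · exact absurd h hx

theorem pair_sublist_total {a b : α} {w : List α} (ha : a ∈ w) (hb : b ∈ w) (hab : a ≠ b) :
    [a, b].Sublist w ∨ [b, a].Sublist w := by
  induction w with
  | nil => simp at ha
  | cons x t ih =>
    rw [pair_sublist_cons, pair_sublist_cons]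
    rcases List.mem_cons.1 ha with rfl | ha₁
    · rcases List.mem_cons.1 hb with rfl | hb₁
      · exact absurd rfl hab
      · exact Or.inl (Or.inr ⟨rfl, hb₁⟩)
    · rcases List.mem_cons.1 hb with rfl | hb₁
      · exact Or.inr (Or.inr ⟨rfl, ha₁⟩)
      · rcases ih ha₁ hb₁ with h | h
        · exact Or.inl (Or.inl h)
        · exact Or.inr (Or.inl h)

open Classical in
/-- The signs that record which of two letters comes first in a word. -/
noncomputable def wordSigns (w : List α) : α × α → SignType := fun p =>
  if [p.1, p.2].Sublist w then 1 else if [p.2, p.1].Sublist w then -1 else 0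

/-- The pairs of distinct elements of `A`. -/
def offPairs (A : Set α) : Set (α × α) :=
  {p | p.1 ∈ A ∧ p.2 ∈ A ∧ p.1 ≠ p.2}

/-- The sign-vectors of the weak orders on `A`. -/
structure IsWeakOrder (A : Set α) (X : α × α → SignType) : Prop where
  off : ∀ p, X p ≠ 0 → p ∈ offPairs A
  antisymm : ∀ a b, X (b, a) = -X (a, b)
  trans : ∀ a b c, X (a, b) = 1 → X (b, c) = 1 → X (a, c) = 1
  zero : ∀ a ∈ A, ∀ b ∈ A, X (a, b) = 0 → ∀ c, X (a, c) = X (b, c)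

theorem wordSigns_eq_one_iff {w : List α} {a b : α} :
    wordSigns w (a, b) = 1 ↔ [a, b].Sublist w := by
  unfold wordSigns
  split_ifs with h h' <;> simp [h]

theorem wordSigns_congr {β : Type*} {w : List α} {w' : List β} {a b : α} {c d : β}
    (h : [a, b].Sublist w ↔ [c, d].Sublist w') (h' : [b, a].Sublist w ↔ [d, c].Sublist w') :
    wordSigns w (a, b) = wordSigns w' (c, d) := by
  unfold wordSigns
  split_ifs <;> simp_all

theorem wordSigns_antisymm {w : List α} (hw : w.Nodup) (a b : α) :
    wordSigns w (b, a) = -wordSigns w (a, b) := by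
  unfold wordSigns
  by_cases h : [a, b].Sublist w
  · simp [h, pair_sublist_asymm hw h]
  · simp only [h, if_false]
    split_ifs <;> simp

theorem wordSigns_reverse {w : List α} (hw : w.Nodup) : wordSigns w.reverse = -wordSigns w := by
  funext ⟨a, b⟩
  rw [Pi.neg_apply, ← wordSigns_antisymm hw]
  unfold wordSigns
  split_ifs <;> simp_all [pair_sublist_reverse]

theorem sign_eq_of_eq_one_iff {x y x' y' : SignType} (hx : x' = -x) (hy : y' = -y)
    (h : x = 1 ↔ y = 1) (h' : x' = 1 ↔ y' = 1) : x = y := by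
  subst hx hy
  revert x y
  decide

theorem IsWordOn.full {A : Set α} {w : List α} (hw : IsWordOn A w) (p : α × α) :
    wordSigns w p ≠ 0 ↔ p ∈ offPairs A := by
  obtain ⟨a, b⟩ := p
  have hmem := hw.2
  change _ ↔ a ∈ A ∧ b ∈ A ∧ a ≠ b
  rw [← hmem, ← hmem]
  constructor
  · intro h
    have : [a, b].Sublist w ∨ [b, a].Sublist w := by
      by_contra hcon
      push Not at hcon
      apply h
      unfold wordSigns
      simp [hcon.1, hcon.2]
    rcases this with h | h
    · exact ⟨(mem_of_pair_sublist h).1, (mem_of_pair_sublist h).2, ne_of_pair_sublist hw.1 h⟩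
    · exact ⟨(mem_of_pair_sublist h).2, (mem_of_pair_sublist h).1, (ne_of_pair_sublist hw.1 h).symm⟩
  · rintro ⟨ha, hb, hab⟩
    unfold wordSigns
    rcases pair_sublist_total ha hb hab with h | h <;> split_ifs <;> simp_all

theorem IsWordOn.trans {A : Set α} {w : List α} (hw : IsWordOn A w) {a b c : α}
    (h : wordSigns w (a, b) = 1) (h' : wordSigns w (b, c) = 1) : wordSigns w (a, c) = 1 := by
  rw [wordSigns_eq_one_iff] at *
  exact pair_sublist_trans hw.1 h h'

theorem IsWordOn.ext {A : Set α} {w w' : List α} (hw : IsWordOn A w) (hw' : IsWordOn A w')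
    (h : wordSigns w = wordSigns w') : w = w' := by
  have hperm : w.Perm w' := (List.perm_ext_iff_of_nodup hw.1 hw'.1).2 fun a => by
    rw [hw.2, hw'.2]
  refine hperm.eq_of_pairwise (le := fun a b => [a, b].Sublist w) ?_ ?_ ?_
  · intro a b _ _ h1 h2
    exact absurd h2 (pair_sublist_asymm hw.1 h1)
  · rw [List.pairwise_iff_forall_sublist]; exact fun h => h
  · rw [List.pairwise_iff_forall_sublist]
    intro a b hab
    rwa [← wordSigns_eq_one_iff, h, wordSigns_eq_one_iff]

theorem IsWordOn.isWeakOrder {A : Set α} {w : List α} (hw : IsWordOn A w) :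
    IsWeakOrder A (wordSigns w) where
  off p := (hw.full p).1
  antisymm := wordSigns_antisymm hw.1
  trans _ _ _ := hw.trans
  zero a ha b hb h c := by
    have : a = b := by
      by_contra hab
      exact (hw.full (a, b)).2 ⟨ha, hb, hab⟩ h
    rw [this]

theorem IsWordOn.reverse {A : Set α} {w : List α} (hw : IsWordOn A w) : IsWordOn A w.reverse :=
  ⟨List.nodup_reverse.2 hw.1, fun a => by rw [List.mem_reverse]; exact hw.2 a⟩

/-! ### Moves -/

/-- The ordered pairs of distinct letters in a common substring of a move. -/
def movePairs (m : Set (List α)) : Set (α × α) :=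
  {p | p.1 ≠ p.2 ∧ ∃ s ∈ m, p.1 ∈ s ∧ p.2 ∈ s}

theorem mem_movePairs_swap {m : Set (List α)} {a b : α} :
    (a, b) ∈ movePairs m ↔ (b, a) ∈ movePairs m :=
  ⟨fun ⟨h, s, hs, h1, h2⟩ => ⟨h.symm, s, hs, h2, h1⟩,
    fun ⟨h, s, hs, h1, h2⟩ => ⟨h.symm, s, hs, h2, h1⟩⟩

theorem mem_invSet_iff [LinearOrder α] {m : Set (List α)} {a b : α} (hab : a < b) :
    (a, b) ∈ invSet m ↔ (a, b) ∈ movePairs m :=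
  ⟨fun h => ⟨hab.ne, h.2⟩, fun h => ⟨hab, h.2⟩⟩

theorem pair_sublist_map_reverse {a b : α} {L : List (List α)} (hL : L.flatten.Nodup) :
    [a, b].Sublist (L.map List.reverse).flatten ↔
      ((∃ B ∈ L, a ∈ B ∧ b ∈ B) ∧ [b, a].Sublist L.flatten) ∨
      (¬ (∃ B ∈ L, a ∈ B ∧ b ∈ B) ∧ [a, b].Sublist L.flatten) := by
  induction L with
  | nil => simp
  | cons C L ih =>
    rw [List.flatten_cons, List.nodup_append] at hL
    obtain ⟨hC, hL', hdisj⟩ := hL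
    have ih := ih hL'
    have hmem : ∀ x, x ∈ (L.map List.reverse).flatten ↔ x ∈ L.flatten := by
      intro x
      simp only [List.mem_flatten, List.mem_map]
      constructor
      · rintro ⟨_, ⟨B, hB, rfl⟩, hx⟩
        exact ⟨B, hB, List.mem_reverse.1 hx⟩
      · rintro ⟨B, hB, hx⟩
        exact ⟨_, ⟨B, hB, rfl⟩, List.mem_reverse.2 hx⟩
    have hdisj' : ∀ x, x ∈ C → x ∉ L.flatten := fun x hx hx' => hdisj x hx x hx' rfl
    have hin : ∀ B ∈ L, ∀ x ∈ B, x ∈ L.flatten := fun B hB x hx => List.mem_flatten.2 ⟨B, hB, hx⟩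
    rw [List.map_cons, List.flatten_cons, List.flatten_cons, pair_sublist_append,
      pair_sublist_append, pair_sublist_append, pair_sublist_reverse, ih, hmem, List.mem_reverse]
    simp only [List.mem_cons, exists_eq_or_imp]
    by_cases ha : a ∈ C <;> by_cases hb : b ∈ C
    · have h1 := hdisj' a ha
      have h2 := hdisj' b hb
      have h3 : ¬ [a, b].Sublist L.flatten := fun h => h1 (mem_of_pair_sublist h).1
      have h4 : ¬ [b, a].Sublist L.flatten := fun h => h2 (mem_of_pair_sublist h).1
      simp [ha, hb, h1, h2, h3, h4]
    · have h1 := hdisj' a ha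
      have h3 : ¬ [a, b].Sublist L.flatten := fun h => h1 (mem_of_pair_sublist h).1
      have h4 : ¬ [b, a].Sublist L.flatten := fun h => h1 (mem_of_pair_sublist h).2
      have h5 : ¬ ∃ B ∈ L, a ∈ B ∧ b ∈ B := fun ⟨B, hB, h, _⟩ => h1 (hin B hB a h)
      have h6 : ¬ [a, b].Sublist C := fun h => hb (mem_of_pair_sublist h).2
      have h7 : ¬ [b, a].Sublist C := fun h => hb (mem_of_pair_sublist h).1
      simp [ha, hb, h3, h4, h5, h6, h7]
    · have h1 := hdisj' b hb
      have h3 : ¬ [a, b].Sublist L.flatten := fun h => h1 (mem_of_pair_sublist h).2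
      have h4 : ¬ [b, a].Sublist L.flatten := fun h => h1 (mem_of_pair_sublist h).1
      have h5 : ¬ ∃ B ∈ L, a ∈ B ∧ b ∈ B := fun ⟨B, hB, _, h⟩ => h1 (hin B hB b h)
      have h6 : ¬ [a, b].Sublist C := fun h => ha (mem_of_pair_sublist h).1
      have h7 : ¬ [b, a].Sublist C := fun h => ha (mem_of_pair_sublist h).2
      simp [ha, hb, h3, h4, h5, h6, h7]
    · have h6 : ¬ [a, b].Sublist C := fun h => ha (mem_of_pair_sublist h).1
      have h7 : ¬ [b, a].Sublist C := fun h => ha (mem_of_pair_sublist h).2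
      simp [ha, hb, h6, h7]

theorem two_le_length {s : List α} {a b : α} (ha : a ∈ s) (hb : b ∈ s) (hab : a ≠ b) :
    2 ≤ s.length := by
  match s, ha, hb with
  | [x], ha, hb => simp_all
  | _ :: _ :: _, _, _ => simp

theorem BlockMove.mem_movePairs_iff {L : List (List α)} {m : Set (List α)} {w w' : List α}
    (h : BlockMove L m w w') {a b : α} :
    (a, b) ∈ movePairs m ↔ a ≠ b ∧ ∃ B ∈ L, a ∈ B ∧ b ∈ B := by
  obtain ⟨-, -, -, rfl, -⟩ := h
  constructor
  · rintro ⟨hab, s, ⟨hs, -⟩, h⟩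
    exact ⟨hab, s, hs, h⟩
  · rintro ⟨hab, s, hs, ha, hb⟩
    exact ⟨hab, s, ⟨hs, two_le_length ha hb hab⟩, ha, hb⟩

theorem BlockMove.wordSigns_of_mem {L : List (List α)} {m : Set (List α)} {w w' : List α}
    (h : BlockMove L m w w') (hw : w.Nodup) {p : α × α} (hp : p ∈ movePairs m) :
    wordSigns w' p = -wordSigns w p := by
  obtain ⟨a, b⟩ := p
  obtain ⟨hab, B, hB, ha, hb⟩ := h.mem_movePairs_iff.1 hp
  obtain ⟨-, rfl, rfl, -, -⟩ := h
  rw [← wordSigns_antisymm hw]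
  have h1 : ∃ B ∈ L, a ∈ B ∧ b ∈ B := ⟨B, hB, ha, hb⟩
  have h2 : ∃ B ∈ L, b ∈ B ∧ a ∈ B := ⟨B, hB, hb, ha⟩
  apply wordSigns_congr <;> rw [pair_sublist_map_reverse hw] <;> simp only [h1, h2] <;> simp

theorem BlockMove.wordSigns_of_notMem {L : List (List α)} {m : Set (List α)} {w w' : List α}
    (h : BlockMove L m w w') (hw : w.Nodup) {p : α × α} (hp : p ∉ movePairs m) :
    wordSigns w' p = wordSigns w p := by
  obtain ⟨a, b⟩ := p
  have hnot := mt h.mem_movePairs_iff.2 hp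
  obtain ⟨-, rfl, rfl, -, -⟩ := h
  by_cases hab : a = b
  · subst hab
    have h0 : ¬ [a, a].Sublist L.flatten := fun h => ne_of_pair_sublist hw h rfl
    have h1 : [a, a].Sublist (L.map List.reverse).flatten ↔ [a, a].Sublist L.flatten := by
      rw [pair_sublist_map_reverse hw]; simp [h0]
    exact wordSigns_congr h1 h1
  · have h1 : ¬ ∃ B ∈ L, a ∈ B ∧ b ∈ B := fun h => hnot ⟨hab, h⟩
    have h2 : ¬ ∃ B ∈ L, b ∈ B ∧ a ∈ B := fun ⟨B, hB, hb, ha⟩ => hnot ⟨hab, B, hB, ha, hb⟩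
    apply wordSigns_congr <;> rw [pair_sublist_map_reverse hw] <;> simp only [h1, h2] <;> simp

theorem nodup_block {L : List (List α)} (hL : L.flatten.Nodup) {B B' : List α}
    (hB : B ∈ L) (hB' : B' ∈ L) {a : α} (ha : a ∈ B) (ha' : a ∈ B') : B = B' := by
  induction L with
  | nil => simp at hB
  | cons C L ih =>
    rw [List.flatten_cons, List.nodup_append] at hL
    obtain ⟨-, hL', hdisj⟩ := hL
    rcases List.mem_cons.1 hB with rfl | h₁ <;> rcases List.mem_cons.1 hB' with rfl | h₂
    · rfl
    · exact absurd rfl (hdisj a ha a (List.mem_flatten.2 ⟨B', h₂, ha'⟩))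
    · exact absurd rfl (hdisj a ha' a (List.mem_flatten.2 ⟨B, h₁, ha⟩))
    · exact ih hL' h₁ h₂

theorem BlockMove.mem_movePairs_trans {L : List (List α)} {m : Set (List α)} {w w' : List α}
    (h : BlockMove L m w w') (hw : w.Nodup) {a b c : α} (h1 : (a, b) ∈ movePairs m)
    (h2 : (b, c) ∈ movePairs m) (hac : a ≠ c) : (a, c) ∈ movePairs m := by
  obtain ⟨-, B, hB, ha, hb⟩ := h.mem_movePairs_iff.1 h1
  obtain ⟨-, B', hB', hb', hc⟩ := h.mem_movePairs_iff.1 h2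
  rw [← h.2.1] at hw
  obtain rfl := nodup_block hw hB hB' hb hb'
  exact h.mem_movePairs_iff.2 ⟨hac, B, hB, ha, hc⟩

theorem BlockMove.movePairs_nonempty {L : List (List α)} {m : Set (List α)} {w w' : List α}
    (h : BlockMove L m w w') (hw : w.Nodup) : (movePairs m).Nonempty := by
  obtain ⟨-, rfl, rfl, rfl, s, hs, hlen⟩ := h
  match s, hs, hlen with
  | a :: b :: t, hs, _ =>
    have : (a :: b :: t).Nodup := (List.nodup_flatten.1 hw).1 _ hs
    refine ⟨(a, b), ?_, _, ⟨hs, by simp⟩, by simp, by simp⟩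
    intro h
    have h : a = b := h
    subst h
    simp at this

theorem BlockMove.movePairs_subset {A : Set α} {L : List (List α)} {m : Set (List α)}
    {w w' : List α} (h : BlockMove L m w w') (hw : IsWordOn A w) : movePairs m ⊆ offPairs A := by
  rintro ⟨a, b⟩ hp
  obtain ⟨hab, B, hB, ha, hb⟩ := h.mem_movePairs_iff.1 hp
  have := h.2.1
  refine ⟨(hw.2 a).1 ?_, (hw.2 b).1 ?_, hab⟩ <;> rw [← this]
  · exact List.mem_flatten.2 ⟨B, hB, ha⟩
  · exact List.mem_flatten.2 ⟨B, hB, hb⟩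

end WordSigns

/-! ### Allowable graphs: which pairs are reversed together, and antipodal faces as weak orders. -/

section AllowableGraphs

variable {α : Type*}

/-- Let a and b be tied and let c come after a. If c came before b, then a would come before b; if c
were tied with b, it would be tied with a. So c comes after b as well. -/
theorem IsWeakOrder.of_zero_trans {A : Set α} {X : α × α → SignType}
    (off : ∀ p, X p ≠ 0 → p ∈ offPairs A) (antisymm : ∀ a b, X (b, a) = -X (a, b))
    (trans : ∀ a b c, X (a, b) = 1 → X (b, c) = 1 → X (a, c) = 1)
    (hzero : ∀ a ∈ A, ∀ b ∈ A, ∀ c ∈ A, X (a, b) = 0 → X (b, c) = 0 → X (a, c) = 0) :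
    IsWeakOrder A X := by
  refine ⟨off, antisymm, trans, fun a ha b hb hab c => ?_⟩
  have hba : X (b, a) = 0 := by rw [antisymm, hab]; rfl
  by_cases hc : c ∈ A
  swap
  · have h1 : X (a, c) = 0 := by
      by_contra h
      exact hc (off _ h).2.1
    have h2 : X (b, c) = 0 := by
      by_contra h
      exact hc (off _ h).2.1
    rw [h1, h2]
  have key : ∀ a b : α, a ∈ A → b ∈ A → X (a, b) = 0 → X (a, c) = 1 → X (b, c) = 1 := by
    intro a b ha hb hab h
    rcases SignType.trichotomy (X (b, c)) with h' | h' | h'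
    · have := trans a c b h (by rw [antisymm, h']; rfl)
      rw [hab] at this
      exact absurd this (by decide)
    · have := hzero a ha b hb c hc hab h'
      rw [h] at this
      exact absurd this (by decide)
    · exact h'
  have key' : ∀ a b : α, a ∈ A → b ∈ A → X (b, a) = 0 → X (c, a) = 1 → X (c, b) = 1 := by
    intro a b ha hb hba h
    rcases SignType.trichotomy (X (c, b)) with h' | h' | h'
    · have := trans b c a (by rw [antisymm, h']; rfl) h
      rw [hba] at this
      exact absurd this (by decide)
    · have := hzero c hc b hb a ha h' hba
      rw [h] at this
      exact absurd this (by decide)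
    · exact h'
  exact sign_eq_of_eq_one_iff (antisymm a c) (antisymm b c)
    ⟨key a b ha hb hab, key b a hb ha hba⟩ ⟨key' a b ha hb hba, key' b a hb ha hab⟩

variable [LinearOrder α]

theorem movePairs_eq_of_invSet_eq {m s : Set (List α)} (h : invSet m = invSet s) :
    movePairs m = movePairs s := by
  have key : ∀ m s : Set (List α), invSet m = invSet s → movePairs m ⊆ movePairs s := by
    rintro m s h ⟨a, b⟩ hp
    rcases lt_or_gt_of_ne (show a ≠ b from hp.1) with hab | hab
    · exact (mem_invSet_iff hab).1 (h ▸ (mem_invSet_iff hab).2 hp)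
    · exact mem_movePairs_swap.1 ((mem_invSet_iff hab).1
        (h ▸ (mem_invSet_iff hab).2 (mem_movePairs_swap.1 hp)))
  exact (key m s h).antisymm (key s m h.symm)

theorem disjoint_movePairs {m s : Set (List α)} (h : Disjoint (invSet m) (invSet s)) :
    Disjoint (movePairs m) (movePairs s) := by
  rw [Set.disjoint_left] at h ⊢
  rintro ⟨a, b⟩ hp hp'
  rcases lt_or_gt_of_ne (show a ≠ b from hp.1) with hab | hab
  · exact h ((mem_invSet_iff hab).2 hp) ((mem_invSet_iff hab).2 hp')
  · exact h ((mem_invSet_iff hab).2 (mem_movePairs_swap.1 hp))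
      ((mem_invSet_iff hab).2 (mem_movePairs_swap.1 hp'))

theorem IsAllowableGraph.movePairs_eq_or_disjoint {A : Set α} {P : Set (List α)}
    {M : Set (Set (List α))} (h : IsAllowableGraph A P M) {m s : Set (List α)} (hm : m ∈ M)
    (hs : s ∈ M) : movePairs m = movePairs s ∨ Disjoint (movePairs m) (movePairs s) :=
  (h.disjoint m hm s hs).imp movePairs_eq_of_invSet_eq disjoint_movePairs

theorem IsAllowableGraph.movePairs_eq {A : Set α} {P : Set (List α)}
    {M : Set (Set (List α))} (h : IsAllowableGraph A P M) {m s : Set (List α)} (hm : m ∈ M)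
    (hs : s ∈ M) {p : α × α} (h1 : p ∈ movePairs m) (h2 : p ∈ movePairs s) :
    movePairs m = movePairs s :=
  (h.movePairs_eq_or_disjoint hm hs).resolve_right fun hd => Set.disjoint_left.1 hd h1 h2

theorem IsAllowableGraph.supp {A : Set α} {P : Set (List α)} {M : Set (Set (List α))}
    (h : IsAllowableGraph A P M) :
    ∀ T ∈ wordSigns '' P, ∀ p, T p ≠ 0 ↔ p ∈ offPairs A := by
  rintro _ ⟨w, hw, rfl⟩
  exact (h.words w hw).full

theorem IsAllowableGraph.neg_mem {A : Set α} {P : Set (List α)} {M : Set (Set (List α))}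
    (h : IsAllowableGraph A P M) {T : α × α → SignType} (hT : T ∈ wordSigns '' P) :
    -T ∈ wordSigns '' P := by
  obtain ⟨w, hw, rfl⟩ := hT
  exact ⟨_, h.symmetric w hw, wordSigns_reverse (h.words w hw).1⟩

theorem IsAllowableGraph.movePairs_subset {A : Set α} {P : Set (List α)} {M : Set (Set (List α))}
    (h : IsAllowableGraph A P M) {m : Set (List α)} (hm : m ∈ M) : movePairs m ⊆ offPairs A := by
  obtain ⟨w, hw, w', -, L, hL⟩ := h.moves m hm
  exact hL.movePairs_subset (h.words w hw)

theorem IsAllowableGraph.movePairs_nonempty {A : Set α} {P : Set (List α)}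
    {M : Set (Set (List α))} (h : IsAllowableGraph A P M) {m : Set (List α)} (hm : m ∈ M) :
    (movePairs m).Nonempty := by
  obtain ⟨w, hw, w', -, L, hL⟩ := h.moves m hm
  exact hL.movePairs_nonempty (h.words w hw).1

/-- Disjoint inversion sets mean that a pair is reversed at most once, so its sign at time k only
depends on whether an earlier move contains it. -/
theorem sequence_signs {l : ℕ} {w : ℕ → List α} {m : ℕ → Set (List α)}
    (hnd : ∀ k ≤ l, (w k).Nodup) (hm : ∀ k < l, IsMove (m k) (w k) (w (k + 1)))
    (hd : ∀ j k, j < k → k < l → Disjoint (invSet (m j)) (invSet (m k))) (p : α × α) :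
    ∀ k ≤ l, (wordSigns (w k) p = -wordSigns (w 0) p ∧ ∃ j < k, p ∈ movePairs (m j)) ∨
      (wordSigns (w k) p = wordSigns (w 0) p ∧ ∀ j < k, p ∉ movePairs (m j)) := by
  intro k
  induction k with
  | zero => intro _; right; simp
  | succ k ih =>
    intro hk
    obtain ⟨L, hL⟩ := hm k (by omega)
    have hn := hnd k (by omega)
    by_cases hp : p ∈ movePairs (m k)
    · left
      rw [hL.wordSigns_of_mem hn hp]
      refine ⟨?_, k, by omega, hp⟩
      rcases ih (by omega) with ⟨-, j, hj, hpj⟩ | ⟨h, -⟩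
      · exact absurd hp (Set.disjoint_left.1 (disjoint_movePairs (hd j k hj (by omega))) hpj)
      · rw [h]
    · rw [hL.wordSigns_of_notMem hn hp]
      rcases ih (by omega) with ⟨h, j, hj, hpj⟩ | ⟨h, h'⟩
      · exact Or.inl ⟨h, j, by omega, hpj⟩
      · refine Or.inr ⟨h, fun j hj => ?_⟩
        rcases Nat.lt_succ_iff_lt_or_eq.1 hj with hj | rfl
        · exact h' j hj
        · exact hp

/-- Between two permutations that differ at `p` there is a move that reverses `p`. -/
theorem IsAllowableGraph.exists_move {A : Set α} {P : Set (List α)} {M : Set (Set (List α))}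
    (h : IsAllowableGraph A P M) {σ σ' : List α} (hσ : σ ∈ P) (hσ' : σ' ∈ P) {p : α × α}
    (hp : wordSigns σ p ≠ wordSigns σ' p) :
    ∃ m ∈ M, ∃ γ ∈ P, ∃ γ' ∈ P, IsMove m γ γ' ∧ p ∈ movePairs m ∧
      ∀ q, wordSigns σ q = wordSigns σ' q →
        wordSigns γ q = wordSigns σ q ∧ wordSigns γ' q = wordSigns σ q := by
  obtain ⟨l, w, m, rfl, rfl, hw, hm, hd⟩ := h.connected σ hσ σ' hσ'
  have hseq := sequence_signs (fun k hk => (h.words _ (hw k hk)).1) (fun k hk => (hm k hk).2) hd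
  rcases hseq p l le_rfl with ⟨-, j, hj, hpj⟩ | ⟨h', -⟩
  · refine ⟨m j, (hm j hj).1, w j, hw j hj.le, w (j + 1), hw (j + 1) hj, (hm j hj).2, hpj, ?_⟩
    intro q hq
    -- A non-zero entry that is the same at both ends has not been reversed at all, since a single
    -- reversal could not be undone.
    have key : ∀ k ≤ l, wordSigns (w k) q = wordSigns (w 0) q := by
      intro k hk
      rcases hseq q l le_rfl with ⟨h1, -⟩ | ⟨-, h1⟩
      · have h0 : wordSigns (w 0) q = 0 := by
          by_contra h0
          exact sign_ne_neg_self h0 (hq.trans h1)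
        rcases hseq q k hk with ⟨h2, -⟩ | ⟨h2, -⟩
        · rw [h2, h0]; rfl
        · exact h2
      · rcases hseq q k hk with ⟨-, j, hj, hqj⟩ | ⟨h2, -⟩
        · exact absurd hqj (h1 j (by omega))
        · exact h2
    exact ⟨key j hj.le, key (j + 1) hj⟩
  · exact absurd h'.symm hp

/-- The first move on the way to another permutation. -/
theorem IsAllowableGraph.exists_first_move {A : Set α} {P : Set (List α)}
    {M : Set (Set (List α))} (h : IsAllowableGraph A P M) {σ σ' : List α} (hσ : σ ∈ P)
    (hσ' : σ' ∈ P) (hne : σ ≠ σ') :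
    ∃ m ∈ M, ∃ γ ∈ P, IsMove m σ γ ∧ ∀ q ∈ movePairs m, wordSigns σ' q ≠ wordSigns σ q := by
  obtain ⟨l, w, m, rfl, rfl, hw, hm, hd⟩ := h.connected σ hσ σ' hσ'
  have hseq := sequence_signs (fun k hk => (h.words _ (hw k hk)).1) (fun k hk => (hm k hk).2) hd
  have hl : 0 < l := by
    by_contra hl
    obtain rfl : l = 0 := by omega
    exact hne rfl
  refine ⟨m 0, (hm 0 hl).1, w 1, hw 1 hl, (hm 0 hl).2, fun q hq heq => ?_⟩
  have hq0 := ((h.words _ (hw 0 hl.le)).full q).2 (h.movePairs_subset (hm 0 hl).1 hq)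
  rcases hseq q l le_rfl with ⟨h1, -⟩ | ⟨-, h1⟩
  · exact sign_ne_neg_self hq0 (heq.symm.trans h1)
  · exact h1 0 hl hq

/-- The pairs reversed by a move are always reversed together. -/
theorem IsAllowableGraph.reversed_together {A : Set α} {P : Set (List α)}
    {M : Set (Set (List α))} (h : IsAllowableGraph A P M) {m : Set (List α)} (hm : m ∈ M)
    {p q : α × α} (hp : p ∈ movePairs m) (hq : q ∈ movePairs m) {T T' : α × α → SignType}
    (hT : T ∈ wordSigns '' P) (hT' : T' ∈ wordSigns '' P) (hne : T p ≠ T' p) : T q ≠ T' q := by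
  obtain ⟨σ, hσ, rfl⟩ := hT
  obtain ⟨σ', hσ', rfl⟩ := hT'
  obtain ⟨l, w, m', rfl, rfl, hw, hm', hd⟩ := h.connected σ hσ σ' hσ'
  have hseq := sequence_signs (fun k hk => (h.words _ (hw k hk)).1) (fun k hk => (hm' k hk).2) hd
  rcases hseq p l le_rfl with ⟨-, j, hj, hpj⟩ | ⟨h1, -⟩
  -- By (P3) the move of the sequence that reverses `p` has the same pairs as `m`, so it reverses
  -- `q` too.
  · rw [h.movePairs_eq hm (hm' j hj).1 hp hpj] at hq
    rcases hseq q l le_rfl with ⟨h1, -⟩ | ⟨-, h1⟩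
    · rw [h1]
      exact sign_ne_neg_self (((h.words _ (hw 0 (by omega))).full q).2
        (h.movePairs_subset (hm' j hj).1 hq))
    · exact absurd hq (h1 j hj)
  · exact absurd h1.symm hne

/-- A permutation and its reverse differ in every pair, so the sequence between them contains a move
for each pair. -/
theorem IsAllowableGraph.exists_move_mem {A : Set α} {P : Set (List α)}
    {M : Set (Set (List α))} (h : IsAllowableGraph A P M) (hne : P.Nonempty) {p : α × α}
    (hp : p ∈ offPairs A) : ∃ m ∈ M, p ∈ movePairs m := by
  obtain ⟨σ, hσ⟩ := hne
  have hp' : wordSigns σ p ≠ wordSigns σ.reverse p := by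
    rw [wordSigns_reverse (h.words σ hσ).1]
    exact sign_ne_neg_self (((h.words σ hσ).full p).2 hp)
  obtain ⟨m, hm, -, -, -, -, -, h', -⟩ := h.exists_move hσ (h.symmetric σ hσ) hp'
  exact ⟨m, hm, h'⟩

/-- The antipodal faces of an allowable graph of permutations are given by weak orders. -/
theorem IsAllowableGraph.isWeakOrder {A : Set α} {P : Set (List α)} {M : Set (Set (List α))}
    (h : IsAllowableGraph A P M) {X : α × α → SignType} (hX : IsAntipodalFace (wordSigns '' P) X) :
    IsWeakOrder A X := by
  obtain ⟨⟨T, hT, hXT⟩, hanti⟩ := hX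
  have hword : ∀ T ∈ wordSigns '' P, IsWeakOrder A T := by
    rintro _ ⟨w, hw, rfl⟩
    exact (h.words w hw).isWeakOrder
  have hS := hanti T hT hXT
  have hS0 : ∀ p, X p = 0 → signComp X (-T) p = -T p := fun p hp => signComp_of_eq hp
  have hS1 : ∀ p, X p ≠ 0 → signComp X (-T) p = T p := fun p hp => by
    rw [signComp_of_ne hp, hXT p hp]
  have off : ∀ p, X p ≠ 0 → p ∈ offPairs A := fun p hp =>
    (h.supp T hT p).1 (by rw [hXT p hp]; exact hp)
  -- Otherwise the opposite tope X∘(-T) would agree with T at (a, b) but not at (b, a).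
  have anti : ∀ a b, X (a, b) ≠ 0 → X (b, a) ≠ 0 := by
    intro a b hab hba
    have h1 := (hword _ hS).antisymm a b
    rw [hS0 _ hba, hS1 _ hab, (hword T hT).antisymm a b, neg_neg] at h1
    exact sign_ne_neg_self (by rw [hXT _ hab]; exact hab) h1
  have antisymm : ∀ a b, X (b, a) = -X (a, b) := by
    intro a b
    by_cases hab : X (a, b) = 0
    · have hba : X (b, a) = 0 := by
        by_contra hba
        exact anti b a hba hab
      rw [hab, hba]; rfl
    · rw [← hXT _ hab, ← hXT _ (anti a b hab), (hword T hT).antisymm a b]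
  refine IsWeakOrder.of_zero_trans off antisymm ?_ ?_
  · intro a b c hab hbc
    have h1 : X (a, b) ≠ 0 := by rw [hab]; decide
    have h2 : X (b, c) ≠ 0 := by rw [hbc]; decide
    have hT1 := (hword T hT).trans a b c (by rw [hXT _ h1, hab]) (by rw [hXT _ h2, hbc])
    -- If X vanished at (a, c), the opposite tope would keep a before b before c and yet place c
    -- before a.
    by_cases h3 : X (a, c) = 0
    · have hS2 := (hword _ hS).trans a b c (by rw [hS1 _ h1, hXT _ h1, hab])
        (by rw [hS1 _ h2, hXT _ h2, hbc])
      rw [hS0 _ h3, hT1] at hS2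
      exact absurd hS2 (by decide)
    · rw [← hXT _ h3, hT1]
  · intro a ha b hb c hc hab hbc
    by_contra hac
    have hab' : a ≠ b := by rintro rfl; exact hac hbc
    have hbc' : b ≠ c := by rintro rfl; exact hac hab
    have hac' : a ≠ c := (off _ hac).2.2
    have hcons : ∀ T ∈ wordSigns '' P, T (a, b) = T (b, c) → T (a, c) = T (a, b) := by
      intro T hT hTe
      have h0 : T (a, b) ≠ 0 := (h.supp T hT _).2 ⟨ha, hb, hab'⟩
      rcases SignType.trichotomy (T (a, b)) with h' | h' | h'
      · have h1 := (hword T hT).trans c b a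
          (by rw [(hword T hT).antisymm b c, ← hTe, h']; rfl)
          (by rw [(hword T hT).antisymm a b, h']; rfl)
        rw [(hword T hT).antisymm c a, h1, h']
      · exact absurd h' h0
      · rw [h', (hword T hT).trans a b c h' (hTe ▸ h')]
    -- In no word of the face is b between a and c: it would also be between them in the opposite
    -- word, in the opposite order, although X fixes the order of a and c.
    have hstar : ∀ T ∈ wordSigns '' P, Conf X T → T (b, c) = -T (a, b) := by
      intro T hT hXT
      have h0 : T (a, b) ≠ 0 := (h.supp T hT _).2 ⟨ha, hb, hab'⟩
      have h1 : T (b, c) ≠ 0 := (h.supp T hT _).2 ⟨hb, hc, hbc'⟩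
      by_contra hne
      have heq : T (a, b) = T (b, c) := by
        by_contra h'
        exact hne (sign_eq_neg_of_ne h0 h1 h')
      have h2 := hcons T hT heq
      have h3 := hcons _ (hanti T hT hXT) (by
        rw [signComp_of_eq hab, signComp_of_eq hbc, Pi.neg_apply, Pi.neg_apply, heq])
      rw [signComp_of_eq hab, signComp_of_ne hac, ← hXT _ hac, h2] at h3
      exact sign_ne_neg_self h0 h3
    obtain ⟨σ, hσ, hσT⟩ := hT
    obtain ⟨σ', hσ', hσ'S⟩ := hS
    have hne : wordSigns σ (a, b) ≠ wordSigns σ' (a, b) := by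
      rw [hσ'S, hS0 _ hab, hσT]
      exact sign_ne_neg_self ((h.supp T ⟨σ, hσ, hσT⟩ _).2 ⟨ha, hb, hab'⟩)
    obtain ⟨m, hm, γ, hγ, γ', hγ', ⟨L, hL⟩, hp, hbetween⟩ := h.exists_move hσ hσ' hne
    have hagree : ∀ q, X q ≠ 0 → wordSigns γ q = X q ∧ wordSigns γ' q = X q := by
      intro q hq
      have := hbetween q (by rw [hσ'S, hS1 _ hq, hσT])
      rwa [hσT, hXT q hq] at this
    have h1 := hstar _ ⟨γ, hγ, rfl⟩ fun q hq => (hagree q hq).1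
    have h2 := hstar _ ⟨γ', hγ', rfl⟩ fun q hq => (hagree q hq).2
    have hn := (h.words γ hγ).1
    -- The move stays in the face and reverses (a, b), so by `hstar` it also reverses (b, c). Then
    -- a, b, c share a substring and (a, c) is reversed, although X fixes it.
    have hbcm : (b, c) ∈ movePairs m := by
      by_contra hnot
      rw [hL.wordSigns_of_mem hn hp, hL.wordSigns_of_notMem hn hnot, h1] at h2
      exact sign_ne_neg_self
        (((h.words γ hγ).full _).2 ⟨ha, hb, hab'⟩) (by simpa using h2.symm)
    have h3 := hL.wordSigns_of_mem hn (hL.mem_movePairs_trans hn hp hbcm hac')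
    rw [(hagree _ hac).1, (hagree _ hac).2] at h3
    exact sign_ne_neg_self hac h3

end AllowableGraphs

/-! ### Parallel classes and reduction to one representative per class. -/

section Transversals

variable {E : Type*}

/-- The elements of `D` fall into parallel classes for `G`: the sign at `p` is up to the factor
`ε p` the sign at the representative `r p` of the class of `p`, and `G` is connected by
reorientations of single classes. -/
structure IsTransversal (D : Set E) (G : Set (E → SignType)) (r : E → E) (ε : E → SignType) :
    Prop where
  supp : ∀ T ∈ G, ∀ p, T p ≠ 0 ↔ p ∈ D
  nonempty : G.Nonempty
  rep_mem : ∀ p ∈ D, r p ∈ D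
  rep_rep : ∀ p ∈ D, r (r p) = r p
  sign : ∀ T ∈ G, ∀ p ∈ D, T p = ε p * T (r p)
  flip : ∀ T ∈ G, ∀ T' ∈ G, T ≠ T' → ∃ c ∈ D, T (r c) ≠ T' (r c) ∧ ∃ T₁ ∈ G,
    ∀ q ∈ D, (r q = r c → T₁ q = -T q) ∧ (r q ≠ r c → T₁ q = T q)

/-- The representatives of the parallel classes. -/
def transversal (D : Set E) (r : E → E) : Set E :=
  {p | p ∈ D ∧ r p = p}

open Classical in
/-- The extension of a sign-vector from a transversal to the parallel classes. -/
noncomputable def classExtend (D : Set E) (r : E → E) (ε : E → SignType) (Y : E → SignType) :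
    E → SignType :=
  fun p => if p ∈ D then ε p * Y (r p) else 0

/-- The restriction of a sign-vector to a transversal. -/
noncomputable def classRestrict (D : Set E) (r : E → E) (Y : E → SignType) : E → SignType :=
  zeroOn (transversal D r)ᶜ Y

variable {D : Set E} {G : Set (E → SignType)} {r : E → E} {ε : E → SignType}

theorem classExtend_of_mem (Y : E → SignType) {p : E} (hp : p ∈ D) :
    classExtend D r ε Y p = ε p * Y (r p) := by
  simp [classExtend, hp]

theorem classExtend_of_notMem (Y : E → SignType) {p : E} (hp : p ∉ D) :
    classExtend D r ε Y p = 0 := by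
  simp [classExtend, hp]

theorem classRestrict_of_mem (Y : E → SignType) {p : E} (hp : p ∈ transversal D r) :
    classRestrict D r Y p = Y p := zeroOn_of_notMem fun h => h hp

theorem classRestrict_of_notMem (Y : E → SignType) {p : E} (hp : p ∉ transversal D r) :
    classRestrict D r Y p = 0 := zeroOn_of_mem hp

theorem classRestrict_neg (Y : E → SignType) : classRestrict D r (-Y) = -classRestrict D r Y :=
  zeroOn_neg _ _

theorem classRestrict_signComp (X Y : E → SignType) :
    classRestrict D r (signComp X Y) = signComp (classRestrict D r X) (classRestrict D r Y) :=
  zeroOn_signComp _ _ _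

theorem classExtend_neg (Y : E → SignType) : classExtend D r ε (-Y) = -classExtend D r ε Y := by
  funext p
  by_cases hp : p ∈ D <;> simp [classExtend, hp]

namespace IsTransversal

theorem rep_mem_transversal (h : IsTransversal D G r ε) {p : E} (hp : p ∈ D) :
    r p ∈ transversal D r := ⟨h.rep_mem p hp, h.rep_rep p hp⟩

theorem sign_ne_zero (h : IsTransversal D G r ε) {p : E} (hp : p ∈ D) : ε p ≠ 0 := by
  obtain ⟨T, hT⟩ := h.nonempty
  intro h0
  have := h.sign T hT p hp
  rw [h0, zero_mul] at this
  exact (h.supp T hT p).2 hp this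

theorem sign_eq_one (h : IsTransversal D G r ε) {p : E} (hp : p ∈ transversal D r) : ε p = 1 := by
  obtain ⟨T, hT⟩ := h.nonempty
  have h1 := h.sign T hT p hp.1
  rw [hp.2] at h1
  have h0 := (h.supp T hT p).2 hp.1
  revert h1 h0
  generalize T p = x
  generalize ε p = y
  revert x y
  decide

theorem extend_ne_zero_iff (h : IsTransversal D G r ε) (Y : E → SignType) {p : E} (hp : p ∈ D) :
    classExtend D r ε Y p ≠ 0 ↔ Y (r p) ≠ 0 := by
  rw [classExtend_of_mem Y hp]
  have := h.sign_ne_zero hp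
  simp [this]

theorem extend_signComp (h : IsTransversal D G r ε) (X Y : E → SignType) :
    classExtend D r ε (signComp X Y) = signComp (classExtend D r ε X) (classExtend D r ε Y) := by
  funext p
  by_cases hp : p ∈ D
  · by_cases hX : X (r p) = 0
    · rw [signComp_of_eq (X := classExtend D r ε X) (by rw [classExtend_of_mem X hp, hX, mul_zero]),
        classExtend_of_mem _ hp, classExtend_of_mem _ hp, signComp_of_eq hX]
    · rw [signComp_of_ne ((h.extend_ne_zero_iff X hp).2 hX),
        classExtend_of_mem _ hp, classExtend_of_mem _ hp, signComp_of_ne hX]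
  · simp [signComp, classExtend_of_notMem, hp]

theorem restrict_extend (h : IsTransversal D G r ε) {Y : E → SignType}
    (hY : ∀ p, Y p ≠ 0 → p ∈ transversal D r) : classRestrict D r (classExtend D r ε Y) = Y := by
  funext p
  by_cases hp : p ∈ transversal D r
  · rw [classRestrict_of_mem _ hp, classExtend_of_mem _ hp.1, h.sign_eq_one hp, one_mul, hp.2]
  · rw [classRestrict_of_notMem _ hp]
    by_contra h'
    exact hp (hY p (Ne.symm h'))

theorem extend_restrict (h : IsTransversal D G r ε) {T : E → SignType} (hT : T ∈ G) :
    classExtend D r ε (classRestrict D r T) = T := by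
  funext p
  by_cases hp : p ∈ D
  · rw [classExtend_of_mem _ hp, classRestrict_of_mem _ (h.rep_mem_transversal hp),
      ← h.sign T hT p hp]
  · rw [classExtend_of_notMem _ hp]
    by_contra h'
    exact hp ((h.supp T hT p).1 (Ne.symm h'))

theorem conf_extend (h : IsTransversal D G r ε) {X Y : E → SignType} (hXY : Conf X Y) :
    Conf (classExtend D r ε X) (classExtend D r ε Y) := by
  intro p hp
  by_cases hpD : p ∈ D
  · rw [classExtend_of_mem _ hpD, classExtend_of_mem _ hpD,
      hXY _ ((h.extend_ne_zero_iff X hpD).1 hp)]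
  · exact absurd (classExtend_of_notMem _ hpD) hp

theorem conf_restrict {X Y : E → SignType} (hXY : Conf X Y) :
    Conf (classRestrict D r X) (classRestrict D r Y) := by
  intro p hp
  by_cases hpD : p ∈ transversal D r
  · rw [classRestrict_of_mem _ hpD] at hp
    rw [classRestrict_of_mem _ hpD, classRestrict_of_mem _ hpD, hXY _ hp]
  · exact absurd (classRestrict_of_notMem _ hpD) hp

theorem restrict_supp (h : IsTransversal D G r ε) :
    ∀ T ∈ classRestrict D r '' G, ∀ p, T p ≠ 0 ↔ p ∈ transversal D r := by
  rintro _ ⟨T, hT, rfl⟩ p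
  by_cases hp : p ∈ transversal D r
  · rw [classRestrict_of_mem _ hp]
    exact ⟨fun _ => hp, fun _ => (h.supp T hT p).2 hp.1⟩
  · simp [classRestrict_of_notMem _ hp, hp]

theorem restrict_injOn (h : IsTransversal D G r ε) : Set.InjOn (classRestrict D r) G := by
  intro T hT T' hT' heq
  rw [← h.extend_restrict hT, heq, h.extend_restrict hT']

theorem isIsometric (h : IsTransversal D G r ε) :
    IsIsometric (transversal D r) (classRestrict D r '' G) where
  supp := h.restrict_supp
  nonempty := h.nonempty.image _
  flip := by
    rintro _ ⟨T, hT, rfl⟩ _ ⟨T', hT', rfl⟩ hne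
    obtain ⟨c, hc, hcne, T₁, hT₁, hT₁q⟩ := h.flip T hT T' hT' (fun h => hne (by rw [h]))
    have hrc := h.rep_mem_transversal hc
    refine ⟨r c, by rwa [classRestrict_of_mem _ hrc, classRestrict_of_mem _ hrc], T₁, hT₁, ?_⟩
    funext q
    by_cases hq : q ∈ transversal D r
    · rw [classRestrict_of_mem _ hq]
      by_cases hqc : q = r c
      · rw [hqc, flipAt_self, classRestrict_of_mem _ hrc, (hT₁q _ hrc.1).1 hrc.2]
      · rw [flipAt_of_ne _ hqc, classRestrict_of_mem _ hq, (hT₁q _ hq.1).2 (by rwa [hq.2])]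
    · have hqc : q ≠ r c := fun hqc => hq (hqc ▸ hrc)
      rw [classRestrict_of_notMem _ hq, flipAt_of_ne _ hqc, classRestrict_of_notMem _ hq]

/-- Both T and X∘(-T) obey the parallelism. If `X` vanished at exactly one of p and r p, passing
from T to X∘(-T) would change only one of the two signs. -/
theorem extend_restrict_of_isAntipodalFace (h : IsTransversal D G r ε) {X : E → SignType}
    (hX : IsAntipodalFace G X) : classExtend D r ε (classRestrict D r X) = X := by
  obtain ⟨⟨T, hT, hXT⟩, hanti⟩ := hX
  have hS := hanti T hT hXT
  funext p
  by_cases hp : p ∈ D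
  swap
  · rw [classExtend_of_notMem _ hp]
    by_contra h'
    exact hp ((h.supp T hT p).1 (by rw [hXT p (Ne.symm h')]; exact Ne.symm h'))
  have hr := h.rep_mem p hp
  have h1 := h.sign T hT p hp
  have h2 := h.sign _ hS p hp
  have hTr := (h.supp T hT _).2 hr
  rw [classExtend_of_mem _ hp, classRestrict_of_mem _ (h.rep_mem_transversal hp)]
  by_cases hXp : X p = 0
  · rw [signComp_of_eq hXp] at h2
    by_cases hXr : X (r p) = 0
    · rw [hXp, hXr, mul_zero]
    · rw [signComp_of_ne hXr, ← hXT _ hXr, ← h1] at h2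
      exact absurd h2.symm (sign_ne_neg_self ((h.supp T hT _).2 hp))
  · rw [signComp_of_ne hXp] at h2
    by_cases hXr : X (r p) = 0
    · rw [signComp_of_eq hXr, Pi.neg_apply, mul_neg, ← h1, ← hXT _ hXp] at h2
      exact absurd h2 (sign_ne_neg_self ((h.supp T hT _).2 hp))
    · rw [← hXT _ hXr, ← hXT _ hXp, ← h1]

theorem isAntipodalFace_restrict (h : IsTransversal D G r ε) {X : E → SignType}
    (hX : IsAntipodalFace G X) :
    IsAntipodalFace (classRestrict D r '' G) (classRestrict D r X) := by
  refine ⟨?_, ?_⟩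
  · obtain ⟨⟨T, hT, hXT⟩, -⟩ := hX
    exact ⟨_, ⟨T, hT, rfl⟩, conf_restrict hXT⟩
  · rintro _ ⟨T, hT, rfl⟩ hXT
    have := h.conf_extend hXT
    rw [h.extend_restrict_of_isAntipodalFace hX, h.extend_restrict hT] at this
    exact ⟨_, hX.2 T hT this, by rw [classRestrict_signComp, classRestrict_neg]⟩

/-- Restriction and extension are inverse to each other on antipodal faces and commute with
composition, so both sets have the same antipodal faces with the same action. -/
theorem antipodalGated_iff (h : IsTransversal D G r ε) :
    AntipodalGated (classRestrict D r '' G) ↔ AntipodalGated G := by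
  constructor
  · intro hA X hX
    have hgated := hA _ (h.isAntipodalFace_restrict hX)
    intro T hT
    have h1 := hgated _ ⟨T, hT, rfl⟩
    rw [← classRestrict_neg, ← classRestrict_signComp, ← classRestrict_signComp] at h1
    have key : ∀ S : E → SignType, classExtend D r ε (classRestrict D r S) = S →
        classRestrict D r (signComp X S) ∈ classRestrict D r '' G → signComp X S ∈ G := by
      rintro S hS ⟨T', hT', heq⟩
      have h2 := h.extend_restrict hT'
      rw [heq, classRestrict_signComp, h.extend_signComp,
        h.extend_restrict_of_isAntipodalFace hX, hS] at h2
      rwa [h2]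
    refine ⟨key T (h.extend_restrict hT) h1.1, key (-T) ?_ h1.2⟩
    rw [classRestrict_neg, classExtend_neg, h.extend_restrict hT]
  · intro hA X hX
    have hXR := isAntipodalFace_supp h.restrict_supp hX
    have hface : IsAntipodalFace G (classExtend D r ε X) := by
      refine ⟨?_, fun T hT hXT => ?_⟩
      · obtain ⟨⟨_, ⟨T, hT, rfl⟩, hXT⟩, -⟩ := hX
        exact ⟨T, hT, h.extend_restrict hT ▸ h.conf_extend hXT⟩
      · have h1 := conf_restrict (D := D) (r := r) hXT
        rw [h.restrict_extend hXR] at h1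
        obtain ⟨T', hT', heq⟩ := hX.2 _ ⟨T, hT, rfl⟩ h1
        have h2 := h.extend_restrict hT'
        rw [heq, h.extend_signComp, classExtend_neg, h.extend_restrict hT] at h2
        rwa [h2]
    rintro _ ⟨T, hT, rfl⟩
    have h1 := hA _ hface T hT
    rw [← classRestrict_neg]
    refine ⟨⟨_, h1.1, ?_⟩, ⟨_, h1.2, ?_⟩⟩ <;> rw [classRestrict_signComp, h.restrict_extend hXR]

/-- The gated covectors of a set of sign-vectors with parallel classes form a complex of oriented
matroids if its antipodal faces are gated. -/
theorem isCOM_gatedCovectors [Finite E] (h : IsTransversal D G r ε) (hA : AntipodalGated G) :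
    IsCOM (gatedCovectors G) := by
  have hcom := (isCOM_and_antipodalOfContraction _ _ h.isIsometric (h.antipodalGated_iff.2 hA)).1
  refine ⟨fun X hX Y hY => gatedCovectors_face hX hY, fun X hX Y hY e he => ?_⟩
  have hXf := isAntipodalFace_of_mem h.nonempty hX
  have hYf := isAntipodalFace_of_mem h.nonempty hY
  have hXr := h.antipodalGated_iff.2 hA _ (h.isAntipodalFace_restrict hXf)
  have hYr := h.antipodalGated_iff.2 hA _ (h.isAntipodalFace_restrict hYf)
  have hXe := h.extend_restrict_of_isAntipodalFace hXf
  have hYe := h.extend_restrict_of_isAntipodalFace hYf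
  have heD : e ∈ D := gatedCovectors_supp h.supp h.nonempty hX e he.1
  have hsep : ∀ f ∈ D, f ∈ sepSet X Y ↔
      r f ∈ sepSet (classRestrict D r X) (classRestrict D r Y) := by
    intro f hf
    have h0 := h.sign_ne_zero hf
    rw [mem_sepSet, mem_sepSet, ← hXe, ← hYe, classExtend_of_mem _ hf, classExtend_of_mem _ hf,
      hXe, hYe]
    generalize classRestrict D r X (r f) = x
    generalize classRestrict D r Y (r f) = y
    generalize ε f = z at h0
    revert x y z
    decide
  obtain ⟨Z, hZ, hZe, hZf⟩ := hcom.elim _ hXr _ hYr (r e) ((hsep e heD).1 he)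
  have hZface := isAntipodalFace_of_mem h.isIsometric.nonempty hZ
  have hZR := isAntipodalFace_supp h.restrict_supp hZface
  refine ⟨classExtend D r ε Z, ?_, by rw [classExtend_of_mem _ heD, hZe, mul_zero], ?_⟩
  · intro T hT
    have h1 := hZ _ ⟨T, hT, rfl⟩
    have key : ∀ S : E → SignType, classExtend D r ε (classRestrict D r S) = S →
        signComp Z (classRestrict D r S) ∈ classRestrict D r '' G →
          signComp (classExtend D r ε Z) S ∈ G := by
      rintro S hS ⟨T', hT', heq⟩
      have h2 := h.extend_restrict hT'
      rw [heq, h.extend_signComp, hS] at h2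
      rwa [h2]
    refine ⟨key T (h.extend_restrict hT) h1.1, key (-T) ?_ (by rw [classRestrict_neg]; exact h1.2)⟩
    rw [classRestrict_neg, classExtend_neg, h.extend_restrict hT]
  · intro f hf
    rw [← hXe, ← hYe, ← h.extend_signComp]
    by_cases hfD : f ∈ D
    · rw [classExtend_of_mem _ hfD, classExtend_of_mem _ hfD, hZf _ (mt (hsep f hfD).2 hf)]
    · rw [classExtend_of_notMem _ hfD, classExtend_of_notMem _ hfD]

end IsTransversal

end Transversals

/-! ### Moves of an allowable graph as parallel classes. -/

section AllowableTransversals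

variable {α : Type*} [LinearOrder α] {A : Set α} {P : Set (List α)} {M : Set (Set (List α))}

/-- In an allowable graph of permutations the pairs reversed by a move form a parallel class. -/
theorem IsAllowableGraph.exists_transversal (h : IsAllowableGraph A P M) (hne : P.Nonempty) :
    ∃ (r : α × α → α × α) (ε : α × α → SignType),
      IsTransversal (offPairs A) (wordSigns '' P) r ε ∧
      ∀ m ∈ M, ∀ p ∈ movePairs m, r p ∈ movePairs m ∧ ∀ q ∈ movePairs m, r p = r q := by
  classical
  choose! c hcM hc using fun p (hp : p ∈ offPairs A) => h.exists_move_mem hne hp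
  obtain ⟨w₀, hw₀⟩ := hne
  have hT₀ : wordSigns w₀ ∈ wordSigns '' P := ⟨w₀, hw₀, rfl⟩
  -- The representative is chosen from the set `movePairs (c p)` rather than from `p`, so equal sets
  -- give equal representatives.
  set r : α × α → α × α := fun p =>
    @Classical.epsilon _ ⟨p⟩ (fun q => q ∈ movePairs (c p)) with hr
  have hrc : ∀ p ∈ offPairs A, r p ∈ movePairs (c p) := fun p hp =>
    Classical.epsilon_spec (p := fun q => q ∈ movePairs (c p)) ⟨p, hc p hp⟩
  have hclass : ∀ m ∈ M, ∀ p ∈ movePairs m, movePairs (c p) = movePairs m := fun m hm p hp => by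
    have hpA := h.movePairs_subset hm hp
    exact h.movePairs_eq (hcM p hpA) hm (hc p hpA) hp
  have hconst : ∀ m ∈ M, ∀ p ∈ movePairs m, ∀ q ∈ movePairs m, r p = r q := by
    intro m hm p hp q hq
    simp only [hr, hclass m hm p hp, hclass m hm q hq]
  have hrm : ∀ m ∈ M, ∀ p ∈ movePairs m, r p ∈ movePairs m := fun m hm p hp => by
    rw [← hclass m hm p hp]
    exact hrc p (h.movePairs_subset hm hp)
  have hrA : ∀ p ∈ offPairs A, r p ∈ offPairs A := fun p hp =>
    h.movePairs_subset (hcM p hp) (hrc p hp)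
  -- The factor compares p with its representative in one fixed word; pairs of a class are reversed
  -- together, so it is the same in every word.
  refine ⟨r, fun p => wordSigns w₀ p * wordSigns w₀ (r p), ⟨h.supp, ⟨_, hT₀⟩, hrA, ?_, ?_, ?_⟩,
    fun m hm p hp => ⟨hrm m hm p hp, hconst m hm p hp⟩⟩
  · intro p hp
    exact hconst _ (hcM p hp) _ (hrc p hp) _ (hc p hp)
  · intro T hT p hp
    have h1 : T p ≠ wordSigns w₀ p → T (r p) ≠ wordSigns w₀ (r p) :=
      h.reversed_together (hcM p hp) (hc p hp) (hrc p hp) hT hT₀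
    have h2 : T (r p) ≠ wordSigns w₀ (r p) → T p ≠ wordSigns w₀ p :=
      h.reversed_together (hcM p hp) (hrc p hp) (hc p hp) hT hT₀
    have h3 := (h.supp T hT p).2 hp
    have h4 := (h.supp _ hT₀ p).2 hp
    have h5 := (h.supp T hT (r p)).2 (hrA p hp)
    have h6 := (h.supp _ hT₀ (r p)).2 (hrA p hp)
    revert h1 h2 h3 h4 h5 h6
    generalize T p = x
    generalize T (r p) = y
    generalize wordSigns w₀ p = z
    generalize wordSigns w₀ (r p) = u
    revert x y z u
    decide
  · rintro _ ⟨σ, hσ, rfl⟩ _ ⟨σ', hσ', rfl⟩ hne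
    obtain ⟨m, hm, γ, hγ, ⟨L, hL⟩, hsep⟩ := h.exists_first_move hσ hσ' (fun h => hne (by rw [h]))
    obtain ⟨p, hp⟩ := h.movePairs_nonempty hm
    refine ⟨p, h.movePairs_subset hm hp, (hsep _ (hrm m hm p hp)).symm, _, ⟨γ, hγ, rfl⟩, ?_⟩
    intro q hq
    refine ⟨fun hqp => hL.wordSigns_of_mem (h.words σ hσ).1 ?_, fun hqp =>
      hL.wordSigns_of_notMem (h.words σ hσ).1 fun hqm => hqp (hconst m hm q hqm p hp)⟩
    have h1 := hrc q hq
    rw [hqp] at h1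
    rw [h.movePairs_eq hm (hcM q hq) (hrm m hm p hp) h1]
    exact hc q hq

end AllowableTransversals

/-! ### Oriented matroids of weak orders and gated antipodal faces. -/

section SweepGraphs

variable {α : Type*}

/-- The signs of the words in `P` are the topes of an oriented matroid of weak orders. -/
def IsSweepGraph (A : Set α) (P : Set (List α)) : Prop :=
  ∃ ℒ : Set (α × α → SignType), IsOrientedMatroid ℒ ∧ (∀ X ∈ ℒ, IsWeakOrder A X) ∧
    fullTopes (offPairs A) ℒ = wordSigns '' P

theorem IsOrientedMatroid.isCOM {E : Type*} {L : Set (E → SignType)} (hL : IsOrientedMatroid L) :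
    IsCOM L where
  face X hX Y hY := hL.comp_mem X hX _ (hL.neg_mem Y hY)
  elim := hL.elim

/-- An antipodal face of the topes is a covector, and composition with a covector preserves topes.
-/
theorem IsSweepGraph.antipodalGated [Finite α] {A : Set α} {P : Set (List α)}
    (h : IsSweepGraph A P) : AntipodalGated (wordSigns '' P) := by
  obtain ⟨ℒ, hℒ, hweak, htope⟩ := h
  intro X hX
  rw [← htope] at hX ⊢
  have hXℒ := hℒ.isCOM.mem_of_isAntipodalFace _ (fun Z hZ => (hweak Z hZ).off) hX
  have key : ∀ T : α × α → SignType, T ∈ ℒ → (∀ e, T e ≠ 0 ↔ e ∈ offPairs A) →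
      signComp X T ∈ fullTopes (offPairs A) ℒ := by
    intro T hT hTf
    refine ⟨hℒ.comp_mem X hXℒ T hT, fun e => ?_⟩
    by_cases he : X e = 0
    · rw [signComp_of_eq he]; exact hTf e
    · rw [signComp_of_ne he]; exact ⟨(hweak X hXℒ).off e, fun _ => he⟩
  intro T hT
  exact ⟨key T hT.1 hT.2, key _ (hℒ.neg_mem T hT.1) fun e => by rw [← hT.2 e]; simp⟩

theorem fullTopes_gatedCovectors {E : Type*} {D : Set E} {G : Set (E → SignType)}
    (hG : ∀ T ∈ G, ∀ e, T e ≠ 0 ↔ e ∈ D) (hne : G.Nonempty) :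
    fullTopes D (gatedCovectors G) = G := by
  ext X
  constructor
  · rintro ⟨hX, hfull⟩
    obtain ⟨T, hT⟩ := hne
    have := (hX T hT).1
    rwa [signComp_eq_of_full hfull (hG T hT)] at this
  · exact fun hX => ⟨mem_gatedCovectors_of_mem hG hX, hG X hX⟩

/-- The oriented matroid consists of the gated covectors. Zero is one of them, and they are closed
under negation, because (P1) makes the set of topes antipodal; elimination holds by
`IsTransversal.isCOM_gatedCovectors`. -/
theorem IsAllowableGraph.isSweepGraph [LinearOrder α] [Finite α] {A : Set α} {P : Set (List α)}
    {M : Set (Set (List α))} (h : IsAllowableGraph A P M) (hne : P.Nonempty)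
    (hA : AntipodalGated (wordSigns '' P)) : IsSweepGraph A P := by
  obtain ⟨r, ε, hr, -⟩ := h.exists_transversal hne
  refine ⟨gatedCovectors (wordSigns '' P), ⟨?_, ?_, ?_, ?_⟩, ?_, ?_⟩
  · intro T hT
    have key : ∀ T : α × α → SignType, signComp (fun _ => 0) T = T := fun T => by
      funext e; simp [signComp]
    rw [key, key]
    exact ⟨hT, h.neg_mem hT⟩
  · intro X hX T hT
    change signComp (-X) T ∈ _ ∧ signComp (-X) (-T) ∈ _
    rw [← neg_signComp]
    have h1 := h.neg_mem (hX T hT).2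
    rw [neg_signComp, neg_neg] at h1
    exact ⟨h1, h.neg_mem (hX T hT).1⟩
  · exact fun X hX Y hY => gatedCovectors_comp hX hY
  · exact (hr.isCOM_gatedCovectors hA).elim
  · exact fun X hX => h.isWeakOrder (isAntipodalFace_of_mem (hne.image _) hX)
  · exact fullTopes_gatedCovectors h.supp (hne.image _)

end SweepGraphs

/-! ### Translation between pairs i < j with braid covectors and ordered pairs with weak orders. -/

section BraidCovectors

variable {n : ℕ}

/-- The extension of a sign-vector on the pairs `i < j` to all pairs. -/
def pairExtend (X : Pairs n → SignType) : Fin n × Fin n → SignType := fun p =>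
  if h : p.1 < p.2 then X ⟨p, h⟩ else if h : p.2 < p.1 then -X ⟨(p.2, p.1), h⟩ else 0

/-- The restriction of a sign-vector to the pairs `i < j`. -/
def pairRestrict (Y : Fin n × Fin n → SignType) : Pairs n → SignType := fun p => Y p.1

theorem pairExtend_of_lt (X : Pairs n → SignType) {a b : Fin n} (h : a < b) :
    pairExtend X (a, b) = X ⟨(a, b), h⟩ := by
  simp [pairExtend, h]

theorem pairRestrict_extend (X : Pairs n → SignType) : pairRestrict (pairExtend X) = X := by
  funext ⟨p, h⟩
  exact pairExtend_of_lt X h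

theorem pairExtend_antisymm (X : Pairs n → SignType) (a b : Fin n) :
    pairExtend X (b, a) = -pairExtend X (a, b) := by
  rcases lt_trichotomy a b with h | rfl | h
  · simp [pairExtend, h, h.not_gt]
  · simp [pairExtend]
  · simp [pairExtend, h, h.not_gt]

theorem eq_of_pairRestrict_eq {Y Y' : Fin n × Fin n → SignType}
    (hY : ∀ a b, Y (b, a) = -Y (a, b)) (hY' : ∀ a b, Y' (b, a) = -Y' (a, b))
    (h : ∀ a b, a < b → Y (a, b) = Y' (a, b)) : Y = Y' := by
  have hdiag : ∀ x : SignType, x = -x → x = 0 := by decide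
  funext ⟨a, b⟩
  rcases lt_trichotomy a b with hab | rfl | hab
  · exact h a b hab
  · rw [hdiag _ (hY a a), hdiag _ (hY' a a)]
  · rw [hY, hY', h b a hab]

theorem signComp_antisymm {α : Type*} {X Y : α × α → SignType} (hX : ∀ a b, X (b, a) = -X (a, b))
    (hY : ∀ a b, Y (b, a) = -Y (a, b)) (a b : α) :
    signComp X Y (b, a) = -signComp X Y (a, b) := by
  unfold signComp
  rw [hX a b, hY a b]
  by_cases h : X (a, b) = 0 <;> simp [h]

theorem pairExtend_restrict {Y : Fin n × Fin n → SignType} (hY : ∀ a b, Y (b, a) = -Y (a, b)) :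
    pairExtend (pairRestrict Y) = Y :=
  eq_of_pairRestrict_eq (pairExtend_antisymm _) hY fun _ _ h => pairExtend_of_lt _ h

theorem pairExtend_signComp (X Y : Pairs n → SignType) :
    pairExtend (signComp X Y) = signComp (pairExtend X) (pairExtend Y) :=
  eq_of_pairRestrict_eq (pairExtend_antisymm _)
    (signComp_antisymm (pairExtend_antisymm X) (pairExtend_antisymm Y)) fun a b h => by
      unfold signComp
      rw [pairExtend_of_lt _ h, pairExtend_of_lt _ h, pairExtend_of_lt _ h]

theorem mem_braidCovectors_iff {X : Pairs n → SignType} :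
    X ∈ braidCovectors n ↔ ∃ u : Fin n → ℝ, ∀ p, X p = SignType.sign (u p.1.2 - u p.1.1) := by
  unfold braidCovectors vectorCovectors
  simp [dotProduct_sub]

theorem isWeakOrder_sign_sub {α : Type*} (u : α → ℝ) :
    IsWeakOrder Set.univ fun p : α × α => SignType.sign (u p.2 - u p.1) where
  off p hp := ⟨trivial, trivial, fun h => hp (by simp [h])⟩
  antisymm a b := by
    rw [← Left.sign_neg, neg_sub]
  trans a b c h h' := by
    simp only [sign_eq_one_iff] at *
    linarith
  zero a _ b _ h c := by
    have : u a = u b := by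
      rw [sign_eq_zero_iff] at h
      linarith
    simp only [this]

/-- The rank function of a weak order. -/
theorem IsWeakOrder.exists_sign_sub {α : Type*} [Finite α] {A : Set α} {X : α × α → SignType}
    (hX : IsWeakOrder A X) :
    ∃ u : α → ℝ, ∀ a ∈ A, ∀ b ∈ A, X (a, b) = SignType.sign (u b - u a) := by
  -- The rank of a is the number of letters strictly before a.
  refine ⟨fun a => ({c | X (c, a) = 1} : Set α).ncard, ?_⟩
  have hlt : ∀ a b, X (a, b) = 1 →
      ({c | X (c, a) = 1} : Set α).ncard < ({c | X (c, b) = 1} : Set α).ncard := by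
    intro a b hab
    refine Set.ncard_lt_ncard ⟨fun c hc => hX.trans c a b hc hab, fun hsub => ?_⟩ (Set.toFinite _)
    have h1 : X (a, a) = 1 := hsub hab
    have h2 := hX.antisymm a a
    rw [h1] at h2
    exact absurd h2 (by decide)
  intro a ha b hb
  beta_reduce
  rcases SignType.trichotomy (X (a, b)) with h | h | h
  · have := hlt b a (by rw [hX.antisymm a b, h]; rfl)
    rw [h, eq_comm, sign_eq_neg_one_iff, sub_neg]
    exact_mod_cast this
  · have : ({c | X (c, a) = 1} : Set α) = {c | X (c, b) = 1} := by
      ext c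
      have h1 := hX.zero a ha b hb h c
      change X (c, a) = 1 ↔ X (c, b) = 1
      rw [hX.antisymm a c, hX.antisymm b c, h1]
    rw [h, this, sub_self, sign_zero]
  · have := hlt a b h
    rw [h, eq_comm, sign_eq_one_iff, sub_pos]
    exact_mod_cast this

theorem pair_sublist_ofFn_iff (σ : Equiv.Perm (Fin n)) (a b : Fin n) :
    [a, b].Sublist (List.ofFn fun k => σ k) ↔ σ.symm a < σ.symm b := by
  have hlt : ∀ a b, [a, b].Sublist (List.ofFn fun k => σ k) → σ.symm a < σ.symm b := by
    have : (List.ofFn fun k => σ k).Pairwise fun a b => σ.symm a < σ.symm b :=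
      List.pairwise_ofFn.2 fun i j hij => by simpa using hij
    exact fun a b hab => List.pairwise_iff_forall_sublist.1 this hab
  refine ⟨hlt a b, fun h => ?_⟩
  have hmem : ∀ a, a ∈ List.ofFn fun k => σ k := fun a => by
    rw [List.mem_ofFn]; exact ⟨σ.symm a, by simp⟩
  have hab : a ≠ b := by rintro rfl; exact h.false
  exact (pair_sublist_total (hmem a) (hmem b) hab).resolve_right fun h' => (hlt b a h').asymm h

theorem isWordOn_ofFn (σ : Equiv.Perm (Fin n)) :
    IsWordOn Set.univ (List.ofFn fun k => σ k) :=
  ⟨List.nodup_ofFn.2 σ.injective, fun a => by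
    rw [List.mem_ofFn]; exact ⟨fun _ => trivial, fun _ => ⟨σ.symm a, by simp⟩⟩⟩

theorem wordSigns_ofFn (σ : Equiv.Perm (Fin n)) :
    wordSigns (List.ofFn fun k => σ k) = pairExtend (signVector σ) := by
  refine eq_of_pairRestrict_eq (wordSigns_antisymm (isWordOn_ofFn σ).1) (pairExtend_antisymm _)
    fun a b hab => ?_
  rw [pairExtend_of_lt _ hab]
  unfold wordSigns signVector
  simp only [pair_sublist_ofFn_iff]
  split_ifs with h1 h2
  · rfl
  · rfl
  · exact absurd (σ.symm.injective (le_antisymm (not_lt.1 h2) (not_lt.1 h1))) hab.ne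

theorem wordSigns_image_permWords (P : Set (Equiv.Perm (Fin n))) :
    wordSigns '' permWords P = pairExtend '' (signVector '' P) := by
  unfold permWords
  rw [Set.image_image, Set.image_image]
  exact Set.image_congr fun σ _ => wordSigns_ofFn σ

theorem signVector_ne_zero (σ : Equiv.Perm (Fin n)) (p : Pairs n) : signVector σ p ≠ 0 := by
  unfold signVector
  split_ifs <;> decide

theorem mem_offPairs_of_lt {a b : Fin n} (h : a < b) : (a, b) ∈ offPairs (Set.univ : Set (Fin n)) :=
  ⟨trivial, trivial, h.ne⟩

/-- Antisymmetric extension carries the axioms over, and a braid covector given by u becomes the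
weak order by the values of u. -/
theorem isSweepGraph_of_arises {P : Set (Equiv.Perm (Fin n))}
    (h : ArisesFromSweepOrientedMatroid P) : IsSweepGraph Set.univ (permWords P) := by
  obtain ⟨L, ⟨hL, hbraid⟩, htope⟩ := h
  refine ⟨pairExtend '' L, ⟨⟨_, hL.zero_mem, ?_⟩, ?_, ?_, ?_⟩, ?_, ?_⟩
  · funext p
    simp [pairExtend]
  · rintro _ ⟨X, hX, rfl⟩
    refine ⟨_, hL.neg_mem X hX, ?_⟩
    funext p
    unfold pairExtend
    split_ifs <;> simp
  · rintro _ ⟨X, hX, rfl⟩ _ ⟨Y, hY, rfl⟩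
    exact ⟨_, hL.comp_mem X hX Y hY, pairExtend_signComp X Y⟩
  · rintro _ ⟨X, hX, rfl⟩ _ ⟨Y, hY, rfl⟩ ⟨a, b⟩ he
    have hswap : ∀ a b, (a, b) ∈ sepSet (pairExtend X) (pairExtend Y) →
        (b, a) ∈ sepSet (pairExtend X) (pairExtend Y) := by
      intro a b h
      rw [mem_sepSet] at h ⊢
      rw [pairExtend_antisymm X a b, pairExtend_antisymm Y a b, h.2]
      exact ⟨by simpa using h.1, rfl⟩
    have key : ∀ a b, a < b → (a, b) ∈ sepSet (pairExtend X) (pairExtend Y) →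
        ∃ Z ∈ pairExtend '' L, Z (a, b) = 0 ∧
          ∀ f, f ∉ sepSet (pairExtend X) (pairExtend Y) →
            Z f = signComp (pairExtend X) (pairExtend Y) f := by
      intro a b hab he
      rw [mem_sepSet, pairExtend_of_lt _ hab, pairExtend_of_lt _ hab] at he
      obtain ⟨Z, hZ, hZe, hZf⟩ := hL.elim X hX Y hY _ he
      refine ⟨_, ⟨Z, hZ, rfl⟩, by rw [pairExtend_of_lt _ hab, hZe], ?_⟩
      have key' : ∀ c d, c < d → (c, d) ∉ sepSet (pairExtend X) (pairExtend Y) →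
          pairExtend Z (c, d) = signComp (pairExtend X) (pairExtend Y) (c, d) := by
        intro c d hcd hf
        rw [← pairExtend_signComp, pairExtend_of_lt _ hcd, pairExtend_of_lt _ hcd]
        apply hZf
        rwa [mem_sepSet, pairExtend_of_lt _ hcd, pairExtend_of_lt _ hcd] at hf
      rintro ⟨c, d⟩ hf
      rcases lt_trichotomy c d with hcd | rfl | hcd
      · exact key' c d hcd hf
      · simp [signComp, pairExtend]
      · rw [pairExtend_antisymm Z d c, key' d c hcd fun h => hf (hswap _ _ h),
          ← pairExtend_signComp, ← pairExtend_antisymm]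
    rcases lt_trichotomy a b with hab | rfl | hab
    · exact key a b hab he
    · exact absurd (by simp [pairExtend]) he.1
    · obtain ⟨Z, hZ, hZe, hZf⟩ := key b a hab (hswap _ _ he)
      refine ⟨Z, hZ, ?_, hZf⟩
      obtain ⟨Z, -, rfl⟩ := hZ
      rw [pairExtend_antisymm, hZe]; rfl
  · rintro _ ⟨X, hX, rfl⟩
    obtain ⟨u, hu⟩ := mem_braidCovectors_iff.1 (hbraid hX)
    have hw := isWeakOrder_sign_sub u
    convert hw using 1
    refine eq_of_pairRestrict_eq (pairExtend_antisymm _) hw.antisymm fun a b hab => ?_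
    rw [pairExtend_of_lt _ hab, hu]
  · rw [wordSigns_image_permWords, ← htope]
    ext T
    constructor
    · rintro ⟨⟨X, hX, rfl⟩, hfull⟩
      refine ⟨X, ⟨hX, fun Y hY hXY => ?_⟩, rfl⟩
      funext ⟨p, hp⟩
      refine ((hXY ⟨p, hp⟩).resolve_left ?_).symm
      have := (hfull p).2 (mem_offPairs_of_lt hp)
      rwa [show p = (p.1, p.2) from rfl, pairExtend_of_lt _ hp] at this
    · rintro ⟨X, hX, rfl⟩
      refine ⟨⟨X, hX.1, rfl⟩, ?_⟩
      rw [htope] at hX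
      obtain ⟨σ, hσ, rfl⟩ := hX
      rw [← wordSigns_ofFn]
      exact (isWordOn_ofFn σ).full

theorem arises_of_isSweepGraph {P : Set (Equiv.Perm (Fin n))} (hne : P.Nonempty)
    (h : IsSweepGraph Set.univ (permWords P)) : ArisesFromSweepOrientedMatroid P := by
  obtain ⟨ℒ, hℒ, hweak, htope⟩ := h
  rw [wordSigns_image_permWords] at htope
  refine ⟨{X | pairExtend X ∈ ℒ}, ⟨⟨?_, ?_, ?_, ?_⟩, ?_⟩, ?_⟩
  · change pairExtend _ ∈ ℒ
    convert hℒ.zero_mem using 1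
    funext p
    simp [pairExtend]
  · intro X hX
    change pairExtend _ ∈ ℒ
    convert hℒ.neg_mem _ hX using 1
    funext p
    unfold pairExtend
    split_ifs <;> simp
  · intro X hX Y hY
    change pairExtend _ ∈ ℒ
    rw [pairExtend_signComp]
    exact hℒ.comp_mem _ hX _ hY
  · rintro X hX Y hY ⟨⟨a, b⟩, hab⟩ he
    obtain ⟨Z, hZ, hZe, hZf⟩ := hℒ.elim _ hX _ hY (a, b) (by
      rw [mem_sepSet, pairExtend_of_lt _ hab, pairExtend_of_lt _ hab]; exact he)
    refine ⟨pairRestrict Z, ?_, hZe, ?_⟩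
    · change pairExtend _ ∈ ℒ
      rwa [pairExtend_restrict (hweak Z hZ).antisymm]
    · rintro ⟨⟨c, d⟩, hcd⟩ hf
      change Z (c, d) = _
      rw [hZf (c, d) (by rwa [mem_sepSet, pairExtend_of_lt _ hcd, pairExtend_of_lt _ hcd]),
        ← pairExtend_signComp, pairExtend_of_lt _ hcd]
  · intro X hX
    obtain ⟨u, hu⟩ := (hweak _ hX).exists_sign_sub
    refine mem_braidCovectors_iff.2 ⟨u, fun ⟨⟨a, b⟩, hab⟩ => ?_⟩
    rw [← hu a trivial b trivial, pairExtend_of_lt _ hab]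
  · have hmem : ∀ σ ∈ P, pairExtend (signVector σ) ∈ fullTopes (offPairs Set.univ) ℒ := by
      intro σ hσ
      rw [htope]
      exact ⟨_, ⟨σ, hσ, rfl⟩, rfl⟩
    ext X
    constructor
    · rintro ⟨hX, hmax⟩
      obtain ⟨σ, hσ⟩ := hne
      -- A maximal covector equals its composition with the sign-vector of σ, so it has no zeros.
      -- This is where non-emptiness of `P` enters: it makes maximal covectors the same as covectors
      -- of full support.
      have h1 := hmax (signComp X (signVector σ)) (by
        change pairExtend _ ∈ ℒ
        rw [pairExtend_signComp]
        exact hℒ.comp_mem _ hX _ (hmem σ hσ).1) (fun e => by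
          by_cases he : X e = 0
          · exact Or.inl he
          · exact Or.inr (signComp_of_ne he).symm)
      have hX0 : ∀ p, X p ≠ 0 := fun p hp => by
        have h2 := congrFun h1 p
        rw [signComp_of_eq hp, hp] at h2
        exact signVector_ne_zero σ p h2
      have hfull : pairExtend X ∈ fullTopes (offPairs Set.univ) ℒ := by
        refine ⟨hX, fun ⟨a, b⟩ => ⟨(hweak _ hX).off _, fun h => ?_⟩⟩
        rcases lt_or_gt_of_ne (show a ≠ b from h.2.2) with hab | hab
        · rw [pairExtend_of_lt _ hab]; exact hX0 _
        · rw [pairExtend_antisymm X b a, pairExtend_of_lt _ hab]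
          simpa using hX0 _
      rw [htope] at hfull
      obtain ⟨_, ⟨τ, hτ, rfl⟩, heq⟩ := hfull
      refine ⟨τ, hτ, ?_⟩
      rw [← pairRestrict_extend (signVector τ), heq, pairRestrict_extend]
    · rintro ⟨σ, hσ, rfl⟩
      refine ⟨(hmem σ hσ).1, fun Y _ hY => ?_⟩
      funext p
      exact ((hY p).resolve_left (signVector_ne_zero σ p)).symm

end BraidCovectors

/-! ### Ordered partitions as weak orders, and their composition with words. -/

section OrderedPartitions

variable {α : Type*}

theorem pair_sublist_map {β : Type*} {f : α → β} {x y : β} {l : List α} :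
    [x, y].Sublist (l.map f) ↔ ∃ a b, [a, b].Sublist l ∧ f a = x ∧ f b = y := by
  rw [List.sublist_map_iff]
  constructor
  · rintro ⟨l', hl', heq⟩
    match l', heq with
    | [a, b], heq =>
      simp only [List.map_cons, List.map_nil, List.cons.injEq, and_true] at heq
      exact ⟨a, b, hl', heq.1.symm, heq.2.symm⟩
  · rintro ⟨a, b, h, rfl, rfl⟩
    exact ⟨[a, b], h, rfl⟩

theorem pair_sublist_filter {p : α → Bool} {a b : α} {l : List α} :
    [a, b].Sublist (l.filter p) ↔ [a, b].Sublist l ∧ p a ∧ p b := by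
  constructor
  · intro h
    have hm := mem_of_pair_sublist h
    exact ⟨h.trans List.filter_sublist, (List.mem_filter.1 hm.1).2, (List.mem_filter.1 hm.2).2⟩
  · rintro ⟨h, ha, hb⟩
    have := h.filter p
    simpa [ha, hb] using this

/-- `I` is an ordered partition of `A`. -/
structure IsPartitionOf (A : Set α) (I : List (Finset α)) : Prop where
  nonempty : ∀ B ∈ I, B.Nonempty
  disjoint : I.Pairwise Disjoint
  cover : ∀ a, a ∈ A ↔ ∃ B ∈ I, a ∈ B

theorem isPartitionOf_univ_iff {I : List (Finset α)} :
    IsPartitionOf Set.univ I ↔ IsOrderedPartition I :=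
  ⟨fun h => ⟨h.1, h.2, fun a => (h.3 a).1 trivial⟩,
    fun h => ⟨h.1, h.2.1, fun a => ⟨fun _ => h.2.2 a, fun _ => trivial⟩⟩⟩

open Classical in
/-- The sign-vector of an ordered partition. -/
noncomputable def partSigns (I : List (Finset α)) : α × α → SignType := fun p =>
  if ∃ B B', [B, B'].Sublist I ∧ p.1 ∈ B ∧ p.2 ∈ B' then 1
  else if ∃ B B', [B, B'].Sublist I ∧ p.2 ∈ B ∧ p.1 ∈ B' then -1 else 0

theorem partSigns_eq_one_iff {I : List (Finset α)} {a b : α} :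
    partSigns I (a, b) = 1 ↔ ∃ B B', [B, B'].Sublist I ∧ a ∈ B ∧ b ∈ B' := by
  unfold partSigns
  split_ifs with h h' <;> simp [h]

namespace IsPartitionOf

variable {A : Set α} {I : List (Finset α)}

theorem block_eq (h : IsPartitionOf A I) {B B' : Finset α} (hB : B ∈ I) (hB' : B' ∈ I) {a : α}
    (ha : a ∈ B) (ha' : a ∈ B') : B = B' := by
  by_contra hne
  rcases pair_sublist_total hB hB' hne with h' | h'
  · exact Finset.disjoint_left.1 (List.pairwise_iff_forall_sublist.1 h.disjoint h') ha ha'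
  · exact Finset.disjoint_left.1 (List.pairwise_iff_forall_sublist.1 h.disjoint h') ha' ha

theorem nodup (h : IsPartitionOf A I) : I.Nodup := by
  rw [List.nodup_iff_pairwise_ne, List.pairwise_iff_forall_sublist]
  rintro B B' hBB rfl
  obtain ⟨a, ha⟩ := h.nonempty B (mem_of_pair_sublist hBB).1
  exact Finset.disjoint_left.1 (List.pairwise_iff_forall_sublist.1 h.disjoint hBB) ha ha

theorem asymm (h : IsPartitionOf A I) {a b : α} (hab : partSigns I (a, b) = 1) :
    partSigns I (b, a) ≠ 1 := by
  rw [ne_eq, partSigns_eq_one_iff]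
  obtain ⟨B, B', hBB, ha, hb⟩ := partSigns_eq_one_iff.1 hab
  rintro ⟨C, C', hCC, hb', ha'⟩
  obtain rfl := h.block_eq (mem_of_pair_sublist hBB).1 (mem_of_pair_sublist hCC).2 ha ha'
  obtain rfl := h.block_eq (mem_of_pair_sublist hBB).2 (mem_of_pair_sublist hCC).1 hb hb'
  exact pair_sublist_asymm h.nodup hBB hCC

theorem antisymm (h : IsPartitionOf A I) (a b : α) :
    partSigns I (b, a) = -partSigns I (a, b) := by
  by_cases hab : partSigns I (a, b) = 1
  · have h1 := h.asymm hab
    rw [partSigns_eq_one_iff] at hab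
    rw [ne_eq, partSigns_eq_one_iff] at h1
    simp [partSigns, hab, h1]
  · rw [partSigns_eq_one_iff] at hab
    unfold partSigns
    rw [if_neg hab]
    split_ifs <;> simp

theorem mem_of_partSigns_ne_zero (h : IsPartitionOf A I) {a b : α} (hab : partSigns I (a, b) ≠ 0) :
    a ∈ A ∧ b ∈ A := by
  have key : ∀ a b, partSigns I (a, b) = 1 → a ∈ A ∧ b ∈ A := by
    intro a b hab
    obtain ⟨B, B', hBB, ha, hb⟩ := partSigns_eq_one_iff.1 hab
    have := mem_of_pair_sublist hBB
    exact ⟨(h.cover a).2 ⟨B, this.1, ha⟩, (h.cover b).2 ⟨B', this.2, hb⟩⟩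
  rcases SignType.trichotomy (partSigns I (a, b)) with h' | h' | h'
  · exact (key b a (by rw [h.antisymm a b, h']; rfl)).symm
  · exact absurd h' hab
  · exact key a b h'

theorem exists_block (h : IsPartitionOf A I) {a b : α} (ha : a ∈ A) (hb : b ∈ A)
    (hab : partSigns I (a, b) = 0) : ∃ B ∈ I, a ∈ B ∧ b ∈ B := by
  obtain ⟨B, hB, ha⟩ := (h.cover a).1 ha
  obtain ⟨B', hB', hb⟩ := (h.cover b).1 hb
  by_cases hBB : B = B'
  · exact ⟨B, hB, ha, hBB ▸ hb⟩
  · exfalso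
    rcases pair_sublist_total hB hB' hBB with h' | h'
    · rw [partSigns_eq_one_iff.2 ⟨B, B', h', ha, hb⟩] at hab
      exact absurd hab (by decide)
    · rw [h.antisymm b a, partSigns_eq_one_iff.2 ⟨B', B, h', hb, ha⟩] at hab
      exact absurd hab (by decide)

theorem partSigns_of_block (h : IsPartitionOf A I) {a b : α} {B : Finset α} (hB : B ∈ I)
    (ha : a ∈ B) (hb : b ∈ B) : partSigns I (a, b) = 0 := by
  have key : ∀ a b, a ∈ B → b ∈ B → partSigns I (a, b) ≠ 1 := by
    intro a b ha hb h'
    obtain ⟨C, C', hCC, ha', hb'⟩ := partSigns_eq_one_iff.1 h'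
    have hm := mem_of_pair_sublist hCC
    obtain rfl := h.block_eq hB hm.1 ha ha'
    obtain rfl := h.block_eq hB hm.2 hb hb'
    exact ne_of_pair_sublist h.nodup hCC rfl
  rcases SignType.trichotomy (partSigns I (a, b)) with h' | h' | h'
  · exact absurd (by rw [h.antisymm a b, h']; rfl) (key b a hb ha)
  · exact h'
  · exact absurd h' (key a b ha hb)

end IsPartitionOf

/-- Every weak order is given by an ordered partition. -/
theorem IsWeakOrder.exists_isPartitionOf [Finite α] {A : Set α} {X : α × α → SignType}
    (hX : IsWeakOrder A X) : ∃ I, IsPartitionOf A I ∧ partSigns I = X := by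
  classical
  have := Fintype.ofFinite α
  obtain ⟨u, hu⟩ := hX.exists_sign_sub
  set F : ℝ → Finset α := fun x => A.toFinset.filter (u · = x)
  have hF : ∀ a x, a ∈ F x ↔ a ∈ A ∧ u a = x := fun a x => by simp [F]
  -- The parts are the level sets of the rank function, in increasing order of its values.
  set S := A.toFinset.image u
  have hS : ∀ x, x ∈ S.sort ↔ ∃ a ∈ A, u a = x := fun x => by simp [S]
  have hlt : ∀ x y, [x, y].Sublist S.sort → x < y :=
    fun x y h => List.pairwise_iff_forall_sublist.1 (Finset.sortedLT_sort S).pairwise h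
  have hpart : IsPartitionOf A (S.sort.map F) := by
    refine ⟨?_, ?_, ?_⟩
    · intro B hB
      obtain ⟨x, hx, rfl⟩ := List.mem_map.1 hB
      obtain ⟨a, ha, hax⟩ := (hS x).1 hx
      exact ⟨a, (hF a x).2 ⟨ha, hax⟩⟩
    · rw [List.pairwise_map]
      refine (Finset.sortedLT_sort S).pairwise.imp fun {x y} hxy => Finset.disjoint_left.2 ?_
      intro a ha hb
      exact hxy.ne (((hF a x).1 ha).2.symm.trans ((hF a y).1 hb).2)
    · intro a
      constructor
      · intro ha
        exact ⟨F (u a), List.mem_map.2 ⟨u a, (hS _).2 ⟨a, ha, rfl⟩, rfl⟩, (hF _ _).2 ⟨ha, rfl⟩⟩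
      · rintro ⟨B, hB, ha⟩
        obtain ⟨x, -, rfl⟩ := List.mem_map.1 hB
        exact ((hF a x).1 ha).1
  refine ⟨_, hpart, ?_⟩
  have key : ∀ a b, partSigns (S.sort.map F) (a, b) = 1 ↔ X (a, b) = 1 := by
    intro a b
    rw [partSigns_eq_one_iff]
    constructor
    · rintro ⟨B, B', hBB, ha, hb⟩
      obtain ⟨x, y, hxy, rfl, rfl⟩ := pair_sublist_map.1 hBB
      have ha := (hF a x).1 ha
      have hb := (hF b y).1 hb
      rw [hu a ha.1 b hb.1, ha.2, hb.2, sign_eq_one_iff, sub_pos]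
      exact hlt x y hxy
    · intro h
      have hab := hX.off (a, b) (by rw [h]; decide)
      have ha : a ∈ A := hab.1
      have hb : b ∈ A := hab.2.1
      rw [hu a ha b hb, sign_eq_one_iff, sub_pos] at h
      refine ⟨F (u a), F (u b), pair_sublist_map.2 ⟨_, _, ?_, rfl, rfl⟩,
        (hF _ _).2 ⟨ha, rfl⟩, (hF _ _).2 ⟨hb, rfl⟩⟩
      exact (pair_sublist_total ((hS _).2 ⟨a, ha, rfl⟩) ((hS _).2 ⟨b, hb, rfl⟩)
        h.ne).resolve_right fun h' => (hlt _ _ h').asymm h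
  funext ⟨a, b⟩
  exact sign_eq_of_eq_one_iff (hpart.antisymm a b) (hX.antisymm a b) (key a b) (key b a)

theorem wordSigns_mem_image_iff {P : Set (List α)} {A : Set α} (hP : ∀ w ∈ P, IsWordOn A w) {w : List α}
    (hw : IsWordOn A w) : wordSigns w ∈ wordSigns '' P ↔ w ∈ P := by
  constructor
  · rintro ⟨w', hw', heq⟩
    rwa [← (hP w' hw').ext hw heq]
  · exact fun h => ⟨w, h, rfl⟩

/-! ### Composition of ordered partitions and words -/

theorem singletons_injective : Function.Injective (singletons (α := α)) :=
  List.map_injective_iff.2 Finset.singleton_injective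

variable [LinearOrder α]

/-- The blocks of the word `w` cut out by the ordered partition `I`. -/
def lexBlocks (I : List (Finset α)) (w : List α) : List (List α) :=
  I.map fun B => w.filter (· ∈ B)

/-- The composition of an ordered partition and a word. -/
def lex (I : List (Finset α)) (w : List α) : List α :=
  (lexBlocks I w).flatten

theorem comp_singletons (I : List (Finset α)) (w : List α) :
    comp I (singletons w) = singletons (lex I w) := by
  have key : ∀ B : Finset α, ((singletons w).map (B ∩ ·)).filter (· ≠ ∅) =
      singletons (w.filter (· ∈ B)) := by
    intro B
    induction w with
    | nil => rfl
    | cons a w ih =>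
      unfold singletons at ih ⊢
      by_cases ha : a ∈ B
      · rw [List.map_cons, List.map_cons, List.filter_cons_of_pos (by simp [ha]),
          List.filter_cons_of_pos (by simp [ha]), List.map_cons, ih]
        simp [ha]
      · rw [List.map_cons, List.map_cons, List.filter_cons_of_neg (by simp [ha]),
          List.filter_cons_of_neg (by simp [ha]), ih]
  unfold comp lex lexBlocks
  simp only [key]
  unfold singletons
  rw [List.map_flatten, List.map_map, List.flatMap_def]
  rfl

theorem mem_lexBlocks {I : List (Finset α)} {w b : List α} :
    b ∈ lexBlocks I w ↔ ∃ B ∈ I, w.filter (· ∈ B) = b := List.mem_map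

theorem lexBlocks_reverse (I : List (Finset α)) (w : List α) :
    (lexBlocks I w).map List.reverse = lexBlocks I w.reverse := by
  simp [lexBlocks]

theorem pair_sublist_lex {I : List (Finset α)} {w : List α} {a b : α} :
    [a, b].Sublist (lex I w) ↔ ([a, b].Sublist w ∧ ∃ B ∈ I, a ∈ B ∧ b ∈ B) ∨
      (a ∈ w ∧ b ∈ w ∧ ∃ B B', [B, B'].Sublist I ∧ a ∈ B ∧ b ∈ B') := by
  unfold lex
  rw [pair_sublist_flatten]
  constructor
  · rintro (⟨b, hb, h⟩ | ⟨b, b', hbb, ha, hb⟩)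
    · obtain ⟨B, hB, rfl⟩ := mem_lexBlocks.1 hb
      rw [pair_sublist_filter] at h
      exact Or.inl ⟨h.1, B, hB, by simpa using h.2⟩
    · obtain ⟨B, B', hBB, rfl, rfl⟩ := pair_sublist_map.1 hbb
      simp only [List.mem_filter, decide_eq_true_eq] at ha hb
      exact Or.inr ⟨ha.1, hb.1, B, B', hBB, ha.2, hb.2⟩
  · rintro (⟨h, B, hB, ha, hb⟩ | ⟨ha, hb, B, B', hBB, ha', hb'⟩)
    · exact Or.inl ⟨_, mem_lexBlocks.2 ⟨B, hB, rfl⟩, pair_sublist_filter.2 ⟨h, by simp [ha, hb]⟩⟩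
    · exact Or.inr ⟨_, _, pair_sublist_map.2 ⟨B, B', hBB, rfl, rfl⟩, by simp [ha, ha'],
        by simp [hb, hb']⟩

namespace IsPartitionOf

variable {A : Set α} {I : List (Finset α)}

theorem isWordOn_lex (h : IsPartitionOf A I) {w : List α} (hw : IsWordOn A w) :
    IsWordOn A (lex I w) := by
  have hmem : ∀ a, a ∈ lex I w ↔ a ∈ A := by
    intro a
    unfold lex
    rw [List.mem_flatten]
    constructor
    · rintro ⟨b, hb, ha⟩
      obtain ⟨B, -, rfl⟩ := mem_lexBlocks.1 hb
      exact (hw.2 a).1 (List.mem_filter.1 ha).1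
    · intro ha
      obtain ⟨B, hB, haB⟩ := (h.cover a).1 ha
      exact ⟨_, mem_lexBlocks.2 ⟨B, hB, rfl⟩, by simp [haB, (hw.2 a).2 ha]⟩
  refine ⟨?_, hmem⟩
  rw [List.nodup_iff_pairwise_ne, List.pairwise_iff_forall_sublist]
  rintro a b hab rfl
  rcases pair_sublist_lex.1 hab with ⟨h', -⟩ | ⟨-, -, B, B', hBB, ha, hb⟩
  · exact ne_of_pair_sublist hw.1 h' rfl
  · exact Finset.disjoint_left.1 (List.pairwise_iff_forall_sublist.1 h.disjoint hBB) ha hb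

/-- Letters in different parts are ordered by `I` and letters in the same part by `w`, which is
composition of sign-vectors. -/
theorem wordSigns_lex (h : IsPartitionOf A I) {w : List α} (hw : IsWordOn A w) :
    wordSigns (lex I w) = signComp (partSigns I) (wordSigns w) := by
  have hl := h.isWordOn_lex hw
  have key1 : ∀ a b, partSigns I (a, b) = 1 → [a, b].Sublist (lex I w) := by
    intro a b hab
    have hm := h.mem_of_partSigns_ne_zero (a := a) (b := b) (by rw [hab]; decide)
    exact pair_sublist_lex.2 (Or.inr ⟨(hw.2 a).2 hm.1, (hw.2 b).2 hm.2,
      partSigns_eq_one_iff.1 hab⟩)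
  have key : ∀ a b, wordSigns (lex I w) (a, b) = 1 ↔
      signComp (partSigns I) (wordSigns w) (a, b) = 1 := by
    intro a b
    rw [wordSigns_eq_one_iff]
    rcases SignType.trichotomy (partSigns I (a, b)) with h' | h' | h'
    · have h1 := key1 b a (by rw [h.antisymm a b, h']; rfl)
      rw [signComp_of_ne (by rw [h']; decide), h']
      exact ⟨fun h2 => absurd h2 (pair_sublist_asymm hl.1 h1), fun h => absurd h (by decide)⟩
    · rw [signComp_of_eq h', wordSigns_eq_one_iff, pair_sublist_lex]
      constructor
      · rintro (⟨h1, -⟩ | ⟨-, -, h1⟩)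
        · exact h1
        · rw [partSigns_eq_one_iff.2 h1] at h'
          exact absurd h' (by decide)
      · intro h1
        have hm := mem_of_pair_sublist h1
        exact Or.inl ⟨h1, h.exists_block ((hw.2 a).1 hm.1) ((hw.2 b).1 hm.2) h'⟩
    · rw [signComp_of_ne (by rw [h']; decide), h']
      exact ⟨fun _ => rfl, fun _ => key1 a b h'⟩
  funext ⟨a, b⟩
  exact sign_eq_of_eq_one_iff (wordSigns_antisymm hl.1 a b)
    (signComp_antisymm h.antisymm (wordSigns_antisymm hw.1) a b) (key a b) (key b a)

theorem lex_eq_self_iff (h : IsPartitionOf A I) {w : List α} (hw : IsWordOn A w) :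
    lex I w = w ↔ Conf (partSigns I) (wordSigns w) := by
  constructor
  · intro h'
    have := h.wordSigns_lex hw
    rw [h'] at this
    rw [this]
    exact Conf.signComp _ _
  · intro h'
    refine (h.isWordOn_lex hw).ext hw ?_
    rw [h.wordSigns_lex hw, h'.signComp_eq]

/-- A word conforming to `I` lists the parts of `I` one after the other, so `lex I w = w` and the
required groups are its blocks `lexBlocks I w`. -/
theorem refines_iff (h : IsPartitionOf A I) {w : List α} (hw : IsWordOn A w) :
    Refines (singletons w) I ↔ Conf (partSigns I) (wordSigns w) := by
  have hmem : ∀ (K : List (Finset α)) (a : α), a ∈ K.foldr (· ∪ ·) ∅ ↔ ∃ S ∈ K, a ∈ S := by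
    intro K a
    induction K with
    | nil => simp
    | cons S K ih => simp [ih]
  constructor
  · rintro ⟨L, hL, hLI⟩
    have key : ∀ a b, partSigns I (a, b) = 1 → wordSigns w (a, b) = 1 := by
      intro a b hab
      obtain ⟨B, B', hBB, ha, hb⟩ := partSigns_eq_one_iff.1 hab
      rw [← hLI] at hBB
      obtain ⟨K, K', hKK, rfl, rfl⟩ := pair_sublist_map.1 hBB
      obtain ⟨S, hS, haS⟩ := (hmem K a).1 ha
      obtain ⟨S', hS', hbS⟩ := (hmem K' b).1 hb
      have hSS : [S, S'].Sublist (singletons w) := by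
        rw [← hL]
        exact pair_sublist_flatten.2 (Or.inr ⟨K, K', hKK, hS, hS'⟩)
      obtain ⟨x, y, hxy, rfl, rfl⟩ := pair_sublist_map.1 hSS
      rw [Finset.mem_singleton] at haS hbS
      subst haS hbS
      exact wordSigns_eq_one_iff.2 hxy
    rintro ⟨a, b⟩ hab
    rcases SignType.trichotomy (partSigns I (a, b)) with h' | h' | h'
    · rw [wordSigns_antisymm hw.1 b a, key b a (by rw [h.antisymm a b, h']; rfl), h']
    · exact absurd h' hab
    · rw [key a b h', h']
  · intro h'
    refine ⟨(lexBlocks I w).map singletons, ?_, ?_⟩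
    · unfold singletons
      rw [← List.map_flatten]
      congr 1
      exact (h.lex_eq_self_iff hw).2 h'
    · unfold lexBlocks
      rw [List.map_map, List.map_map]
      conv_rhs => rw [← List.map_id I]
      refine List.map_congr_left fun B hB => ?_
      ext a
      simp only [Function.comp_apply, hmem, singletons, List.mem_map, List.mem_filter,
        decide_eq_true_eq, id_eq]
      constructor
      · rintro ⟨_, ⟨b, hb, rfl⟩, ha⟩
        rw [Finset.mem_singleton] at ha
        exact ha ▸ hb.2
      · intro ha
        exact ⟨{a}, ⟨a, ⟨(hw.2 a).2 ((h.cover a).2 ⟨B, hB, ha⟩), ha⟩, rfl⟩, by simp⟩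

end IsPartitionOf

end OrderedPartitions

/-! ### Potential sweeps as antipodal faces, and sweeps as gated ones. -/

section PotentialSweeps

variable {α : Type*} [LinearOrder α] {P : Set (List α)} {I : List (Finset α)}

theorem exists_comp_singletons_iff {w : List α} :
    (∃ τ ∈ P, comp I (singletons w) = singletons τ) ↔ lex I w ∈ P := by
  rw [comp_singletons]
  constructor
  · rintro ⟨τ, hτ, heq⟩
    rwa [singletons_injective heq]
  · exact fun h => ⟨_, h, rfl⟩

/-- Refinement is conformity of sign-vectors, and composing `I` with the reversed word is passing
from T to X∘(-T). -/
theorem isPotentialSweep_iff (hP : ∀ w ∈ P, IsWordOn Set.univ w)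
    (hI : IsPartitionOf Set.univ I) :
    IsPotentialSweep P I ↔ IsAntipodalFace (wordSigns '' P) (partSigns I) := by
  have key : ∀ w ∈ P, (∃ τ ∈ P, comp I (singletons w.reverse) = singletons τ) ↔
      signComp (partSigns I) (-wordSigns w) ∈ wordSigns '' P := by
    intro w hw
    have hr := (hP w hw).reverse
    rw [exists_comp_singletons_iff, ← wordSigns_reverse (hP w hw).1, ← hI.wordSigns_lex hr,
      wordSigns_mem_image_iff hP (hI.isWordOn_lex hr)]
  constructor
  · rintro ⟨-, ⟨σ, hσ, hσI⟩, h⟩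
    refine ⟨⟨_, ⟨σ, hσ, rfl⟩, (hI.refines_iff (hP σ hσ)).1 hσI⟩, ?_⟩
    rintro _ ⟨τ, hτ, rfl⟩ hX
    exact (key τ hτ).1 (h τ hτ ((hI.refines_iff (hP τ hτ)).2 hX))
  · rintro ⟨⟨_, ⟨σ, hσ, rfl⟩, hX⟩, h⟩
    refine ⟨isPartitionOf_univ_iff.1 hI, ⟨σ, hσ, (hI.refines_iff (hP σ hσ)).2 hX⟩, ?_⟩
    intro τ hτ hτI
    exact (key τ hτ).2 (h _ ⟨τ, hτ, rfl⟩ ((hI.refines_iff (hP τ hτ)).1 hτI))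

theorem isSweep_iff (hP : ∀ w ∈ P, IsWordOn Set.univ w) (hI : IsPartitionOf Set.univ I) :
    IsSweep P I ↔ ∀ T ∈ wordSigns '' P, signComp (partSigns I) T ∈ wordSigns '' P := by
  rw [IsSweep, ← isPartitionOf_univ_iff, and_iff_right hI, Set.forall_mem_image]
  refine forall₂_congr fun w hw => ?_
  rw [exists_comp_singletons_iff, ← hI.wordSigns_lex (hP w hw),
    wordSigns_mem_image_iff hP (hI.isWordOn_lex (hP w hw))]

/-- Every potential sweep is a sweep if and only if the antipodal faces are gated. -/
theorem IsAllowableGraph.forall_isSweep_iff [Finite α] {M : Set (Set (List α))}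
    (h : IsAllowableGraph Set.univ P M) :
    (∀ I, IsPotentialSweep P I → IsSweep P I) ↔ AntipodalGated (wordSigns '' P) := by
  constructor
  · intro hsweep X hX
    -- Every antipodal face is a weak order, so a condition on ordered partitions covers all of
    -- them.
    obtain ⟨I, hI, rfl⟩ := (h.isWeakOrder hX).exists_isPartitionOf
    exact mem_gatedCovectors_of_face hX
      ((isSweep_iff h.words hI).1 (hsweep I ((isPotentialSweep_iff h.words hI).2 hX)))
  · intro hA I hpot
    have hI := isPartitionOf_univ_iff.2 hpot.1
    exact (isSweep_iff h.words hI).2 fun T hT =>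
      (hA _ ((isPotentialSweep_iff h.words hI).1 hpot) T hT).1

end PotentialSweeps

/-! ### The move graph as an isometric subgraph of a cube. -/

section MoveGraphs

theorem range_classRestrict_wordSigns {α : Type*} {A : Set α} {P : Set (List α)}
    (r : α × α → α × α) :
    Set.range (fun w : P => classRestrict (offPairs A) r (wordSigns w.1)) =
      classRestrict (offPairs A) r '' (wordSigns '' P) := by
  rw [Set.image_image, Set.image_eq_range]

variable {α : Type} [LinearOrder α] {A : Set α} {P : Set (List α)} {M : Set (Set (List α))}

/-- A move contains exactly one representative, so on the transversal it changes a single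
coordinate. Conversely, if two permutations differ in one representative, the first move between
them already leads from one to the other. -/
theorem IsAllowableGraph.isSignEmbedding (h : IsAllowableGraph A P M) {r : α × α → α × α}
    {ε : α × α → SignType} (hr : IsTransversal (offPairs A) (wordSigns '' P) r ε)
    (hrm : ∀ m ∈ M, ∀ p ∈ movePairs m, r p ∈ movePairs m ∧ ∀ q ∈ movePairs m, r p = r q) :
    IsSignEmbedding (moveGraph P M) (transversal (offPairs A) r)
      fun w : P => classRestrict (offPairs A) r (wordSigns w.1) := by
  have hinj : ∀ v ∈ P, ∀ w ∈ P, classRestrict (offPairs A) r (wordSigns v) =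
      classRestrict (offPairs A) r (wordSigns w) → v = w := fun v hv w hw heq =>
    (h.words v hv).ext (h.words w hw) (hr.restrict_injOn ⟨v, hv, rfl⟩ ⟨w, hw, rfl⟩ heq)
  have hmove : ∀ m ∈ M, ∀ p ∈ movePairs m, ∀ v ∈ P, ∀ w, IsMove m v w →
      classRestrict (offPairs A) r (wordSigns w) =
        flipAt (r p) (classRestrict (offPairs A) r (wordSigns v)) := by
    rintro m hm p hp v hv w ⟨L, hL⟩
    have hn := (h.words v hv).1
    have hrp := (hrm m hm p hp).1
    have hrt := hr.rep_mem_transversal (h.movePairs_subset hm hp)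
    funext q
    by_cases hq : q ∈ transversal (offPairs A) r
    · rw [classRestrict_of_mem _ hq]
      by_cases hqp : q = r p
      · rw [hqp, flipAt_self, classRestrict_of_mem _ hrt, hL.wordSigns_of_mem hn hrp]
      · rw [flipAt_of_ne _ hqp, classRestrict_of_mem _ hq, hL.wordSigns_of_notMem hn]
        intro hqm
        exact hqp (hq.2.symm.trans ((hrm m hm q hqm).2 p hp))
    · have hqp : q ≠ r p := fun hqp => hq (hqp ▸ hrt)
      rw [classRestrict_of_notMem _ hq, flipAt_of_ne _ hqp, classRestrict_of_notMem _ hq]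
  refine ⟨fun v w heq => Subtype.ext (hinj v.1 v.2 w.1 w.2 heq), ?_, ?_⟩
  · rw [range_classRestrict_wordSigns]
    exact hr.isIsometric
  · rintro ⟨v, hv⟩ ⟨w, hw⟩
    constructor
    · rintro ⟨-, m, hm, hmv⟩
      obtain ⟨p, hp⟩ := h.movePairs_nonempty hm
      refine ⟨r p, hr.rep_mem_transversal (h.movePairs_subset hm hp), ?_⟩
      rcases hmv with hmv | hmv
      · exact hmove m hm p hp v hv w hmv
      · change classRestrict _ r (wordSigns w) = flipAt (r p) (classRestrict _ r (wordSigns v))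
        rw [hmove m hm p hp w hw v hmv, flipAt_flipAt]
    · rintro ⟨f, hf, hfw⟩
      have hfw : classRestrict _ r (wordSigns w) = flipAt f (classRestrict _ r (wordSigns v)) := hfw
      have hvf := (h.supp _ ⟨v, hv, rfl⟩ f).2 hf.1
      have hne : v ≠ w := by
        rintro rfl
        have := congrFun hfw f
        rw [flipAt_self, classRestrict_of_mem _ hf] at this
        exact sign_ne_neg_self hvf this
      obtain ⟨m, hm, γ, hγ, hmove', hsep⟩ := h.exists_first_move hv hw hne
      obtain ⟨p, hp⟩ := h.movePairs_nonempty hm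
      have hrt := hr.rep_mem_transversal (h.movePairs_subset hm hp)
      have hpf : r p = f := by
        by_contra hpf
        have h1 := congrFun hfw (r p)
        rw [flipAt_of_ne _ hpf, classRestrict_of_mem _ hrt, classRestrict_of_mem _ hrt] at h1
        exact hsep _ (hrm m hm p hp).1 h1
      have hγw : γ = w := by
        refine hinj γ hγ w hw ?_
        rw [hfw, hmove m hm p hp v hv γ hmove', hpf]
      exact ⟨fun heq => hne (congrArg Subtype.val heq), m, hm, Or.inl (hγw ▸ hmove')⟩

/-- The graph is in `F(Q⁻)` if and only if its antipodal faces are gated. -/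
theorem IsAllowableGraph.inFQMinus_iff [Finite α] (h : IsAllowableGraph A P M)
    (hne : P.Nonempty) :
    InFQMinus (moveGraph P M) ↔ AntipodalGated (wordSigns '' P) := by
  obtain ⟨r, ε, hr, hrm⟩ := h.exists_transversal hne
  have hemb := h.isSignEmbedding hr hrm
  rw [← hr.antipodalGated_iff, ← range_classRestrict_wordSigns]
  constructor
  · intro hF
    exact hemb.antipodalGated hF.2
  · intro hA
    exact not_hasPCMinor_of_isCOM hemb (isCOM_and_antipodalOfContraction _ _ hemb.iso hA).1
      (fun Z hZ => gatedCovectors_supp hemb.iso.supp hemb.iso.nonempty hZ)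
      (fullTopes_gatedCovectors hemb.iso.supp hemb.iso.nonempty)

end MoveGraphs

/-! ### Elementary contractions in terms of sign-vectors. -/

section Contractions

variable {α : Type*}

open Classical in
/-- Changing the signs in `N`. -/
noncomputable def flipOn {E : Type*} (N : Set E) (T : E → SignType) : E → SignType :=
  fun e => if e ∈ N then -T e else T e

theorem flipOn_of_mem {E : Type*} {N : Set E} {T : E → SignType} {e : E} (h : e ∈ N) :
    flipOn N T e = -T e := by
  simp [flipOn, h]

theorem flipOn_of_notMem {E : Type*} {N : Set E} {T : E → SignType} {e : E} (h : e ∉ N) :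
    flipOn N T e = T e := by
  simp [flipOn, h]

theorem BlockMove.wordSigns_eq {L : List (List α)} {m : Set (List α)} {w w' : List α}
    (h : BlockMove L m w w') (hw : w.Nodup) : wordSigns w' = flipOn (movePairs m) (wordSigns w) := by
  funext p
  by_cases hp : p ∈ movePairs m
  · rw [flipOn_of_mem hp, h.wordSigns_of_mem hw hp]
  · rw [flipOn_of_notMem hp, h.wordSigns_of_notMem hw hp]

theorem BlockMove.reverse {L : List (List α)} {m : Set (List α)} {w w' : List α}
    (h : BlockMove L m w w') : BlockMove (L.map List.reverse) (List.reverse '' m) w' w := by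
  obtain ⟨hne, rfl, rfl, rfl, hm⟩ := h
  refine ⟨?_, rfl, ?_, ?_, hm.image _⟩
  · intro b hb
    obtain ⟨c, hc, rfl⟩ := List.mem_map.1 hb
    simpa using hne c hc
  · rw [List.map_map]
    simp
  · ext b
    constructor
    · rintro ⟨c, ⟨hc, hlen⟩, rfl⟩
      exact ⟨List.mem_map.2 ⟨c, hc, rfl⟩, by simpa using hlen⟩
    · rintro ⟨hb, hlen⟩
      obtain ⟨c, hc, rfl⟩ := List.mem_map.1 hb
      exact ⟨c, ⟨hc, by simpa using hlen⟩, rfl⟩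

theorem movePairs_image_reverse (m : Set (List α)) : movePairs (List.reverse '' m) = movePairs m := by
  ext ⟨a, b⟩
  simp [movePairs]

theorem BlockMove.sublist_of_mem {L : List (List α)} {m : Set (List α)} {w w' : List α}
    (h : BlockMove L m w w') {s : List α} (hs : s ∈ m) : s.Sublist w := by
  obtain ⟨-, rfl, -, rfl, -⟩ := h
  exact List.sublist_flatten_of_mem hs.1

/-- A move is determined by the pairs that it reverses and their order. -/
theorem BlockMove.eq_of_signs {L L₁ : List (List α)} {m m₁ : Set (List α)} {w w' w₁ w₁' : List α}
    (h : BlockMove L m w w') (h₁ : BlockMove L₁ m₁ w₁ w₁') (hw : w.Nodup) (hw₁ : w₁.Nodup)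
    (hpairs : movePairs m = movePairs m₁)
    (hs : ∀ p ∈ movePairs m, wordSigns w p = wordSigns w₁ p) : m = m₁ := by
  have key : ∀ {L L₁ : List (List α)} {m m₁ : Set (List α)} {w w' w₁ w₁' : List α},
      BlockMove L m w w' → BlockMove L₁ m₁ w₁ w₁' → w.Nodup → w₁.Nodup →
      movePairs m = movePairs m₁ → (∀ p ∈ movePairs m, wordSigns w p = wordSigns w₁ p) →
      m ⊆ m₁ := by
    intro L L₁ m m₁ w w' w₁ w₁' h h₁ hw hw₁ hpairs hs s hsm
    have hsub := h.sublist_of_mem hsm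
    have hsn := hsub.nodup hw
    have hlen : 2 ≤ s.length := by
      obtain ⟨-, -, -, rfl, -⟩ := h
      exact hsm.2
    obtain ⟨a, b, ha, hb, hab⟩ : ∃ a b, a ∈ s ∧ b ∈ s ∧ a ≠ b := by
      match s, hlen, hsn with
      | a :: b :: t, _, hsn =>
        refine ⟨a, b, by simp, by simp, ?_⟩
        rintro rfl
        simp at hsn
    have hp : (a, b) ∈ movePairs m₁ := hpairs ▸ ⟨hab, s, hsm, ha, hb⟩
    obtain ⟨-, t, htm, hat, hbt⟩ := hp
    have huniq : ∀ {L : List (List α)} {m : Set (List α)} {w w' : List α}, BlockMove L m w w' →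
        w.Nodup → ∀ s ∈ m, ∀ t ∈ m, ∀ c ∈ s, c ∈ t → s = t := by
      rintro L m w w' ⟨-, rfl, -, rfl, -⟩ hw s hs t ht c hcs hct
      exact nodup_block hw hs.1 ht.1 hcs hct
    -- The letters of a substring are one of its letters a together with all letters paired with a,
    -- so the pairs determine them; the signs then determine the order of the letters.
    have hst : ∀ c, c ∈ s ↔ c ∈ t := by
      intro c
      by_cases hca : c = a
      · rw [hca]; exact ⟨fun _ => hat, fun _ => ha⟩
      constructor
      · intro hc
        have hp : (a, c) ∈ movePairs m₁ := hpairs ▸ ⟨Ne.symm hca, s, hsm, ha, hc⟩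
        obtain ⟨-, t', ht', hat', hct'⟩ := hp
        rwa [huniq h₁ hw₁ t htm t' ht' a hat hat']
      · intro hc
        have hp : (a, c) ∈ movePairs m := hpairs ▸ ⟨Ne.symm hca, t, htm, hat, hc⟩
        obtain ⟨-, s', hs', has', hcs'⟩ := hp
        rwa [huniq h hw s hsm s' hs' a ha has']
    have htsub := h₁.sublist_of_mem htm
    have htn := htsub.nodup hw₁
    have hsubl : ∀ x y, [x, y].Sublist s → [x, y].Sublist t := by
      intro x y hxy
      have hm := mem_of_pair_sublist hxy
      have hne := ne_of_pair_sublist hsn hxy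
      have h1 := hs (x, y) ⟨hne, s, hsm, hm.1, hm.2⟩
      rw [wordSigns_eq_one_iff.2 (hxy.trans hsub)] at h1
      refine (pair_sublist_total ((hst x).1 hm.1) ((hst y).1 hm.2) hne).resolve_right fun h' => ?_
      exact pair_sublist_asymm hw₁ (h'.trans htsub) (wordSigns_eq_one_iff.1 h1.symm)
    have heq : s = t := by
      refine IsWordOn.ext (A := {c | c ∈ t}) ⟨hsn, hst⟩ ⟨htn, fun _ => Iff.rfl⟩ ?_
      funext ⟨x, y⟩
      refine sign_eq_of_eq_one_iff (wordSigns_antisymm hsn x y) (wordSigns_antisymm htn x y) ?_ ?_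
      all_goals
        rw [wordSigns_eq_one_iff, wordSigns_eq_one_iff]
        refine ⟨hsubl _ _, fun hxy => ?_⟩
        have hm := mem_of_pair_sublist hxy
        exact (pair_sublist_total ((hst _).2 hm.1) ((hst _).2 hm.2)
          (ne_of_pair_sublist htn hxy)).resolve_right fun h' =>
            pair_sublist_asymm htn hxy (hsubl _ _ h')
    rwa [heq]
  exact (key h h₁ hw hw₁ hpairs hs).antisymm
    (key h₁ h hw₁ hw hpairs.symm fun p hp => (hs p (hpairs ▸ hp)).symm)

variable [LinearOrder α]

theorem IsMinLetter.eq {b : List α} {a a' : α} (h : IsMinLetter b a) (h' : IsMinLetter b a') :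
    a = a' := le_antisymm (h.2 a' h'.1) (h'.2 a h.1)

theorem exists_isMinLetter {b : List α} (hb : b ≠ []) : ∃ a, IsMinLetter b a := by
  obtain ⟨x, hx⟩ := List.exists_mem_of_ne_nil b hb
  obtain ⟨a, ha, hmin⟩ := b.toFinset.exists_min_image id ⟨x, List.mem_toFinset.2 hx⟩
  exact ⟨a, List.mem_toFinset.1 ha, fun y hy => hmin y (List.mem_toFinset.2 hy)⟩

theorem exists_forall₂_isMinLetter {L : List (List α)} (hL : ∀ b ∈ L, b ≠ []) :
    ∃ v, List.Forall₂ IsMinLetter L v := by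
  induction L with
  | nil => exact ⟨[], List.Forall₂.nil⟩
  | cons b L ih =>
    obtain ⟨v, hv⟩ := ih fun c hc => hL c (List.mem_cons_of_mem _ hc)
    obtain ⟨a, ha⟩ := exists_isMinLetter (hL b List.mem_cons_self)
    exact ⟨a :: v, List.Forall₂.cons ha hv⟩

theorem forall₂_isMinLetter_sublist {L : List (List α)} {v : List α}
    (h : List.Forall₂ IsMinLetter L v) : v.Sublist L.flatten := by
  induction h with
  | nil => simp
  | cons ha _ ih => exact (List.singleton_sublist.2 ha.1).append ih

theorem mem_of_forall₂_isMinLetter {L : List (List α)} {v : List α}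
    (h : List.Forall₂ IsMinLetter L v) (a : α) : a ∈ v ↔ ∃ b ∈ L, IsMinLetter b a := by
  induction h with
  | nil => simp
  | cons ha _ ih =>
    simp only [List.mem_cons, ih, exists_eq_or_imp]
    constructor
    · rintro (rfl | h)
      · exact Or.inl ha
      · exact Or.inr h
    · rintro (h | h)
      · exact Or.inl (h.eq ha)
      · exact Or.inr h

theorem contractGround_image_reverse (A : Set α) (m : Set (List α)) :
    contractGround A (List.reverse '' m) = contractGround A m := by
  ext a
  simp [contractGround, IsMinLetter]

theorem notMem_movePairs_of_mem_contractGround {A : Set α} {m : Set (List α)} {p : α × α}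
    (hp : p ∈ offPairs (contractGround A m)) : p ∉ movePairs m := by
  rintro ⟨hne, s, hs, h1, h2⟩
  exact hne ((hp.1.2 s hs h1).eq (hp.2.1.2 s hs h2))

/-- The word that `γ` contributes to a contraction. -/
theorem BlockMove.contract {A : Set α} {L : List (List α)} {m : Set (List α)} {γ γ' v : List α}
    (h : BlockMove L m γ γ') (hγ : IsWordOn A γ) (hv : List.Forall₂ IsMinLetter L v) :
    IsWordOn (contractGround A m) v ∧
      wordSigns v = zeroOn (offPairs (contractGround A m))ᶜ (wordSigns γ) := by
  obtain ⟨hne, hγL, -, rfl, -⟩ := h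
  have hsub := forall₂_isMinLetter_sublist hv
  rw [hγL] at hsub
  have hnd : L.flatten.Nodup := by rw [hγL]; exact hγ.1
  have hword : IsWordOn (contractGround A {b | b ∈ L ∧ 2 ≤ b.length}) v := by
    refine ⟨hsub.nodup hγ.1, fun a => ?_⟩
    rw [mem_of_forall₂_isMinLetter hv]
    constructor
    · rintro ⟨b, hb, hab⟩
      refine ⟨(hγ.2 a).1 (hγL ▸ List.mem_flatten.2 ⟨b, hb, hab.1⟩), fun s hs has => ?_⟩
      rwa [nodup_block hnd hs.1 hb has hab.1]
    · rintro ⟨haA, hmin⟩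
      have haγ := (hγ.2 a).2 haA
      rw [← hγL] at haγ
      obtain ⟨b, hb, hab⟩ := List.mem_flatten.1 haγ
      refine ⟨b, hb, ?_⟩
      by_cases hlen : 2 ≤ b.length
      · exact hmin b ⟨hb, hlen⟩ hab
      · match b, hlen, hab with
        | [x], _, hab =>
          rw [List.mem_singleton] at hab
          subst hab
          exact ⟨List.mem_singleton_self _, fun y hy => (List.mem_singleton.1 hy).ge⟩
        | _ :: _ :: _, hlen, _ => simp at hlen
  refine ⟨hword, ?_⟩
  funext ⟨a, b⟩
  by_cases hp : (a, b) ∈ offPairs (contractGround A {b | b ∈ L ∧ 2 ≤ b.length})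
  · rw [zeroOn_of_notMem (Set.notMem_compl_iff.2 hp)]
    have key : ∀ a b, a ∈ v → b ∈ v → a ≠ b → ([a, b].Sublist v ↔ [a, b].Sublist γ) := by
      intro a b ha hb hab
      refine ⟨fun h => h.trans hsub, fun h => ?_⟩
      exact (pair_sublist_total ha hb hab).resolve_right fun h' =>
        pair_sublist_asymm hγ.1 h (h'.trans hsub)
    have ha := (hword.2 a).2 hp.1
    have hb := (hword.2 b).2 hp.2.1
    exact wordSigns_congr (key a b ha hb hp.2.2) (key b a hb ha (Ne.symm hp.2.2))
  · rw [zeroOn_of_mem hp]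
    by_contra h
    exact hp ((hword.full _).1 h)

variable {A : Set α} {P : Set (List α)} {M : Set (Set (List α))}

/-- The pairs of `m` are reversed together, so in γ they are all ordered as before the move `m` or
all as after it. A move being determined by its pairs and their order, only `m` and its reverse are
possible. -/
theorem IsAllowableGraph.eq_or_eq_image_reverse (h : IsAllowableGraph A P M)
    {m : Set (List α)} (hm : m ∈ M) {L₁ : List (List α)} {m₁ : Set (List α)} {γ γ' : List α}
    (hγ : γ ∈ P) (h₁ : BlockMove L₁ m₁ γ γ') (hpairs : movePairs m₁ = movePairs m) :
    m₁ = m ∨ m₁ = List.reverse '' m := by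
  obtain ⟨w, hw, w', hw', L, hL⟩ := h.moves m hm
  obtain ⟨p, hp⟩ := h.movePairs_nonempty hm
  have hn := (h.words w hw).1
  have hnγ := (h.words γ hγ).1
  by_cases hpe : wordSigns γ p = wordSigns w p
  · left
    refine h₁.eq_of_signs hL hnγ hn hpairs fun q hq => ?_
    by_contra hne
    rw [hpairs] at hq
    exact h.reversed_together hm hq hp ⟨γ, hγ, rfl⟩ ⟨w, hw, rfl⟩ hne hpe
  · right
    refine h₁.eq_of_signs hL.reverse hnγ (h.words w' hw').1 ?_ fun q hq => ?_
    · rw [movePairs_image_reverse, hpairs]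
    · rw [hpairs] at hq
      have hne := h.reversed_together hm hp hq ⟨γ, hγ, rfl⟩ ⟨w, hw, rfl⟩ hpe
      rw [hL.wordSigns_of_mem hn hq]
      have hqA := h.movePairs_subset hm hq
      exact sign_eq_neg_of_ne (((h.words w hw).full q).2 hqA) (((h.words γ hγ).full q).2 hqA)
        (Ne.symm hne)

/-- Two permutations that differ exactly in the pairs of a move differ by this move. -/
theorem IsAllowableGraph.exists_blockMove (h : IsAllowableGraph A P M) {m : Set (List α)}
    (hm : m ∈ M) {γ γ' : List α} (hγ : γ ∈ P) (hγ' : γ' ∈ P)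
    (heq : wordSigns γ' = flipOn (movePairs m) (wordSigns γ)) :
    ∃ L m', (m' = m ∨ m' = List.reverse '' m) ∧ BlockMove L m' γ γ' := by
  obtain ⟨p, hp⟩ := h.movePairs_nonempty hm
  have hne : γ ≠ γ' := by
    rintro rfl
    have := congrFun heq p
    rw [flipOn_of_mem hp] at this
    exact sign_ne_neg_self (((h.words γ hγ).full p).2 (h.movePairs_subset hm hp)) this
  obtain ⟨m₁, hm₁, δ, hδ, ⟨L, hL⟩, hsep⟩ := h.exists_first_move hγ hγ' hne
  -- The first move on the way to γ' only reverses pairs in which γ and γ' differ, that is, pairs of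
  -- `m`; by (P3) it reverses all of them.
  have hpairs : movePairs m₁ = movePairs m := by
    obtain ⟨q, hq⟩ := h.movePairs_nonempty hm₁
    refine h.movePairs_eq hm₁ hm hq ?_
    by_contra hqm
    exact hsep q hq (by rw [heq, flipOn_of_notMem hqm])
  have hδγ : δ = γ' := by
    refine (h.words δ hδ).ext (h.words γ' hγ') ?_
    rw [heq, hL.wordSigns_eq (h.words γ hγ).1, hpairs]
  exact ⟨L, m₁, h.eq_or_eq_image_reverse hm hγ hL hpairs, hδγ ▸ hL⟩

theorem IsAllowableGraph.isWordOn_of_mem_contractWords (h : IsAllowableGraph A P M)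
    {m : Set (List α)} {v : List α} (hv : v ∈ contractWords P m) :
    IsWordOn (contractGround A m) v := by
  obtain ⟨γ, hγ, γ', -, L, m', hm', hL, hLv⟩ := hv
  have := (hL.contract (h.words γ hγ) hLv).1
  rcases hm' with rfl | rfl
  · exact this
  · rwa [contractGround_image_reverse] at this

/-- The sign-vectors of an elementary contraction. -/
theorem IsAllowableGraph.wordSigns_image_contractWords (h : IsAllowableGraph A P M)
    {m : Set (List α)} (hm : m ∈ M) :
    wordSigns '' contractWords P m = zeroOn (offPairs (contractGround A m))ᶜ ''
      {T | T ∈ wordSigns '' P ∧ flipOn (movePairs m) T ∈ wordSigns '' P} := by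
  ext X
  constructor
  · rintro ⟨v, ⟨γ, hγ, γ', hγ', L, m', hm', hL, hLv⟩, rfl⟩
    have hmp : movePairs m' = movePairs m := by
      rcases hm' with rfl | rfl
      · rfl
      · exact movePairs_image_reverse m
    have hmg : contractGround A m' = contractGround A m := by
      rcases hm' with rfl | rfl
      · rfl
      · exact contractGround_image_reverse A m
    refine ⟨wordSigns γ, ⟨⟨γ, hγ, rfl⟩, γ', hγ', ?_⟩, ?_⟩
    · rw [hL.wordSigns_eq (h.words γ hγ).1, hmp]
    · rw [(hL.contract (h.words γ hγ) hLv).2, hmg]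
  · rintro ⟨_, ⟨⟨γ, hγ, rfl⟩, γ', hγ', heq⟩, rfl⟩
    obtain ⟨L, m', hm', hL⟩ := h.exists_blockMove hm hγ hγ' heq
    obtain ⟨v, hv⟩ := exists_forall₂_isMinLetter hL.1
    refine ⟨v, ⟨γ, hγ, γ', hγ', L, m', hm', hL, hv⟩, ?_⟩
    rw [(hL.contract (h.words γ hγ) hv).2]
    rcases hm' with rfl | rfl
    · rfl
    · rw [contractGround_image_reverse]

/-- Take the minimal letter of the block of x. In a weak order that vanishes on the move, both
letters are tied and hence compare in the same way with every z. -/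
theorem IsAllowableGraph.exists_representative (h : IsAllowableGraph A P M) {m : Set (List α)}
    (hm : m ∈ M) {x : α} (hx : x ∈ A) :
    ∃ a ∈ contractGround A m, ∀ Y : α × α → SignType, IsWeakOrder A Y →
      (∀ p ∈ movePairs m, Y p = 0) → ∀ z, Y (x, z) = Y (a, z) := by
  obtain ⟨w, hw, w', hw', L, hL⟩ := h.moves m hm
  have hword := h.words w hw
  have hxw := (hword.2 x).2 hx
  rw [← hL.2.1] at hxw
  obtain ⟨B, hB, hxB⟩ := List.mem_flatten.1 hxw
  obtain ⟨a, ha⟩ := exists_isMinLetter (hL.1 B hB)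
  have haA : a ∈ A := by
    rw [← hword.2, ← hL.2.1]
    exact List.mem_flatten.2 ⟨B, hB, ha.1⟩
  refine ⟨a, ⟨haA, fun s hs has => ?_⟩, fun Y hY hY0 z => ?_⟩
  · obtain ⟨-, rfl, -, rfl, -⟩ := hL
    rwa [nodup_block hword.1 hs.1 hB has ha.1]
  · refine hY.zero x hx a haA ?_ z
    by_cases hxa : x = a
    · by_contra h0
      exact (hY.off _ h0).2.2 hxa
    · exact hY0 _ (hL.mem_movePairs_iff.2 ⟨hxa, B, hB, hxB, ha.1⟩)

/-- A weak order that vanishes on a move is determined by the contracted ground set. -/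
theorem IsAllowableGraph.exists_representatives (h : IsAllowableGraph A P M) {m : Set (List α)}
    (hm : m ∈ M) {x y : α} (hx : x ∈ A) (hy : y ∈ A) :
    ∃ a ∈ contractGround A m, ∃ b ∈ contractGround A m, ∀ Y : α × α → SignType,
      IsWeakOrder A Y → (∀ p ∈ movePairs m, Y p = 0) → Y (x, y) = Y (a, b) := by
  obtain ⟨a, ha, hxa⟩ := h.exists_representative hm hx
  obtain ⟨b, hb, hyb⟩ := h.exists_representative hm hy
  refine ⟨a, ha, b, hb, fun Y hY hY0 => ?_⟩
  rw [hxa Y hY hY0, hY.antisymm y a, hyb Y hY hY0, ← hY.antisymm]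

theorem IsAllowableGraph.mem_movePairs_trans (h : IsAllowableGraph A P M) {m : Set (List α)}
    (hm : m ∈ M) {a b c : α} (h1 : (a, b) ∈ movePairs m) (h2 : (b, c) ∈ movePairs m)
    (hac : a ≠ c) : (a, c) ∈ movePairs m := by
  obtain ⟨w, hw, w', hw', L, hL⟩ := h.moves m hm
  exact hL.mem_movePairs_trans (h.words w hw).1 h1 h2 hac

theorem IsAllowableGraph.isWeakOrder_of_mem (h : IsAllowableGraph A P M)
    {T : α × α → SignType} (hT : T ∈ wordSigns '' P) : IsWeakOrder A T := by
  obtain ⟨w, hw, rfl⟩ := hT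
  exact (h.words w hw).isWeakOrder

/-- The covector between two permutations that differ by a move. -/
theorem IsAllowableGraph.isWeakOrder_zeroOn (h : IsAllowableGraph A P M) {m : Set (List α)}
    (hm : m ∈ M) {T : α × α → SignType} (hT : T ∈ wordSigns '' P)
    (hT' : flipOn (movePairs m) T ∈ wordSigns '' P) :
    IsWeakOrder A (zeroOn (movePairs m) T) := by
  have hw := h.isWeakOrder_of_mem hT
  have hw' := h.isWeakOrder_of_mem hT'
  have hone : ∀ p, zeroOn (movePairs m) T p = 1 ↔ p ∉ movePairs m ∧ T p = 1 := by
    intro p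
    by_cases hp : p ∈ movePairs m <;> simp [zeroOn, hp]
  have hzero : ∀ p ∈ offPairs A, zeroOn (movePairs m) T p = 0 → p ∈ movePairs m := by
    intro p hp h0
    by_contra hpm
    rw [zeroOn_of_notMem hpm] at h0
    exact (h.supp T hT p).2 hp h0
  have hdiag : ∀ a, zeroOn (movePairs m) T (a, a) = 0 := fun a => by
    rw [zeroOn_of_notMem fun h => h.1 rfl]
    by_contra h0
    exact (hw.off _ h0).2.2 rfl
  refine IsWeakOrder.of_zero_trans ?_ ?_ ?_ ?_
  · intro p hp
    by_cases hpm : p ∈ movePairs m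
    · exact h.movePairs_subset hm hpm
    · rw [zeroOn_of_notMem hpm] at hp
      exact hw.off p hp
  · intro a b
    by_cases hab : (a, b) ∈ movePairs m
    · rw [zeroOn_of_mem hab, zeroOn_of_mem (mem_movePairs_swap.1 hab)]; rfl
    · rw [zeroOn_of_notMem hab, zeroOn_of_notMem (mt mem_movePairs_swap.1 hab), hw.antisymm]
  · intro a b c hab hbc
    rw [hone] at *
    have hac := hw.trans a b c hab.2 hbc.2
    -- If the move reversed (a, c), the permutation behind it would have a before b before c, but c
    -- before a.
    refine ⟨fun hacm => ?_, hac⟩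
    have := hw'.trans a b c (by rw [flipOn_of_notMem hab.1, hab.2])
      (by rw [flipOn_of_notMem hbc.1, hbc.2])
    rw [flipOn_of_mem hacm, hac] at this
    exact absurd this (by decide)
  · intro a ha b hb c hc hab hbc
    by_cases h1 : a = b
    · rwa [h1]
    by_cases h2 : b = c
    · rwa [← h2]
    by_cases h3 : a = c
    · rw [← h3]; exact hdiag a
    · exact zeroOn_of_mem (h.mem_movePairs_trans hm (hzero _ ⟨ha, hb, h1⟩ hab)
        (hzero _ ⟨hb, hc, h2⟩ hbc) h3)

end Contractions

/-! ### Contractions of sweep oriented matroids are sweep oriented matroids. -/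

section ContractionClosure

variable {α : Type*}

theorem IsWeakOrder.diag {A : Set α} {X : α × α → SignType} (hX : IsWeakOrder A X) (a : α) :
    X (a, a) = 0 := by
  by_contra h
  exact (hX.off _ h).2.2 rfl

theorem IsWeakOrder.zeroOn_offPairs {A A' : Set α} {X : α × α → SignType} (hX : IsWeakOrder A X)
    (hA : A' ⊆ A) : IsWeakOrder A' (zeroOn (offPairs A')ᶜ X) := by
  have hin : ∀ a ∈ A', ∀ b ∈ A', zeroOn (offPairs A')ᶜ X (a, b) = X (a, b) := by
    intro a ha b hb
    by_cases hab : a = b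
    · subst hab
      rw [hX.diag, zeroOn_of_mem fun h => h.2.2 rfl]
    · exact zeroOn_of_notMem (Set.notMem_compl_iff.2 ⟨ha, hb, hab⟩)
  have hoff : ∀ p, zeroOn (offPairs A')ᶜ X p ≠ 0 → p ∈ offPairs A' := by
    intro p hp
    by_contra h
    exact hp (zeroOn_of_mem h)
  have hout : ∀ a b, ¬ (a ∈ A' ∧ b ∈ A') → zeroOn (offPairs A')ᶜ X (a, b) = 0 := by
    intro a b hab
    exact zeroOn_of_mem fun h => hab ⟨h.1, h.2.1⟩
  refine ⟨hoff, ?_, ?_, ?_⟩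
  · intro a b
    by_cases hab : a ∈ A' ∧ b ∈ A'
    · rw [hin a hab.1 b hab.2, hin b hab.2 a hab.1, hX.antisymm]
    · rw [hout a b hab, hout b a fun h => hab h.symm]; rfl
  · intro a b c hab hbc
    have h1 := hoff (a, b) (by rw [hab]; decide)
    have h2 := hoff (b, c) (by rw [hbc]; decide)
    rw [hin a h1.1 b h1.2.1] at hab
    rw [hin b h2.1 c h2.2.1] at hbc
    rw [hin a h1.1 c h2.2.1]
    exact hX.trans a b c hab hbc
  · intro a ha b hb hab c
    rw [hin a ha b hb] at hab
    by_cases hc : c ∈ A'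
    · rw [hin a ha c hc, hin b hb c hc]
      exact hX.zero a (hA ha) b (hA hb) hab c
    · rw [hout a c fun h => hc h.2, hout b c fun h => hc h.2]

variable [LinearOrder α] {A : Set α} {P : Set (List α)} {M : Set (Set (List α))}

/-- Sweep oriented matroids are closed under elementary contractions. -/
theorem IsAllowableGraph.isSweepGraph_contract (h : IsAllowableGraph A P M) {m : Set (List α)}
    (hm : m ∈ M) (hS : IsSweepGraph A P) :
    IsSweepGraph (contractGround A m) (contractWords P m) := by
  obtain ⟨ℒ, hℒ, hweak, htope⟩ := hS
  set N := movePairs m with hN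
  set D := offPairs (contractGround A m) with hD
  have hDA : D ⊆ offPairs A := fun p hp => ⟨hp.1.1, hp.2.1.1, hp.2.2⟩
  have hDN : ∀ p ∈ D, p ∉ N := fun p hp => notMem_movePairs_of_mem_contractGround hp
  have hcom := (hℒ.isCOM.contract N).zeroOn_image Dᶜ
  refine ⟨zeroOn Dᶜ '' {Z | Z ∈ ℒ ∧ ∀ e ∈ N, Z e = 0}, ⟨?_, ?_, ?_, hcom.elim⟩, ?_, ?_⟩
  · refine ⟨_, ⟨hℒ.zero_mem, fun _ _ => rfl⟩, ?_⟩
    funext e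
    simp [zeroOn]
  · rintro _ ⟨Z, ⟨hZ, hZN⟩, rfl⟩
    exact ⟨-Z, ⟨hℒ.neg_mem Z hZ, fun e he => by simp [hZN e he]⟩, zeroOn_neg _ _⟩
  · intro X hX Y hY
    exact hcom.comp hX hY
  · rintro _ ⟨Z, ⟨hZ, hZN⟩, rfl⟩
    exact (hweak Z hZ).zeroOn_offPairs fun a ha => ha.1
  · rw [h.wordSigns_image_contractWords hm]
    have hfull : ∀ Z ∈ ℒ, ∀ T ∈ wordSigns '' P, signComp Z T ∈ wordSigns '' P := by
      intro Z hZ T hT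
      rw [← htope] at hT ⊢
      refine ⟨hℒ.comp_mem Z hZ T hT.1, fun e => ?_⟩
      by_cases he : Z e = 0
      · rw [signComp_of_eq he]; exact hT.2 e
      · rw [signComp_of_ne he]; exact ⟨(hweak Z hZ).off e, fun _ => he⟩
    ext X
    constructor
    · rintro ⟨⟨Z, ⟨hZ, hZN⟩, rfl⟩, hZfull⟩
      obtain ⟨w, hw, w', hw', L, hL⟩ := h.moves m hm
      have hT : wordSigns w ∈ wordSigns '' P := ⟨w, hw, rfl⟩
      have hT' : flipOn N (wordSigns w) ∈ wordSigns '' P :=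
        ⟨w', hw', hL.wordSigns_eq (h.words w hw).1⟩
      have hwo := h.isWeakOrder_zeroOn hm hT hT'
      -- On the contracted ground set `Z` has no zeros off the diagonal, so tied letters have the
      -- same representative. The weak order obtained by zeroing `w` on the move then ties them too,
      -- and its only zeros in `offPairs A` are the pairs of the move.
      have hzero : ∀ p ∈ offPairs A, Z p = 0 → p ∈ N := by
        rintro ⟨x, y⟩ hp hZp
        obtain ⟨a, ha, b, hb, hab⟩ := h.exists_representatives hm hp.1 hp.2.1
        rw [hab Z (hweak Z hZ) hZN] at hZp
        have hab' : a = b := by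
          by_contra hne
          have hpD : (a, b) ∈ D := ⟨ha, hb, hne⟩
          have := (hZfull (a, b)).2 hpD
          rw [zeroOn_of_notMem (Set.notMem_compl_iff.2 hpD)] at this
          exact this hZp
        have h1 := hab _ hwo fun p hp => zeroOn_of_mem hp
        rw [hab', hwo.diag] at h1
        by_contra hpN
        rw [zeroOn_of_notMem hpN] at h1
        exact (h.supp _ hT _).2 hp h1
      refine ⟨signComp Z (wordSigns w), ⟨hfull Z hZ _ hT, ?_⟩, ?_⟩
      -- Within `offPairs A`, the zeros of `Z` are exactly the pairs in `N`, so Z∘(-T) is Z∘T with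
      -- the pairs of `N` reversed.
      · convert hfull Z hZ _ (h.neg_mem hT) using 1
        funext p
        by_cases hpN : p ∈ N
        · rw [flipOn_of_mem hpN, signComp_of_eq (hZN p hpN), signComp_of_eq (hZN p hpN)]; rfl
        · rw [flipOn_of_notMem hpN]
          by_cases hp : p ∈ offPairs A
          · have hZp : Z p ≠ 0 := fun h0 => hpN (hzero p hp h0)
            rw [signComp_of_ne hZp, signComp_of_ne hZp]
          · have hT0 : wordSigns w p = 0 := by
              by_contra h0
              exact hp ((h.supp _ hT p).1 h0)
            simp [signComp, hT0]
      · funext p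
        by_cases hp : p ∈ D
        · rw [zeroOn_of_notMem (Set.notMem_compl_iff.2 hp),
            zeroOn_of_notMem (Set.notMem_compl_iff.2 hp), signComp_of_ne]
          exact fun h0 => hDN p hp (hzero p (hDA hp) h0)
        · rw [zeroOn_of_mem hp, zeroOn_of_mem hp]
    · rintro ⟨T, ⟨hT, hT'⟩, rfl⟩
      have hTℒ := htope ▸ hT
      have hTℒ' := htope ▸ hT'
      obtain ⟨e, he⟩ := h.movePairs_nonempty hm
      have hTe := (h.supp T hT e).2 (h.movePairs_subset hm he)
      -- Elimination between the two ends of the move only prescribes a zero at `e`.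
      obtain ⟨Z, hZ, hZe, hZf⟩ := hℒ.elim T hTℒ.1 _ hTℒ'.1 e ⟨hTe, flipOn_of_mem he⟩
      have hZoff : ∀ p, p ∉ N → Z p = T p := by
        intro p hp
        by_cases hTp : T p = 0
        · rw [hZf p fun hh => hh.1 hTp, signComp_of_eq hTp, flipOn_of_notMem hp]
        · rw [hZf p, signComp_of_ne hTp]
          rintro ⟨-, hh⟩
          rw [flipOn_of_notMem hp] at hh
          exact sign_ne_neg_self hTp hh
      -- The topes Z∘T and Z∘(-T) differ at `e`, hence at all pairs reversed together with `e`,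
      -- which is impossible where `Z` is non-zero.
      have hZN : ∀ p ∈ N, Z p = 0 := by
        intro p hp
        by_contra hZp
        refine h.reversed_together hm he hp (hfull Z hZ T hT) (hfull Z hZ _ (h.neg_mem hT)) ?_ ?_
        · rw [signComp_of_eq hZe, signComp_of_eq hZe]
          exact sign_ne_neg_self hTe
        · rw [signComp_of_ne hZp, signComp_of_ne hZp]
      have heq : zeroOn Dᶜ Z = zeroOn Dᶜ T := by
        funext p
        by_cases hp : p ∈ D
        · rw [zeroOn_of_notMem (Set.notMem_compl_iff.2 hp),
            zeroOn_of_notMem (Set.notMem_compl_iff.2 hp), hZoff p (hDN p hp)]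
        · rw [zeroOn_of_mem hp, zeroOn_of_mem hp]
      refine ⟨⟨Z, ⟨hZ, hZN⟩, heq⟩, fun p => ?_⟩
      by_cases hp : p ∈ D
      · rw [zeroOn_of_notMem (Set.notMem_compl_iff.2 hp)]
        exact ⟨fun _ => hp, fun _ => (h.supp T hT p).2 (hDA hp)⟩
      · rw [zeroOn_of_mem hp]
        exact ⟨fun hh => absurd rfl hh, fun hh => absurd hh hp⟩

end ContractionClosure

/-! ### From allowable contractions to gated antipodal faces. -/

section ContractionsGated

variable {α : Type*} [LinearOrder α] {A : Set α} {P : Set (List α)} {M : Set (Set (List α))}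

theorem IsAllowableGraph.contractGround_ssubset (h : IsAllowableGraph A P M) {m : Set (List α)}
    (hm : m ∈ M) : contractGround A m ⊂ A := by
  refine ⟨fun a ha => ha.1, fun hsub => ?_⟩
  obtain ⟨p, hp⟩ := h.movePairs_nonempty hm
  have hpA := h.movePairs_subset hm hp
  exact notMem_movePairs_of_mem_contractGround (A := A) ⟨hsub hpA.1, hsub hpA.2.1, hpA.2.2⟩ hp

/-- An antipodal face that vanishes on a move composes with the permutations at the move, if the
antipodal faces of the contraction are gated. -/
theorem IsAllowableGraph.signComp_mem_of_contract (h : IsAllowableGraph A P M) {m : Set (List α)}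
    (hm : m ∈ M) (hA : AntipodalGated (wordSigns '' contractWords P m))
    {X T : α × α → SignType} (hX : IsAntipodalFace (wordSigns '' P) X)
    (hXm : ∀ p ∈ movePairs m, X p = 0) (hT : T ∈ wordSigns '' P)
    (hT' : flipOn (movePairs m) T ∈ wordSigns '' P) : signComp X T ∈ wordSigns '' P := by
  have hXw := h.isWeakOrder hX
  rw [h.wordSigns_image_contractWords hm] at hA
  set N := movePairs m with hN
  set D := offPairs (contractGround A m) with hD
  have hDN : ∀ p ∈ D, p ∉ N := fun p hp => notMem_movePairs_of_mem_contractGround hp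
  have hres : ∀ (Y : α × α → SignType), ∀ p ∈ D, zeroOn Dᶜ Y p = Y p := fun Y p hp =>
    zeroOn_of_notMem (Set.notMem_compl_iff.2 hp)
  obtain ⟨e, he⟩ := h.movePairs_nonempty hm
  have heA := h.movePairs_subset hm he
  have hface : IsAntipodalFace (zeroOn Dᶜ ''
      {T | T ∈ wordSigns '' P ∧ flipOn N T ∈ wordSigns '' P}) (zeroOn Dᶜ X) := by
    refine ⟨?_, ?_⟩
    · obtain ⟨⟨_, ⟨σ, hσ, rfl⟩, hXσ⟩, hanti⟩ := hX
      obtain ⟨σ', hσ', hσ'eq⟩ := hanti _ ⟨σ, hσ, rfl⟩ hXσ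
      have hne : wordSigns σ e ≠ wordSigns σ' e := by
        rw [hσ'eq, signComp_of_eq (hXm e he)]
        exact sign_ne_neg_self ((h.supp _ ⟨σ, hσ, rfl⟩ e).2 heA)
      -- A word of the face and its opposite differ at `e`. The move between them that reverses `e`
      -- stays in the face and by (P3) has the pairs of `m`, so it gives an element of the
      -- contracted face.
      obtain ⟨m₁, hm₁, γ, hγ, γ', hγ', ⟨L, hL⟩, hem₁, hbetween⟩ := h.exists_move hσ hσ' hne
      have hmm : movePairs m₁ = N := h.movePairs_eq hm₁ hm hem₁ he
      refine ⟨_, ⟨wordSigns γ, ⟨⟨γ, hγ, rfl⟩, γ', hγ', ?_⟩, rfl⟩, fun p hp => ?_⟩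
      · rw [hL.wordSigns_eq (h.words γ hγ).1, hmm]
      · by_cases hpD : p ∈ D
        · rw [hres _ p hpD] at hp
          rw [hres _ p hpD, hres _ p hpD, (hbetween p ?_).1, hXσ p hp]
          rw [hσ'eq, signComp_of_ne hp, hXσ p hp]
        · exact absurd (zeroOn_of_mem hpD) hp
    · rintro _ ⟨S, ⟨hS, hS'⟩, rfl⟩ hconf
      -- `X` and `S` zeroed on `N` are weak orders that vanish on `N`, so conformity on
      -- representatives implies conformity everywhere.
      have hXS : Conf X S := by
        rintro ⟨x, y⟩ hxy
        have hxyA := hXw.off _ hxy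
        obtain ⟨a, ha, b, hb, hab⟩ := h.exists_representatives hm hxyA.1 hxyA.2.1
        have hXab := hab X hXw hXm
        have habD : (a, b) ∈ D := ⟨ha, hb, (hXw.off _ (hXab ▸ hxy)).2.2⟩
        have h1 := hconf (a, b) (by rw [hres _ _ habD, ← hXab]; exact hxy)
        rw [hres _ _ habD, hres _ _ habD] at h1
        have h2 := hab _ (h.isWeakOrder_zeroOn hm hS hS') fun p hp => zeroOn_of_mem hp
        rw [zeroOn_of_notMem fun h => hxy (hXm _ h), zeroOn_of_notMem (hDN _ habD), h1] at h2
        rw [h2, hXab]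
      refine ⟨signComp X (-S), ⟨hX.2 S hS hXS, ?_⟩, by rw [zeroOn_signComp, zeroOn_neg]⟩
      convert hX.2 _ hS' ?_ using 1
      · funext p
        by_cases hp : p ∈ N
        · rw [flipOn_of_mem hp, signComp_of_eq (hXm p hp), signComp_of_eq (hXm p hp), Pi.neg_apply,
            Pi.neg_apply, flipOn_of_mem hp]
        · rw [flipOn_of_notMem hp]
          unfold signComp
          rw [Pi.neg_apply, Pi.neg_apply, flipOn_of_notMem hp]
      · intro p hp
        rw [flipOn_of_notMem fun h => hp (hXm p h), hXS p hp]
  obtain ⟨S, ⟨hS, hS'⟩, hSeq⟩ := (hA _ hface _ ⟨T, ⟨hT, hT'⟩, rfl⟩).1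
  have hoff : ∀ p ∈ offPairs A, p ∉ N → S p = signComp X T p := by
    rintro ⟨x, y⟩ hxy hxyN
    obtain ⟨a, ha, b, hb, hab⟩ := h.exists_representatives hm hxy.1 hxy.2.1
    have h1 := hab X hXw hXm
    have hTw := h.isWeakOrder_zeroOn hm hT hT'
    have h2 := hab _ hTw fun p hp => zeroOn_of_mem hp
    have h3 := hab _ (h.isWeakOrder_zeroOn hm hS hS') fun p hp => zeroOn_of_mem hp
    rw [zeroOn_of_notMem hxyN] at h2 h3
    have hT0 := (h.supp T hT _).2 hxy
    have hne : a ≠ b := by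
      rintro rfl
      rw [hTw.diag] at h2
      exact hT0 h2
    have habD : (a, b) ∈ D := ⟨ha, hb, hne⟩
    rw [zeroOn_of_notMem (hDN _ habD)] at h2 h3
    have h4 := congrFun hSeq (a, b)
    rw [← zeroOn_signComp, hres _ _ habD, hres _ _ habD] at h4
    rw [h3, h4]
    unfold signComp
    rw [h1, h2]
  have hnot : ∀ p, p ∉ offPairs A → S p = signComp X T p := by
    intro p hp
    have h1 : S p = 0 := by
      by_contra h0
      exact hp ((h.supp S hS p).1 h0)
    have h2 : T p = 0 := by
      by_contra h0
      exact hp ((h.supp T hT p).1 h0)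
    have h3 : X p = 0 := by
      by_contra h0
      exact hp (hXw.off p h0)
    rw [h1, signComp_of_eq h3, h2]
  -- Outside `N` the lift `S` is X∘T. On `N`, where `X` vanishes, it is `T` or -T as a whole; in the
  -- second case the other end of the move is taken.
  by_cases hSe : S e = T e
  · convert hS using 1
    funext p
    by_cases hpN : p ∈ N
    · rw [signComp_of_eq (hXm p hpN)]
      by_contra hne
      exact h.reversed_together hm hpN he hS hT (Ne.symm hne) hSe
    · by_cases hpA : p ∈ offPairs A
      · exact (hoff p hpA hpN).symm
      · exact (hnot p hpA).symm
  · convert hS' using 1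
    funext p
    by_cases hpN : p ∈ N
    · have hpA := h.movePairs_subset hm hpN
      rw [signComp_of_eq (hXm p hpN), flipOn_of_mem hpN]
      exact sign_eq_neg_of_ne ((h.supp S hS p).2 hpA) ((h.supp T hT p).2 hpA)
        (h.reversed_together hm he hpN hS hT hSe)
    · rw [flipOn_of_notMem hpN]
      by_cases hpA : p ∈ offPairs A
      · exact (hoff p hpA hpN).symm
      · exact (hnot p hpA).symm

theorem IsContraction.trans {A' A'' : Set α} {P' P'' : Set (List α)}
    (h : IsContraction A P A' P') (h' : IsContraction A' P' A'' P'') : IsContraction A P A'' P'' := by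
  induction h' with
  | refl => exact h
  | step _ hM hm ih => exact IsContraction.step ih hM hm

/-- If all contractions are allowable graphs of permutations, then the antipodal faces are
gated. -/
theorem antipodalGated_of_contractions [Finite α] (A : Set α) (P : Set (List α))
    (h : ∀ A' P', IsContraction A P A' P' → ∃ M', IsAllowableGraph A' P' M') :
    AntipodalGated (wordSigns '' P) := by
  induction hn : A.ncard using Nat.strong_induction_on generalizing A P with
  | _ n ih =>
  obtain ⟨M, hM⟩ := h A P IsContraction.refl
  have hcontract : ∀ m ∈ M, AntipodalGated (wordSigns '' contractWords P m) := fun m hm =>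
    ih _ (hn ▸ Set.ncard_lt_ncard (hM.contractGround_ssubset hm) (Set.toFinite _)) _ _
      (fun A' P' hc => h A' P' ((IsContraction.refl.step hM hm).trans hc)) rfl
  intro X hX
  refine mem_gatedCovectors_of_face hX fun T hT => ?_
  obtain ⟨⟨T₀, hT₀, hXT₀⟩, hanti⟩ := id hX
  -- A second induction, on the number of entries of `X` that `T` violates: `T` walks towards the
  -- element `T₀` of the face.
  induction hk : {p | X p ≠ 0 ∧ T p ≠ X p}.ncard using Nat.strong_induction_on generalizing T with
  | _ k ihk =>
  by_cases hTT₀ : T = T₀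
  · rw [hTT₀, hXT₀.signComp_eq]
    exact hT₀
  obtain ⟨σ, hσ, rfl⟩ := hT
  obtain ⟨σ₀, hσ₀, rfl⟩ := hT₀
  obtain ⟨m, hm, γ, hγ, ⟨L, hL⟩, hsep⟩ :=
    hM.exists_first_move hσ hσ₀ fun h => hTT₀ (by rw [h])
  have hγs := hL.wordSigns_eq (hM.words σ hσ).1
  obtain ⟨e, he⟩ := hM.movePairs_nonempty hm
  have heA := hM.movePairs_subset hm he
  have hS₀ := hanti _ ⟨σ₀, hσ₀, rfl⟩ hXT₀
  -- Within `offPairs A`, `T₀` and X∘(-T₀) differ exactly where `X` vanishes. As pairs of a move are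
  -- reversed together, `X` vanishes on all pairs of the move or on none.
  by_cases hXe : X e = 0
  · refine hM.signComp_mem_of_contract hm (hcontract m hm) hX (fun p hp => ?_) ⟨σ, hσ, rfl⟩
      ⟨γ, hγ, hγs⟩
    by_contra hXp
    refine hM.reversed_together hm he hp ⟨σ₀, hσ₀, rfl⟩ hS₀ ?_ ?_
    · rw [signComp_of_eq hXe]
      exact sign_ne_neg_self ((hM.supp _ ⟨σ₀, hσ₀, rfl⟩ e).2 heA)
    · rw [signComp_of_ne hXp, hXT₀ p hXp]
  · have hXm : ∀ p ∈ movePairs m, X p ≠ 0 := by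
      intro p hp hXp
      refine hM.reversed_together hm hp he ⟨σ₀, hσ₀, rfl⟩ hS₀ ?_ ?_
      · rw [signComp_of_eq hXp]
        exact sign_ne_neg_self ((hM.supp _ ⟨σ₀, hσ₀, rfl⟩ p).2 (hM.movePairs_subset hm hp))
      · rw [signComp_of_ne hXe, hXT₀ e hXe]
    have hγX : ∀ p ∈ movePairs m, wordSigns γ p = X p := by
      intro p hp
      have hpA := hM.movePairs_subset hm hp
      rw [hγs, flipOn_of_mem hp, ← hXT₀ p (hXm p hp)]
      exact (sign_eq_neg_of_ne ((hM.supp _ ⟨σ, hσ, rfl⟩ p).2 hpA)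
        ((hM.supp _ ⟨σ₀, hσ₀, rfl⟩ p).2 hpA) (hsep p hp).symm).symm
    -- The move only reverses pairs on which `X` decides, so the composition does not notice it,
    -- while the new word violates fewer entries of `X`.
    have heq : signComp X (wordSigns σ) = signComp X (wordSigns γ) := by
      funext p
      by_cases hp : p ∈ movePairs m
      · rw [signComp_of_ne (hXm p hp), signComp_of_ne (hXm p hp)]
      · unfold signComp
        rw [hγs, flipOn_of_notMem hp]
    rw [heq]
    refine ihk _ ?_ _ ⟨γ, hγ, rfl⟩ rfl
    rw [← hk]
    refine Set.ncard_lt_ncard ⟨fun p hp => ⟨hp.1, ?_⟩, fun hsub => ?_⟩ (Set.toFinite _)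
    · have hpm : p ∉ movePairs m := fun hpm => hp.2 (hγX p hpm)
      have := hp.2
      rwa [hγs, flipOn_of_notMem hpm] at this
    · have : e ∈ {p | X p ≠ 0 ∧ wordSigns σ p ≠ X p} :=
        ⟨hXe, fun hh => hsep e he (by rw [hh, hXT₀ e hXe])⟩
      exact (hsub this).2 (hγX e he)

end ContractionsGated

/-! ### Walls of a tope in an oriented matroid. -/

section Walls

variable {E : Type*} [Finite E] {D : Set E} {L : Set (E → SignType)}

/-- Below a tope there is a covector that agrees with it where a given covector does. -/
theorem IsCOM.exists_conf (hL : IsCOM L) (hD : ∀ Z ∈ L, ∀ e, Z e ≠ 0 → e ∈ D)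
    {T W : E → SignType} (hT : T ∈ fullTopes D L) (hW : W ∈ L) (hne : W ≠ T) :
    ∃ Z ∈ L, Z ≠ T ∧ Conf Z T ∧ ∀ f, W f = T f → Z f = T f := by
  -- Eliminating a separating element between `T` and `W` preserves every agreement with `T`,
  -- shrinks the separation set, and cannot produce `T` itself because of the new zero.
  induction hn : (sepSet T W).ncard using Nat.strong_induction_on generalizing W with
  | _ n ih =>
  by_cases hsep : ∃ e, e ∈ sepSet T W
  · obtain ⟨e, he⟩ := hsep
    obtain ⟨Z, hZ, hZe, hZf⟩ := hL.elim T hT.1 W hW e he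
    have hZf' : ∀ f, f ∉ sepSet T W → Z f = T f := by
      intro f hf
      rw [hZf f hf]
      by_cases hTf : T f = 0
      · rw [signComp_of_eq hTf, hTf]
        by_contra hWf
        exact (hT.2 f).2 (hD W hW f hWf) hTf
      · exact signComp_of_ne hTf
    have hZT : Z ≠ T := by
      rintro rfl
      exact he.1 hZe
    have hsub : sepSet T Z ⊂ sepSet T W := by
      refine ⟨fun f hf => ?_, fun hsub => ?_⟩
      · by_contra hfW
        have := hf.2
        rw [hZf' f hfW] at this
        exact sign_ne_neg_self hf.1 this
      · have := (hsub he).2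
        rw [hZe] at this
        exact he.1 (SignType.neg_eq_zero_iff.1 this.symm)
    obtain ⟨Z', hZ', hne', hconf, hZ'f⟩ :=
      ih _ (hn ▸ Set.ncard_lt_ncard hsub (Set.toFinite _)) hZ hZT rfl
    refine ⟨Z', hZ', hne', hconf, fun f hf => hZ'f f (hZf' f fun hfs => ?_)⟩
    have := hfs.2
    rw [hf] at this
    exact sign_ne_neg_self hfs.1 this
  · refine ⟨W, hW, hne, fun f hf => ?_, fun f hf => hf⟩
    have hTf := (hT.2 f).2 (hD W hW f hf)
    by_contra hfne
    exact hsep ⟨f, hTf, sign_eq_neg_of_ne hTf hf hfne⟩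

/-- A covector below the tope `T`, which agrees with `T` wherever `T'` does and the zeros of
which in `D` are parallel. -/
theorem IsOrientedMatroid.exists_wall (hL : IsOrientedMatroid L)
    (hD : ∀ Z ∈ L, ∀ e, Z e ≠ 0 → e ∈ D) {T T' : E → SignType} (hT : T ∈ fullTopes D L)
    (hT' : T' ∈ L) (hne : T' ≠ T) :
    ∃ Z ∈ L, Z ≠ T ∧ Conf Z T ∧ (∀ f, T' f = T f → Z f = T f) ∧
      ∀ p ∈ D, ∀ q ∈ D, Z p = 0 → Z q = 0 → ∀ X ∈ L, X p = 0 → X q = 0 := by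
  obtain ⟨Z₀, hZ₀, hZ₀T, hconf₀, hf₀⟩ := hL.isCOM.exists_conf hD hT hT' hne
  -- The wall is a candidate of maximal support.
  obtain ⟨Z, ⟨hZ, hZT, hconf, hf⟩, hmax⟩ := Set.exists_max_image
    {Z | Z ∈ L ∧ Z ≠ T ∧ Conf Z T ∧ ∀ f, T' f = T f → Z f = T f}
    (fun Z => {f | Z f ≠ 0}.ncard) (Set.toFinite _) ⟨Z₀, hZ₀, hZ₀T, hconf₀, hf₀⟩
  refine ⟨Z, hZ, hZT, hconf, hf, fun p hp q hq hZp hZq X hX hXp => ?_⟩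
  by_contra hXq
  have hTp := (hT.2 p).2 hp
  have hTq := (hT.2 q).2 hq
  -- If some covector vanished at p but not at q, then with the right sign Z∘Y would differ from T
  -- and agree with T at q. A covector below T preserving these agreements would be a candidate of
  -- larger support.
  obtain ⟨Y, hY, hYp, hYq⟩ : ∃ Y ∈ L, Y p = 0 ∧ Y q = T q := by
    by_cases h : X q = T q
    · exact ⟨X, hX, hXp, h⟩
    · refine ⟨_, hL.neg_mem X hX, by simp [hXp], (sign_eq_neg_of_ne hXq hTq h).symm⟩
  have hne' : signComp Z Y ≠ T := by
    intro h
    have := congrFun h p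
    rw [signComp_of_eq hZp, hYp] at this
    exact hTp this.symm
  obtain ⟨W, hW, hWT, hWconf, hWf⟩ :=
    hL.isCOM.exists_conf hD hT (hL.comp_mem Z hZ Y hY) hne'
  have hZW : ∀ f, Z f ≠ 0 → W f = T f := fun f hZf =>
    hWf f (by rw [signComp_of_ne hZf, hconf f hZf])
  have hWq : W q = T q := hWf q (by rw [signComp_of_eq hZq, hYq])
  have hle := hmax W ⟨hW, hWT, hWconf, fun f hf' => by
    by_cases hZf : Z f = 0
    · have hTf := (hf f hf').symm.trans hZf
      by_contra hne
      have hWf0 : W f ≠ 0 := fun h0 => hne (h0.trans hTf.symm)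
      exact hne (hWconf f hWf0).symm
    · exact hZW f hZf⟩
  refine absurd hle (not_le.2 (Set.ncard_lt_ncard ⟨fun f hZf => ?_, fun hsub => ?_⟩
    (Set.toFinite _)))
  · change W f ≠ 0
    rw [hZW f hZf, hconf f hZf]
    exact hZf
  · exact hsub (show W q ≠ 0 from hWq ▸ hTq) hZq

end Walls

/-! ### The permutations of a sweep oriented matroid form an allowable graph. -/

section SweepGraphs

variable {α : Type*} [LinearOrder α] {A : Set α} {P : Set (List α)}

/-- The move that passes through a weak order. -/
theorem IsWeakOrder.exists_blockMove [Finite α] {Z : α × α → SignType} (hZ : IsWeakOrder A Z)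
    {w : List α} (hw : IsWordOn A w) (hconf : Conf Z (wordSigns w)) (hne : Z ≠ wordSigns w) :
    ∃ m γ, IsMove m w γ ∧ IsWordOn A γ ∧ movePairs m = {p | p ∈ offPairs A ∧ Z p = 0} ∧
      wordSigns γ = signComp Z (-wordSigns w) := by
  obtain ⟨I, hI, rfl⟩ := hZ.exists_isPartitionOf
  have hmem : ∀ a b, a ≠ b → ((∃ B ∈ lexBlocks I w, a ∈ B ∧ b ∈ B) ↔
      (a ∈ A ∧ b ∈ A) ∧ partSigns I (a, b) = 0) := by
    intro a b _
    constructor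
    · rintro ⟨_, hblk, ha, hb⟩
      obtain ⟨B, hB, rfl⟩ := mem_lexBlocks.1 hblk
      simp only [List.mem_filter, decide_eq_true_eq] at ha hb
      exact ⟨⟨(hw.2 a).1 ha.1, (hw.2 b).1 hb.1⟩, hI.partSigns_of_block hB ha.2 hb.2⟩
    · rintro ⟨⟨ha, hb⟩, h0⟩
      obtain ⟨B, hB, haB, hbB⟩ := hI.exists_block ha hb h0
      exact ⟨_, mem_lexBlocks.2 ⟨B, hB, rfl⟩, by simp [(hw.2 a).2 ha, haB],
        by simp [(hw.2 b).2 hb, hbB]⟩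
  -- Because `w` conforms to `I`, each part of `I` is a block of consecutive letters, and reversing
  -- every block is composing `I` with the reversed word.
  have hblock : BlockMove (lexBlocks I w) {b | b ∈ lexBlocks I w ∧ 2 ≤ b.length} w
      (lex I w.reverse) := by
    refine ⟨?_, (hI.lex_eq_self_iff hw).2 hconf, ?_, rfl, ?_⟩
    · intro b hb
      obtain ⟨B, hB, rfl⟩ := mem_lexBlocks.1 hb
      obtain ⟨a, ha⟩ := hI.nonempty B hB
      have haw : a ∈ w := (hw.2 a).2 ((hI.cover a).2 ⟨B, hB, ha⟩)
      exact List.ne_nil_of_mem (a := a) (by simp [haw, ha])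
    · rw [lexBlocks_reverse]; rfl
    · obtain ⟨⟨a, b⟩, hab⟩ : ∃ p, partSigns I p ≠ wordSigns w p := by
        by_contra h
        push Not at h
        exact hne (funext h)
      have h0 : partSigns I (a, b) = 0 := by
        by_contra h0
        exact hab (hconf _ h0).symm
      have hp := (hw.full (a, b)).1 fun h => hab (h0.trans h.symm)
      obtain ⟨B, hB, ha, hb⟩ := (hmem a b hp.2.2).2 ⟨⟨hp.1, hp.2.1⟩, h0⟩
      exact ⟨B, hB, two_le_length ha hb hp.2.2⟩
  refine ⟨_, _, ⟨_, hblock⟩, hI.isWordOn_lex hw.reverse, ?_, ?_⟩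
  · ext ⟨a, b⟩
    rw [hblock.mem_movePairs_iff]
    constructor
    · rintro ⟨hab, h⟩
      have := (hmem a b hab).1 h
      exact ⟨⟨this.1.1, this.1.2, hab⟩, this.2⟩
    · rintro ⟨⟨ha, hb, hab⟩, h0⟩
      exact ⟨hab, (hmem a b hab).2 ⟨⟨ha, hb⟩, h0⟩⟩
  · rw [hI.wordSigns_lex hw.reverse, wordSigns_reverse hw.1]

/-- The permutations of a sweep oriented matroid form an allowable graph of permutations. -/
theorem IsSweepGraph.exists_isAllowableGraph [Finite α] (h : IsSweepGraph A P)
    (hP : ∀ w ∈ P, IsWordOn A w) : ∃ M, IsAllowableGraph A P M := by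
  obtain ⟨ℒ, hℒ, hweak, htope⟩ := h
  have hD : ∀ Z ∈ ℒ, ∀ e, Z e ≠ 0 → e ∈ offPairs A := fun Z hZ => (hweak Z hZ).off
  -- Only moves whose pairs form a whole parallel class are admitted, which makes (P3) automatic.
  -- Passing through a wall is such a move, since the zeros of the wall in `offPairs A` are one
  -- parallel class.
  set M : Set (Set (List α)) := {m | (∃ w ∈ P, ∃ w' ∈ P, IsMove m w w') ∧
    ∀ p ∈ movePairs m, movePairs m = {q | q ∈ offPairs A ∧ ∀ X ∈ ℒ, X p = 0 ↔ X q = 0}} with hM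
  have hfirst : ∀ σ ∈ P, ∀ σ' ∈ P, σ ≠ σ' → ∃ m ∈ M, ∃ γ ∈ P, IsMove m σ γ ∧
      ∀ q ∈ movePairs m, wordSigns σ' q ≠ wordSigns σ q := by
    intro σ hσ σ' hσ' hne
    have hT : wordSigns σ ∈ fullTopes (offPairs A) ℒ := htope ▸ ⟨σ, hσ, rfl⟩
    have hT' : wordSigns σ' ∈ fullTopes (offPairs A) ℒ := htope ▸ ⟨σ', hσ', rfl⟩
    have hne' : wordSigns σ' ≠ wordSigns σ := fun heq => hne ((hP σ hσ).ext (hP σ' hσ') heq.symm)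
    obtain ⟨Z, hZ, hZT, hconf, hZT', hpar⟩ := hℒ.exists_wall hD hT hT'.1 hne'
    obtain ⟨m, γ, hmove, hγ, hmp, hγs⟩ := (hweak Z hZ).exists_blockMove (hP σ hσ) hconf hZT
    have hγP : γ ∈ P := by
      rw [← wordSigns_mem_image_iff hP hγ, ← htope]
      exact ⟨hγs ▸ hℒ.comp_mem Z hZ _ (hℒ.neg_mem _ hT.1), hγ.full⟩
    refine ⟨m, ⟨⟨σ, hσ, γ, hγP, hmove⟩, fun p hp => ?_⟩, γ, hγP, hmove, fun q hq heq => ?_⟩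
    · rw [hmp] at hp ⊢
      ext q
      constructor
      · rintro ⟨hq, hZq⟩
        exact ⟨hq, fun X hX => ⟨hpar p hp.1 q hq hp.2 hZq X hX, hpar q hq p hp.1 hZq hp.2 X hX⟩⟩
      · rintro ⟨hq, hX⟩
        exact ⟨hq, (hX Z hZ).1 hp.2⟩
    · rw [hmp] at hq
      exact ((hP σ hσ).full q).2 hq.1 ((hZT' q heq).symm.trans hq.2)
  refine ⟨M, hP, fun m hm => hm.1, fun w hw => ?_, fun σ hσ σ' hσ' => ?_, fun m hm s hs => ?_⟩
  · rw [← wordSigns_mem_image_iff hP (hP w hw).reverse, wordSigns_reverse (hP w hw).1, ← htope]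
    have hT : wordSigns w ∈ fullTopes (offPairs A) ℒ := htope ▸ ⟨w, hw, rfl⟩
    exact ⟨hℒ.neg_mem _ hT.1, fun e => by rw [← hT.2 e]; simp⟩
  · induction hn : {p | wordSigns σ' p ≠ wordSigns σ p}.ncard
      using Nat.strong_induction_on generalizing σ with
    | _ n ih =>
    by_cases hne : σ = σ'
    · exact ⟨0, fun _ => σ, fun _ => ∅, rfl, hne, fun _ _ => hσ, by simp, by simp⟩
    obtain ⟨m, hm, γ, hγ, ⟨L, hL⟩, hsep⟩ := hfirst σ hσ σ' hσ' hne
    have hnd := (hP σ hσ).1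
    have hmove : ∀ p ∈ movePairs m, wordSigns σ' p = wordSigns γ p := by
      intro p hp
      have hpA := hL.movePairs_subset (hP σ hσ) hp
      rw [hL.wordSigns_of_mem hnd hp]
      exact sign_eq_neg_of_ne (((hP σ hσ).full p).2 hpA) (((hP σ' hσ').full p).2 hpA)
        (hsep p hp).symm
    have hlt : {p | wordSigns σ' p ≠ wordSigns γ p} ⊂ {p | wordSigns σ' p ≠ wordSigns σ p} := by
      refine ⟨fun p hp => ?_, fun hsub => ?_⟩
      · have hpm : p ∉ movePairs m := fun hpm => hp (hmove p hpm)
        change wordSigns σ' p ≠ wordSigns σ p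
        rw [← hL.wordSigns_of_notMem hnd hpm]
        exact hp
      · obtain ⟨p, hp⟩ := hL.movePairs_nonempty hnd
        exact hsub (hsep p hp) (hmove p hp)
    obtain ⟨l, w, s, hw0, hwl, hwP, hs, hdisj⟩ :=
      ih _ (hn ▸ Set.ncard_lt_ncard hlt (Set.toFinite _)) γ hγ rfl
    have hseq := sequence_signs (fun k hk => (hP _ (hwP k hk)).1) (fun k hk => (hs k hk).2) hdisj
    refine ⟨l + 1, fun k => k.casesOn σ w, fun k => k.casesOn m s, rfl, hwl, ?_, ?_, ?_⟩
    · rintro (_ | k) hk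
      · exact hσ
      · exact hwP k (by omega)
    · rintro (_ | k) hk
      · exact ⟨hm, L, by change BlockMove L m σ (w 0); rw [hw0]; exact hL⟩
      · exact hs k (by omega)
    · rintro (_ | j) (_ | k) hjk hk
      · omega
      -- A pair of the first move has its final sign already in γ, so the rest of the sequence does
      -- not reverse it.
      · refine Set.disjoint_left.2 fun p hp hp' => ?_
        have hpm : p ∈ movePairs m := (mem_invSet_iff hp.1).1 hp
        have hpk : p ∈ movePairs (s k) := (mem_invSet_iff hp.1).1 hp'
        rcases hseq p l le_rfl with ⟨h1, -⟩ | ⟨-, h1⟩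
        · rw [hwl, hw0, hmove p hpm] at h1
          exact sign_ne_neg_self (((hP γ hγ).full p).2 (hL.movePairs_subset (hP σ hσ) hpm)) h1
        · exact h1 k (by omega) hpk
      · omega
      · exact hdisj j k (by omega) (by omega)
  · by_cases hms : Disjoint (invSet m) (invSet s)
    · exact Or.inr hms
    · left
      obtain ⟨p, hp, hp'⟩ := Set.not_disjoint_iff.1 hms
      have heq : movePairs m = movePairs s := by
        rw [hm.2 p ((mem_invSet_iff hp.1).1 hp), hs.2 p ((mem_invSet_iff hp.1).1 hp')]
      ext ⟨a, b⟩
      constructor <;> intro hab <;>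
        exact (mem_invSet_iff hab.1).2 (by
          have := (mem_invSet_iff hab.1).1 hab
          first | rwa [← heq] | rwa [heq])

/-- The allowable structure that each step of the contraction carries is what keeps the sweep
property; none has to be constructed along the way. -/
theorem IsSweepGraph.contraction [Finite α] (h : IsSweepGraph A P)
    (hP : ∀ w ∈ P, IsWordOn A w) {A' : Set α} {P' : Set (List α)} (hc : IsContraction A P A' P') :
    IsSweepGraph A' P' ∧ ∀ w ∈ P', IsWordOn A' w := by
  induction hc with
  | refl => exact ⟨h, hP⟩
  | step _ hM hm ih =>
    exact ⟨hM.isSweepGraph_contract hm ih.1, fun v hv => hM.isWordOn_of_mem_contractWords hv⟩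

end SweepGraphs

end Sweep

/-! ### The equivalence, assembled through `AntipodalGated`. -/

theorem mainTheorem11 (n : ℕ) (P : Set (Equiv.Perm (Fin n))) (M : Set (Set (List (Fin n))))
    (hne : P.Nonempty)
    (hP : Sweep.IsAllowableGraph Set.univ (Sweep.permWords P) M) :
    List.TFAE [
      Sweep.ArisesFromSweepOrientedMatroid P,
      ∀ I : List (Finset (Fin n)),
        Sweep.IsPotentialSweep (Sweep.permWords P) I → Sweep.IsSweep (Sweep.permWords P) I,
      ∀ (A' : Set (Fin n)) (P' : Set (List (Fin n))),
        Sweep.IsContraction Set.univ (Sweep.permWords P) A' P' →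
          ∃ M' : Set (Set (List (Fin n))), Sweep.IsAllowableGraph A' P' M',
      Sweep.InFQMinus (Sweep.moveGraph (Sweep.permWords P) M)] := by
  have hne' : (Sweep.permWords P).Nonempty := hne.image _
  have hsweep : Sweep.AntipodalGated (Sweep.wordSigns '' Sweep.permWords P) →
      Sweep.IsSweepGraph Set.univ (Sweep.permWords P) := hP.isSweepGraph hne'
  tfae_have 1 → 2 := fun h =>
    hP.forall_isSweep_iff.2 (Sweep.isSweepGraph_of_arises h).antipodalGated
  tfae_have 2 → 3 := fun h A' P' hc => by
    have := (hsweep (hP.forall_isSweep_iff.1 h)).contraction hP.words hc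
    exact this.1.exists_isAllowableGraph this.2
  tfae_have 3 → 4 := fun h =>
    (hP.inFQMinus_iff hne').2 (Sweep.antipodalGated_of_contractions _ _ h)
  tfae_have 4 → 1 := fun h =>
    Sweep.arises_of_isSweepGraph hne (hsweep ((hP.inFQMinus_iff hne').1 h))
  tfae_finish
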